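/- **Setting.** Let $G$ be a directed graph without parallel edges, with $n$ vertices and $m\ge 2$ edges, positive integral edge lengths $\ell$ and capacities $U$, and two distinct vertices $s$ (source) and $t$ (sink). Put $U(u,v)=0$ if $(u,v)\notin E(G)$, $\Delta(v)=U(s,v)$, $\nabla(v)=U(v,t)$, and let $\deg^+(v)$ be the out-degree of $v$. For an integer $h\ge 1$ let $\mathcal P_h$ be the set of simple $s$-$t$ paths of length $\ell(P)\le h$. A feasible $h$-length flow is a function $f:\mathcal P_h\to\mathbb R_{\ge0}$ with $f(e):=\sum_{P\ni e}f(P)\le U(e)$ for every edge $e$; its value is $\mathrm{val}(f)=\sum_P f(P)$. A feasible $h$-length moving cut is a function $w:E(G)\to\mathbb R_{\ge0}$ with $\sum_{e\in P}w(e)\ge1$ for all $P\in\mathcal P_h$; its size is $|w|=\sum_e U(e)w(e)$. A feasible pair $(f,w)$ is $\alpha$-approximate if $|w|\le\alpha\cdot\mathrm{val}(f)$. **Theorem.** There are a deterministic algorithm and absolute implied constants such that the following holds for all $G$ as above, all $0<\delta<1$ and all integers $h\ge1$. Let $\zeta=6/\delta+3$, and assume that every edge into $t$ has length $1$ and that $\sum_e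 U(e)\le m^{\zeta}$. Given $n,m,s,t,h,\delta$ and access to the adjacency lists of $G$ (out-degree of a vertex; head, length and capacity of the $i$-th edge in the list of a vertex; sink capacity $\nabla(v)$ of a vertex), the algorithm computes an $h$-length flow $f$ (as a list of paths with values) and functions $w$, $w_{\min}$ on $E(G)$ (each as a default value and a list of edges with their values) such that: 1. $(f,w)$ is a feasible pair, which is $O(\log n/\delta)$-approximate if $\mathcal P_h\neq\emptyset$; moreover, for some $\eta=\Theta(\delta^2/\log m)$, all the values $f(P)/\eta$ are integers and $$w(e)=\frac{(1+\delta/6)^{f(e)/(\eta\,U(e))}}{m^{\zeta}}\qquad\text{for every } e\in E(G);$$ 2. $(f,w_{\min})$ is a feasible pair that is $(2+\delta)$-approximate. The running time is, for every real $c\ge1$ simultaneously, at most $$\mathrm{poly}(h,1/\delta,\log n)\cdot\Bigl(1+\sum_{v\in V(G)\setminus\{s,t\}}\bigl(c\,\Delta(v)+\max\{\deg^+(v)-c\,\nabla(v),0\}\bigr)\Bigr).$$ Time is counted on a real RAM: unit cost for each memory access, adjacency-list query, addition, subtraction, halving and comparison of natural numbers, and field operation, power, logarithm and comparison of real numbers.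 -/

import Mathlib

namespace LocalFlow

/-! ### Directed networks given by adjacency lists -/

/-- A directed graph on the vertices `0, …, n - 1`, given by its adjacency lists (in arbitrary
order, without parallel edges), with positive integral edge lengths and capacities and with
distinct source and sink. The values of `len` and `cap` off the edges are irrelevant. -/
structure Network (n : ℕ) where
  out : Fin n → List (Fin n)
  nodup : ∀ u, (out u).Nodup
  len : Fin n → Fin n → ℕ
  cap : Fin n → Fin n → ℕ
  len_pos : ∀ u, ∀ v ∈ out u, 0 < len u v
  cap_pos : ∀ u, ∀ v ∈ out u, 0 < cap u v
  s : Fin n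
  t : Fin n
  s_ne_t : s ≠ t

variable {n : ℕ}

namespace Network

/-- The edge set `E(G)`. -/
def edges (N : Network n) : Finset (Fin n × Fin n) :=
  Finset.univ.filter fun e => e.2 ∈ N.out e.1

/-- The number `m` of edges. -/
def m (N : Network n) : ℕ := N.edges.card

/-- The out-degree. -/
def outDeg (N : Network n) (v : Fin n) : ℕ := (N.out v).length

/-- The capacity `U(u,v)`, which is `0` if there is no edge from `u` to `v`. -/
def U (N : Network n) (u v : Fin n) : ℕ := if v ∈ N.out u then N.cap u v else 0

/-- The source capacity `Δ(v) = U(s,v)`. -/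
def srcCap (N : Network n) (v : Fin n) : ℕ := N.U N.s v

/-- The sink capacity `∇(v) = U(v,t)`. -/
def sinkCap (N : Network n) (v : Fin n) : ℕ := N.U v N.t

end Network

/-- The consecutive pairs of a vertex sequence. -/
def pathEdges (P : List (Fin n)) : List (Fin n × Fin n) := P.zip P.tail

namespace Network

/-- The length `ℓ(P)` of a vertex sequence. -/
def pathLen (N : Network n) (P : List (Fin n)) : ℕ :=
  ((pathEdges P).map fun e => N.len e.1 e.2).sum

/-- `P` belongs to `𝒫_h(s,t)`: it is (the vertex sequence of) a simple path from `s` to `t` of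
length at most `h`. -/
def IsHPath (N : Network n) (h : ℕ) (P : List (Fin n)) : Prop :=
  P.head? = some N.s ∧ P.getLast? = some N.t ∧ P.Nodup ∧
    (∀ e ∈ pathEdges P, e ∈ N.edges) ∧ N.pathLen P ≤ h

end Network

/-! ### Length-constrained flows and moving cuts -/

/-- The flow `f(e)` through an edge, for an assignment `f` of values to paths. -/
noncomputable def edgeFlow (f : List (Fin n) →₀ ℝ) (e : Fin n × Fin n) : ℝ :=
  f.sum fun P x => if e ∈ pathEdges P then x else 0

/-- The value `val(f)` of a flow. -/
noncomputable def flowValue (f : List (Fin n) →₀ ℝ) : ℝ := f.sum fun _ x => x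

namespace Network

/-- `f` is a feasible `h`-length `s`-`t` flow. -/
def IsHLengthFlow (N : Network n) (h : ℕ) (f : List (Fin n) →₀ ℝ) : Prop :=
  (∀ P, 0 ≤ f P) ∧ (∀ P ∈ f.support, N.IsHPath h P) ∧
    ∀ e ∈ N.edges, edgeFlow f e ≤ N.U e.1 e.2

/-- `w` is a feasible `h`-length fractional moving cut. -/
def IsMovingCut (N : Network n) (h : ℕ) (w : Fin n × Fin n → ℝ) : Prop :=
  (∀ e ∈ N.edges, 0 ≤ w e) ∧ ∀ P, N.IsHPath h P → 1 ≤ ((pathEdges P).map w).sum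

/-- The size `|w|` of a moving cut. -/
noncomputable def cutSize (N : Network n) (w : Fin n × Fin n → ℝ) : ℝ :=
  ∑ e ∈ N.edges, N.U e.1 e.2 * w e

/-- `(f, w)` is a feasible pair of an `h`-length flow and an `h`-length moving cut. -/
def IsFeasiblePair (N : Network n) (h : ℕ) (f : List (Fin n) →₀ ℝ)
    (w : Fin n × Fin n → ℝ) : Prop :=
  N.IsHLengthFlow h f ∧ N.IsMovingCut h w

/-- `∑_{v ≠ s,t} (c·Δ(v) + max{deg⁺(v) − c·∇(v), 0})`. -/
noncomputable def localSize (N : Network n) (c : ℝ) : ℝ :=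
  ∑ v ∈ Finset.univ.filter (fun v => v ≠ N.s ∧ v ≠ N.t),
    (c * N.srcCap v + max (N.outDeg v - c * N.sinkCap v) 0)

/-! ### Oracle access to the input

Vertices are named by numbers; out-of-range queries return `0`. -/

/-- The out-degree of vertex `v`. -/
def degQuery (N : Network n) (v : ℕ) : ℕ := if hv : v < n then N.outDeg ⟨v, hv⟩ else 0

/-- The `i`-th entry of the adjacency list of `v`, evaluated by `g`. -/
def entryQuery (N : Network n) (g : Fin n → Fin n → ℕ) (v i : ℕ) : ℕ :=
  if hv : v < n then (((N.out ⟨v, hv⟩)[i]?).map (g ⟨v, hv⟩)).getD 0 else 0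

/-- The sink capacity of vertex `v`. -/
def sinkQuery (N : Network n) (v : ℕ) : ℕ := if hv : v < n then N.sinkCap ⟨v, hv⟩ else 0

end Network

/-! ### The machine model: a real RAM with structured programs

Memory consists of arrays of natural numbers and arrays of real numbers with two indices. Array
names are constants of the program, indices are computed. On natural numbers there are addition,
truncated subtraction and halving (no multiplication), on real numbers the field operations, powers
and the logarithm, but no rounding and no real constants other than those built from natural
numbers and the input `δ`. Every operation, comparison, memory access and query has unit cost. -/

/-- The memory. -/
structure Mem where
  nat : ℕ → ℕ → ℕ → ℕ
  real : ℕ → ℕ → ℕ → ℝ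

/-- The initial memory: all cells are zero. -/
def Mem.init : Mem := ⟨fun _ _ _ => 0, fun _ _ _ => 0⟩

/-- Overwrite a cell holding a natural number. -/
def Mem.setNat (σ : Mem) (a i j x : ℕ) : Mem :=
  { σ with nat := fun a' i' j' => if a' = a ∧ i' = i ∧ j' = j then x else σ.nat a' i' j' }

/-- Overwrite a cell holding a real number. -/
noncomputable def Mem.setReal (σ : Mem) (a i j : ℕ) (x : ℝ) : Mem :=
  { σ with real := fun a' i' j' => if a' = a ∧ i' = i ∧ j' = j then x else σ.real a' i' j' }

/-- The input: the network with the parameters `h` and `δ`. -/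
structure Input (n : ℕ) where
  N : Network n
  h : ℕ
  δ : ℝ

/-- Expressions for natural numbers. -/
inductive NExp where
  | const (k : ℕ)
  | inN | inM | inH | inS | inT
  | get (a : ℕ) (i j : NExp)
  | add (x y : NExp)
  | sub (x y : NExp)
  | half (x : NExp)
  | deg (v : NExp)
  | head (v i : NExp)
  | len (v i : NExp)
  | cap (v i : NExp)
  | sinkCap (v : NExp)

/-- Expressions for real numbers. -/
inductive RExp where
  | ofNat (x : NExp)
  | inδ
  | get (a : ℕ) (i j : NExp)
  | add (x y : RExp)
  | sub (x y : RExp)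
  | mul (x y : RExp)
  | div (x y : RExp)
  | pow (x y : RExp)
  | log (x : RExp)

/-- Tests. -/
inductive BExp where
  | ltN (x y : NExp)
  | ltR (x y : RExp)
  | not (b : BExp)
  | and (b c : BExp)

/-- Programs. -/
inductive Cmd where
  | skip
  | setN (a : ℕ) (i j x : NExp)
  | setR (a : ℕ) (i j : NExp) (x : RExp)
  | seq (p q : Cmd)
  | ite (b : BExp) (p q : Cmd)
  | loop (b : BExp) (p : Cmd)

/-- The value of an expression. -/
def NExp.eval (I : Input n) (σ : Mem) : NExp → ℕ
  | const k => k
  | inN => n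
  | inM => I.N.m
  | inH => I.h
  | inS => I.N.s
  | inT => I.N.t
  | get a i j => σ.nat a (i.eval I σ) (j.eval I σ)
  | add x y => x.eval I σ + y.eval I σ
  | sub x y => x.eval I σ - y.eval I σ
  | half x => x.eval I σ / 2
  | deg v => I.N.degQuery (v.eval I σ)
  | head v i => I.N.entryQuery (fun _ u => u) (v.eval I σ) (i.eval I σ)
  | len v i => I.N.entryQuery I.N.len (v.eval I σ) (i.eval I σ)
  | cap v i => I.N.entryQuery I.N.cap (v.eval I σ) (i.eval I σ)
  | sinkCap v => I.N.sinkQuery (v.eval I σ)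

/-- The number of steps for evaluating an expression. -/
def NExp.cost : NExp → ℕ
  | const _ | inN | inM | inH | inS | inT => 1
  | get _ i j => i.cost + j.cost + 1
  | add x y | sub x y => x.cost + y.cost + 1
  | half x => x.cost + 1
  | deg v | sinkCap v => v.cost + 1
  | head v i | len v i | cap v i => v.cost + i.cost + 1

/-- The value of an expression. -/
noncomputable def RExp.eval (I : Input n) (σ : Mem) : RExp → ℝ
  | ofNat x => x.eval I σ
  | inδ => I.δ
  | get a i j => σ.real a (i.eval I σ) (j.eval I σ)
  | add x y => x.eval I σ + y.eval I σ
  | sub x y => x.eval I σ - y.eval I σ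
  | mul x y => x.eval I σ * y.eval I σ
  | div x y => x.eval I σ / y.eval I σ
  | pow x y => x.eval I σ ^ y.eval I σ
  | log x => Real.log (x.eval I σ)

/-- The number of steps for evaluating an expression. -/
def RExp.cost : RExp → ℕ
  | ofNat x => x.cost + 1
  | inδ => 1
  | get _ i j => i.cost + j.cost + 1
  | add x y | sub x y | mul x y | div x y | pow x y => x.cost + y.cost + 1
  | log x => x.cost + 1

/-- The truth value of a test. -/
def BExp.Holds (I : Input n) (σ : Mem) : BExp → Prop
  | ltN x y => x.eval I σ < y.eval I σ
  | ltR x y => x.eval I σ < y.eval I σ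
  | not b => ¬ b.Holds I σ
  | and b c => b.Holds I σ ∧ c.Holds I σ

/-- The number of steps for evaluating a test. -/
def BExp.cost : BExp → ℕ
  | ltN x y => x.cost + y.cost + 1
  | ltR x y => x.cost + y.cost + 1
  | not b => b.cost + 1
  | and b c => b.cost + c.cost + 1

/-- `Exec I p σ T τ`: on input `I`, the program `p` started in memory `σ` halts after `T` steps in
memory `τ`. -/
inductive Exec (I : Input n) : Cmd → Mem → ℕ → Mem → Prop where
  | skip (σ : Mem) : Exec I .skip σ 1 σ
  | setN (σ : Mem) (a : ℕ) (i j x : NExp) :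
      Exec I (.setN a i j x) σ (i.cost + j.cost + x.cost + 1)
        (σ.setNat a (i.eval I σ) (j.eval I σ) (x.eval I σ))
  | setR (σ : Mem) (a : ℕ) (i j : NExp) (x : RExp) :
      Exec I (.setR a i j x) σ (i.cost + j.cost + x.cost + 1)
        (σ.setReal a (i.eval I σ) (j.eval I σ) (x.eval I σ))
  | seq {p q : Cmd} {σ τ ρ : Mem} {S T : ℕ} :
      Exec I p σ S τ → Exec I q τ T ρ → Exec I (.seq p q) σ (S + T) ρ
  | ite_true {b : BExp} {p q : Cmd} {σ τ : Mem} {T : ℕ} :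
      b.Holds I σ → Exec I p σ T τ → Exec I (.ite b p q) σ (b.cost + T) τ
  | ite_false {b : BExp} {p q : Cmd} {σ τ : Mem} {T : ℕ} :
      ¬ b.Holds I σ → Exec I q σ T τ → Exec I (.ite b p q) σ (b.cost + T) τ
  | loop_true {b : BExp} {p : Cmd} {σ τ ρ : Mem} {S T : ℕ} :
      b.Holds I σ → Exec I p σ S τ → Exec I (.loop b p) τ T ρ →
        Exec I (.loop b p) σ (b.cost + S + T) ρ
  | loop_false {b : BExp} {p : Cmd} {σ : Mem} :
      ¬ b.Holds I σ → Exec I (.loop b p) σ b.cost σ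

/-! ### Reading the output -/

/-- The `j`-th vertex sequence of the output. -/
def Mem.outPath (τ : Mem) (j : ℕ) : List ℕ := (List.range (τ.nat 0 1 j)).map (τ.nat 1 j)

/-- The output holds the flow `f` as a list of `h`-length `s`-`t` paths with values, the flow value
of a path being the sum of the values listed with it. -/
def HoldsFlow (I : Input n) (τ : Mem) (f : List (Fin n) →₀ ℝ) : Prop :=
  (∀ j < τ.nat 0 0 0, 0 ≤ τ.real 0 0 j ∧
      ∃ P : List (Fin n), I.N.IsHPath I.h P ∧ τ.outPath j = P.map Fin.val) ∧
    ∀ P : List (Fin n), f P =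
      ∑ j ∈ Finset.range (τ.nat 0 0 0), if τ.outPath j = P.map Fin.val then τ.real 0 0 j else 0

/-- Array `a` of the output holds the edge function `w`, as a default value together with a list of
edges and their values; edges that are not listed have the default value. -/
def HoldsCut (I : Input n) (τ : Mem) (a : ℕ) (w : Fin n × Fin n → ℝ) : Prop :=
  (∀ j < τ.nat a 0 0, ∃ e ∈ I.N.edges,
      τ.nat a 1 j = e.1 ∧ τ.nat a 2 j = e.2 ∧ w e = τ.real a 1 j) ∧
    ∀ e ∈ I.N.edges, (∀ j < τ.nat a 0 0, ¬ (τ.nat a 1 j = e.1 ∧ τ.nat a 2 j = e.2)) →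
      w e = τ.real a 0 0

end LocalFlow

open LocalFlow

/-! The algorithm is the multiplicative weights method for packing paths, with a push-relabel search
in place of shortest path computations. Weights are kept as excess `Input.wt` over the initial
weight, in multiples of that weight, so an edge without flow has excess `0`. By Bernoulli's
inequality, sending a bottleneck amount `b` along `P` raises the volume `Input.vol` by at most
`(δ/6)·b·(wt(P) + |P|)` (`Input.vol_add_le`).

Every vertex `v` has, for every length budget `d`, a label on a geometric scale of ratio `1 +
1/(4h)`. Up to a loss of one gap per edge, it is a lower bound for the excess weight of the paths
from `v` to `t` of length at most `d` (`LabelInv.level_le_sum`). The label of the source therefore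
certifies a distance (`LabelInv.certified_le`), and an augmenting path weighs at most about `5/3` of
it (`PathInv.sum_wt_le`, `level_succ_le`). The run ends when the certified distance reaches `m^ζ`.

Approximation: the current weights are then a moving cut, and summing the increments of the volume
bounds its size by `O(δ)` times the number of units sent, which is the `O(log n/δ)` bound. For the
better cut, the program records the smallest ratio of volume to certified distance. If `β` is at
most this ratio, the increments are at most `(const/β)·b` times the volume plus `β·m`, so the volume
grows at most exponentially in the units sent, while it ends at `β·m^ζ` or more. Comparing
logarithms gives `2 + δ` (`FlowInv.potential`, `FlowInv.num_div_den_le`). Feasibility of the flow is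
read off from the upper bound for the weights (`Input.Good.eta_mul_le`).

Locality: zero labels are correct at the start, so nothing needs initialization. The list of a
vertex is scanned only if it has no edge to the sink or this edge has excess above `1/(4h)`; in the
second case the edge carries at least `∇(v)/h` units (`Input.cap_le_of_wt`). The flow into `t` from
inner vertices is at most the flow from `s` into inner vertices, which the capacities `Δ` bound, so
the scanned degrees are bounded by the local size (`FlowInv.satDeg_le`). All running time is charged
to `State.work`, a potential that increases in every step (`step_run`) and is bounded in `work_le`.
The parameter `c` occurs in the analysis only. -/

namespace LocalFlow

section

variable {n : ℕ}

/-! ### Parameters of the algorithm -/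

namespace Input

/-- The growth factor `1 + δ/6` of the weights. -/
noncomputable def growth (I : Input n) : ℝ := 1 + I.δ / 6

/-- The base of the geometric scale on which distance labels live. -/
noncomputable def base (I : Input n) : ℝ := 1 + 1 / (4 * (I.h : ℝ))

/-- The distance that a label `j` stands for. -/
noncomputable def level (I : Input n) (j : ℕ) : ℝ := I.base ^ j - 1

/-- The distance between the labels `j` and `j + 1`. -/
noncomputable def gap (I : Input n) (j : ℕ) : ℝ := 1 / (4 * (I.h : ℝ)) * I.base ^ j

/-- The reciprocal of the initial weight of an edge. -/
noncomputable def thr (I : Input n) : ℝ := (I.N.m : ℝ) ^ (6 / I.δ + 3)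

/-- The unit of flow. -/
noncomputable def eta (I : Input n) : ℝ :=
  Real.log I.growth / ((6 / I.δ + 4) * Real.log I.N.m)

/-- The weight of an edge in excess of the initial one and in multiples of it, for a flow of `g`
units. -/
noncomputable def wt (I : Input n) (g : Fin n × Fin n → ℕ) (e : Fin n × Fin n) : ℝ :=
  I.growth ^ ((g e : ℝ) / (I.N.U e.1 e.2 : ℝ)) - 1

/-- The lower bound for the weight of every path that a label `j` of the source certifies. -/
noncomputable def certified (I : Input n) (j : ℕ) : ℝ := I.level j - I.h * I.gap j

/-- The hypotheses on the input. -/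
structure Good (I : Input n) : Prop where
  one_le_h : 1 ≤ I.h
  delta_pos : 0 < I.δ
  delta_lt : I.δ < 1
  two_le_m : 2 ≤ I.N.m
  len_sink : ∀ v, I.N.t ∈ I.N.out v → I.N.len v I.N.t = 1
  cap_sum : (∑ e ∈ I.N.edges, (I.N.U e.1 e.2 : ℝ)) ≤ I.thr

end Input

namespace Network

theorem mem_edges {N : Network n} {e : Fin n × Fin n} : e ∈ N.edges ↔ e.2 ∈ N.out e.1 := by
  simp [edges]

theorem U_pos_iff {N : Network n} {u v : Fin n} : 0 < N.U u v ↔ v ∈ N.out u := by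
  unfold U
  split_ifs with h
  · simp [h, N.cap_pos u v h]
  · simp [h]

theorem m_le_sq (N : Network n) : N.m ≤ n ^ 2 := by
  have := Finset.card_le_univ N.edges
  simpa [m, sq] using this

end Network

/-! ### Inequalities for the parameters -/

namespace Input.Good

variable {I : Input n} (H : I.Good)
include H

theorem h_pos : (1 : ℝ) ≤ I.h := by exact_mod_cast H.one_le_h

theorem one_lt_growth : 1 < I.growth := by
  have := H.delta_pos
  unfold Input.growth; linarith

theorem growth_pos : 0 < I.growth := one_pos.trans H.one_lt_growth

theorem growth_le : I.growth ≤ 7 / 6 := by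
  have := H.delta_lt
  unfold Input.growth; linarith

theorem log_growth_le : Real.log I.growth ≤ I.δ / 6 := by
  have := Real.log_le_sub_one_of_pos H.growth_pos
  unfold Input.growth at *; linarith

/-- This is `log x ≥ 1 - 1/x`. The factor `1 + δ/6` is one of the losses that make up the
approximation factor `2 + δ`. -/
theorem le_log_growth : I.δ / 6 ≤ (1 + I.δ / 6) * Real.log I.growth := by
  have h0 := H.delta_pos
  have h1 := Real.one_sub_inv_le_log_of_pos H.growth_pos
  have h2 : I.growth * (1 - I.growth⁻¹) = I.δ / 6 := by
    rw [mul_sub, mul_inv_cancel₀ H.growth_pos.ne']; unfold Input.growth; ring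
  have h3 := mul_le_mul_of_nonneg_left h1 H.growth_pos.le
  rw [h2] at h3
  exact h3

theorem log_growth_pos : 0 < Real.log I.growth := Real.log_pos H.one_lt_growth

theorem gap_coeff_pos : 0 < 1 / (4 * (I.h : ℝ)) := by
  have := H.h_pos
  positivity

theorem gap_coeff_le : 1 / (4 * (I.h : ℝ)) ≤ 1 / 4 := by
  have := H.h_pos
  rw [div_le_div_iff₀ (by linarith) (by norm_num)]; linarith

theorem one_lt_base : 1 < I.base := by
  have := H.gap_coeff_pos
  unfold Input.base; linarith

theorem base_pos : 0 < I.base := one_pos.trans H.one_lt_base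

theorem base_le : I.base ≤ 5 / 4 := by
  have := H.gap_coeff_le
  unfold Input.base; linarith

omit H in
theorem level_zero : I.level 0 = 0 := by simp [Input.level]

omit H in
theorem level_succ (j : ℕ) : I.level (j + 1) = I.level j + I.gap j := by
  unfold Input.level Input.gap Input.base; ring

theorem level_mono : Monotone I.level := fun i j hij => by
  have := pow_le_pow_right₀ H.one_lt_base.le hij
  unfold Input.level; linarith

theorem level_nonneg (j : ℕ) : 0 ≤ I.level j := by
  have := H.level_mono (Nat.zero_le j)
  rwa [level_zero] at this

theorem le_of_level_le {i j : ℕ} (hij : I.level i ≤ I.level j) : i ≤ j := by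
  unfold Input.level at hij
  exact (pow_le_pow_iff_right₀ H.one_lt_base).1 (by linarith)

theorem gap_mono : Monotone I.gap := fun i j hij => by
  have := pow_le_pow_right₀ H.one_lt_base.le hij
  exact mul_le_mul_of_nonneg_left this H.gap_coeff_pos.le

theorem gap_pos (j : ℕ) : 0 < I.gap j := mul_pos H.gap_coeff_pos (pow_pos H.base_pos j)

theorem le_gap (j : ℕ) : 1 / (4 * (I.h : ℝ)) ≤ I.gap j := by
  have := H.gap_mono (Nat.zero_le j)
  simpa [Input.gap] using this

/-- The gap is a `1/(4h)` part of `base ^ j`, so losing it on each of `h` edges costs a quarter in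
all. This dictates the base of the scale. -/
theorem certified_eq (j : ℕ) : I.certified j = 3 / 4 * I.base ^ j - 1 := by
  have := H.h_pos
  unfold Input.certified Input.level Input.gap
  field_simp
  ring

theorem m_ge : (2 : ℝ) ≤ I.N.m := by exact_mod_cast H.two_le_m

theorem log_m_pos : 0 < Real.log I.N.m := Real.log_pos (by linarith [H.m_ge])

theorem log_m_le : Real.log I.N.m ≤ 2 * Real.log n := by
  have h1 : (I.N.m : ℝ) ≤ (n : ℝ) ^ 2 := by exact_mod_cast I.N.m_le_sq
  have h2 := Real.log_le_log (by linarith [H.m_ge]) h1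
  simpa using h2

theorem inv_delta : 1 < 1 / I.δ := by
  rw [lt_div_iff₀ H.delta_pos]; linarith [H.delta_lt]

theorem m_le_thr : (I.N.m : ℝ) ≤ I.thr := by
  have h1 := H.m_ge
  have h2 : (1 : ℝ) ≤ 6 / I.δ + 3 := by
    have := div_pos (by norm_num : (0 : ℝ) < 6) H.delta_pos
    linarith
  have h3 : (1 : ℝ) ≤ I.N.m := by linarith
  simpa [Input.thr] using Real.rpow_le_rpow_of_exponent_le h3 h2

/-- Absorbs additive constants. The most demanding use is `35/18 · (thr + 1) ≤ 2 · thr` in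
`FlowInv.augment`, for which `35` would suffice. -/
theorem le_thr : 64 ≤ I.thr := by
  have h1 := H.m_ge
  have h2 : (6 : ℝ) ≤ 6 / I.δ + 3 := by
    have := H.inv_delta
    have h3 : 6 / I.δ = 6 * (1 / I.δ) := by ring
    linarith
  calc (64 : ℝ) = 2 ^ (6 : ℝ) := by norm_num
    _ ≤ (I.N.m : ℝ) ^ (6 : ℝ) := Real.rpow_le_rpow (by norm_num) h1 (by norm_num)
    _ ≤ _ := Real.rpow_le_rpow_of_exponent_le (by linarith) h2

theorem eta_pos : 0 < I.eta := by
  have h1 := H.delta_pos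
  have h2 := H.log_growth_pos
  have h3 := H.log_m_pos
  unfold Input.eta; positivity

/-- The flow of `g` units through an edge of small weight respects the capacity. -/
theorem eta_mul_le {g : Fin n × Fin n → ℕ} {e : Fin n × Fin n} (he : 0 < I.N.U e.1 e.2)
    (hw : I.wt g e + 1 ≤ 2 * I.thr) : I.eta * g e ≤ I.N.U e.1 e.2 := by
  have hU : (0 : ℝ) < I.N.U e.1 e.2 := by exact_mod_cast he
  have hm := H.m_ge
  have h1 : I.growth ^ ((g e : ℝ) / I.N.U e.1 e.2) ≤ (I.N.m : ℝ) ^ (6 / I.δ + 4) := by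
    calc I.growth ^ ((g e : ℝ) / I.N.U e.1 e.2) ≤ 2 * I.thr := by
          unfold Input.wt at hw; linarith
      -- The factor `2` becomes one more power of `m`; hence the exponent `6/δ + 4` in `eta`,
      -- against `6/δ + 3` in `thr`.
      _ ≤ I.N.m * I.thr := by
          have := H.le_thr
          gcongr
      _ = _ := by
          unfold Input.thr
          rw [show 6 / I.δ + 4 = (6 / I.δ + 3) + 1 by ring, Real.rpow_add (by linarith) _ 1,
            Real.rpow_one, mul_comm]
  have h2 := Real.log_le_log (Real.rpow_pos_of_pos H.growth_pos _) h1
  rw [Real.log_rpow H.growth_pos, Real.log_rpow (by linarith)] at h2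
  have h3 : 0 < (6 / I.δ + 4) * Real.log I.N.m := by
    have h1 := H.delta_pos
    have h3 := H.log_m_pos
    positivity
  unfold Input.eta
  rw [div_mul_eq_mul_div, div_le_iff₀ h3]
  rw [div_mul_eq_mul_div, div_le_iff₀ hU] at h2
  linarith

end Input.Good

/-! ### The response of excess weights to additional flow -/

namespace Input

variable {I : Input n} {g g' : Fin n × Fin n → ℕ} {e : Fin n × Fin n}

theorem wt_mono (H : I.Good) (hg : g e ≤ g' e) : I.wt g e ≤ I.wt g' e := by
  have h2 : (g e : ℝ) ≤ g' e := by exact_mod_cast hg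
  have := Real.rpow_le_rpow_of_exponent_le H.one_lt_growth.le
    (div_le_div_of_nonneg_right h2 (Nat.cast_nonneg (I.N.U e.1 e.2)))
  unfold wt; linarith

theorem wt_of_eq_zero (hg : g e = 0) : I.wt g e = 0 := by simp [wt, hg]

theorem wt_nonneg (H : I.Good) : 0 ≤ I.wt g e := by
  have := wt_mono (g := fun _ => 0) (g' := g) (e := e) H (Nat.zero_le _)
  rwa [wt_of_eq_zero rfl] at this

theorem wt_congr (hg : g e = g' e) : I.wt g e = I.wt g' e := by simp [wt, hg]

theorem wt_add (H : I.Good) (b : ℕ) (hg : g' e = g e + b) :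
    I.wt g' e + 1 = (I.wt g e + 1) * I.growth ^ ((b : ℝ) / I.N.U e.1 e.2) := by
  simp only [wt, hg, Nat.cast_add, add_div, Real.rpow_add H.growth_pos]
  ring

/-- Bernoulli's inequality for exponents in `[0, 1]`; the restriction on `x` is why an augmentation
must not exceed the capacities on its path. -/
theorem growth_rpow_le (H : I.Good) {x : ℝ} (h0 : 0 ≤ x) (h1 : x ≤ 1) :
    I.growth ^ x ≤ 1 + x * (I.δ / 6) := by
  have := H.delta_pos
  exact _root_.rpow_one_add_le_one_add_mul_self (by linarith) h0 h1

/-- Sending `b` units through an edge of capacity at least `b`. -/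
theorem wt_add_le (H : I.Good) {b : ℕ} (hb : b ≤ I.N.U e.1 e.2) (hg : g' e = g e + b) :
    (I.N.U e.1 e.2 : ℝ) * I.wt g' e ≤
      I.N.U e.1 e.2 * I.wt g e + I.δ / 6 * b * (I.wt g e + 1) := by
  rcases Nat.eq_zero_or_pos (I.N.U e.1 e.2) with h0 | h0
  · have : b = 0 := by omega
    simp [h0, this]
  have hU : (0 : ℝ) < I.N.U e.1 e.2 := by exact_mod_cast h0
  have hb' : (b : ℝ) ≤ I.N.U e.1 e.2 := by exact_mod_cast hb
  have h1 := growth_rpow_le H (x := (b : ℝ) / I.N.U e.1 e.2) (by positivity)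
    ((div_le_one hU).2 hb')
  have h2 := mul_le_mul_of_nonneg_left h1
    (mul_nonneg hU.le (by linarith [wt_nonneg (g := g) (e := e) H] : 0 ≤ I.wt g e + 1))
  have h3 := wt_add H b hg
  have h4 : I.N.U e.1 e.2 * (I.wt g e + 1) * (1 + (b : ℝ) / I.N.U e.1 e.2 * (I.δ / 6)) =
      I.N.U e.1 e.2 * (I.wt g e + 1) + I.δ / 6 * b * (I.wt g e + 1) := by
    field_simp
  rw [h4, mul_assoc, ← h3] at h2
  linarith

/-- Sending `b` units multiplies the weight by at most the growth factor. -/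
theorem wt_add_le_mul (H : I.Good) {b : ℕ} (hb : b ≤ I.N.U e.1 e.2) (hg : g' e = g e + b) :
    I.wt g' e + 1 ≤ I.growth * (I.wt g e + 1) := by
  rw [wt_add H b hg, mul_comm]
  refine mul_le_mul_of_nonneg_right ?_ (by linarith [wt_nonneg (g := g) (e := e) H])
  have h1 : (b : ℝ) / I.N.U e.1 e.2 ≤ 1 :=
    div_le_one_of_le₀ (by exact_mod_cast hb) (Nat.cast_nonneg _)
  simpa using Real.rpow_le_rpow_of_exponent_le H.one_lt_growth.le h1

/-- An edge of non-negligible weight carries a non-negligible fraction of its capacity. -/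
theorem cap_le_of_wt (H : I.Good) (hw : 1 / (4 * (I.h : ℝ)) < I.wt g e) :
    I.N.U e.1 e.2 ≤ I.h * g e := by
  by_contra! hlt
  have hh := H.h_pos
  have hlt' : (I.h : ℝ) * g e < I.N.U e.1 e.2 := by exact_mod_cast hlt
  have hU : (0 : ℝ) < I.N.U e.1 e.2 := lt_of_le_of_lt (by positivity) hlt'
  have h0 : (g e : ℝ) / I.N.U e.1 e.2 ≤ 1 / I.h := by
    rw [div_le_div_iff₀ hU (by linarith)]; linarith
  have h1 : (1 : ℝ) / I.h ≤ 1 := by rw [div_le_one (by linarith)]; exact hh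
  have h2 := growth_rpow_le H (x := (g e : ℝ) / I.N.U e.1 e.2) (by positivity) (h0.trans h1)
  -- A flow below a fraction `1/h` of the capacity leaves an excess of at most `δ/(6h)`, which is
  -- below `1/(4h)`.
  have h3 : (g e : ℝ) / I.N.U e.1 e.2 * (I.δ / 6) ≤ 1 / I.h * (1 / 4) := by
    have := H.delta_pos
    have := H.delta_lt
    gcongr
    linarith
  have h4 : (1 : ℝ) / (4 * I.h) = 1 / I.h * (1 / 4) := by
    field_simp
  unfold wt at hw
  linarith

end Input

end

section

variable {n : ℕ}

/-! ### Vertex sequences -/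

theorem pathEdges_append_pair (l : List (Fin n)) (a x : Fin n) :
    pathEdges (l ++ [a] ++ [x]) = pathEdges (l ++ [a]) ++ [(a, x)] := by
  induction l with
  | nil => rfl
  | cons c l ih =>
    cases l with
    | nil => rfl
    | cons c' l =>
      have : ∀ r : List (Fin n), pathEdges (c :: c' :: r) = (c, c') :: pathEdges (c' :: r) :=
        fun _ => rfl
      simp only [List.cons_append, this] at ih ⊢
      rw [ih]

theorem pathEdges_prefix {l l' : List (Fin n)} (h : l <+: l') :
    pathEdges l <+: pathEdges l' := by
  induction l generalizing l' with
  | nil => exact List.nil_prefix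
  | cons a l ih =>
    obtain ⟨r, rfl⟩ := h
    cases l with
    | nil => exact List.nil_prefix
    | cons b l =>
      have h2 := ih (l' := b :: l ++ r) ⟨r, rfl⟩
      exact List.cons_prefix_cons.2 ⟨rfl, h2⟩

theorem map_snd_pathEdges (P : List (Fin n)) : (pathEdges P).map Prod.snd = P.tail :=
  List.map_snd_zip (by simp)

theorem pathEdges_nodup {P : List (Fin n)} (h : P.Nodup) : (pathEdges P).Nodup :=
  List.Nodup.of_map Prod.snd (by rw [map_snd_pathEdges]; exact h.tail)

theorem pathEdges_pred_unique {P : List (Fin n)} (h : P.Nodup) {u v x : Fin n}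
    (hu : (u, x) ∈ pathEdges P) (hv : (v, x) ∈ pathEdges P) : u = v := by
  have h1 : ((pathEdges P).map Prod.snd).Nodup := by rw [map_snd_pathEdges]; exact h.tail
  exact congrArg Prod.fst (List.inj_on_of_nodup_map h1 hu hv rfl)

theorem length_pathEdges (P : List (Fin n)) : (pathEdges P).length = P.length - 1 := by
  simp [pathEdges]

theorem fst_mem_of_mem_pathEdges {P : List (Fin n)} {e : Fin n × Fin n} (h : e ∈ pathEdges P) :
    e.1 ∈ P := (List.of_mem_zip h).1

/-- Covers both cases of a push: if `x` is new nothing is cut, otherwise the cycle that closes at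
`x` is removed. -/
theorem takeWhile_append_prefix (l : List (Fin n)) (x : Fin n) :
    l.takeWhile (· ≠ x) ++ [x] <+: l ++ [x] := by
  induction l with
  | nil => simp
  | cons a l ih =>
    by_cases h : a = x
    · simp [h]
    · simpa [List.takeWhile_cons, h] using ih

theorem takeWhile_append_nodup {l : List (Fin n)} (hl : l.Nodup) (x : Fin n) :
    (l.takeWhile (· ≠ x) ++ [x]).Nodup := by
  rw [List.nodup_append]
  refine ⟨hl.sublist (List.takeWhile_sublist _), by simp, ?_⟩
  intro a ha b hb
  have := List.mem_takeWhile_imp ha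
  simp only [List.mem_singleton] at hb
  subst hb
  simpa using this

/-- The flow through `e`, in units, of a list of paths with amounts. -/
def units (augs : List (List (Fin n) × ℕ)) (e : Fin n × Fin n) : ℕ :=
  (augs.map fun a => if e ∈ pathEdges a.1 then a.2 else 0).sum

theorem units_append (augs : List (List (Fin n) × ℕ)) (P : List (Fin n)) (b : ℕ)
    (e : Fin n × Fin n) :
    units (augs ++ [(P, b)]) e = units augs e + if e ∈ pathEdges P then b else 0 := by
  simp [units]

/-- The value, in units, of a list of paths with amounts. -/
def total (augs : List (List (Fin n) × ℕ)) : ℕ := (augs.map Prod.snd).sum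

theorem total_append (augs : List (List (Fin n) × ℕ)) (P : List (Fin n)) (b : ℕ) :
    total (augs ++ [(P, b)]) = total augs + b := by
  simp [total]

/-! ### Simple source-sink paths: first and last edges, number of edges -/

namespace Network

theorem IsHPath.eq_cons {N : Network n} {h : ℕ} {P : List (Fin n)} (hP : N.IsHPath h P) :
    ∃ x l, P = N.s :: x :: l := by
  obtain ⟨h1, h2, -⟩ := hP
  match P, h1, h2 with
  | [], h1, _ => simp at h1
  | [a], h1, h2 =>
    simp at h1 h2
    exact absurd (h1.symm.trans h2) N.s_ne_t
  | a :: x :: l, h1, _ =>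
    simp at h1
    exact ⟨x, l, by rw [h1]⟩

/-- Vertices other than the source and the sink. -/
def inner (N : Network n) : Finset (Fin n) := Finset.univ.filter fun v => v ≠ N.s ∧ v ≠ N.t

/-- A path that enters the sink from an inner vertex leaves the source to an inner vertex. -/
theorem IsHPath.sum_sink_le {N : Network n} {h : ℕ} {P : List (Fin n)} (hP : N.IsHPath h P)
    (b : ℕ) :
    (∑ v ∈ N.inner, if (v, N.t) ∈ pathEdges P then b else 0) ≤
      ∑ v ∈ N.inner, if (N.s, v) ∈ pathEdges P then b else 0 := by
  obtain ⟨x, l, rfl⟩ := hP.eq_cons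
  obtain ⟨-, -, hnd, -⟩ := hP
  have hx : (N.s, x) ∈ pathEdges (N.s :: x :: l) := List.mem_cons_self
  by_cases hxt : x = N.t
  · subst hxt
    rw [Finset.sum_eq_zero]
    · exact Nat.zero_le _
    · intro v hv
      rw [if_neg]
      intro hv'
      have := pathEdges_pred_unique hnd hv' hx
      simp [inner, this] at hv
  · have hxi : x ∈ N.inner := by
      simp only [inner, Finset.mem_filter, Finset.mem_univ, true_and]
      refine ⟨fun h => ?_, hxt⟩
      subst h
      simp at hnd
    have h1 : b ≤ ∑ v ∈ N.inner, if (N.s, v) ∈ pathEdges (N.s :: x :: l) then b else 0 := by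
      have := Finset.single_le_sum
        (f := fun v => if (N.s, v) ∈ pathEdges (N.s :: x :: l) then b else 0)
        (fun _ _ => Nat.zero_le _) hxi
      simpa [if_pos hx] using this
    refine le_trans ?_ h1
    by_cases hv : ∃ v ∈ N.inner, (v, N.t) ∈ pathEdges (N.s :: x :: l)
    · obtain ⟨v, hv, hve⟩ := hv
      rw [Finset.sum_eq_single_of_mem v hv]
      · simp [hve]
      · intro u _ huv
        rw [if_neg]
        exact fun hu => huv (pathEdges_pred_unique hnd hu hve)
    · push Not at hv
      rw [Finset.sum_eq_zero (fun v hv' => if_neg (hv v hv'))]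
      exact Nat.zero_le _

/-- Lets source capacities control the flow that reaches the sink from inner vertices. A path using
the edge from `s` to `t` counts on neither side. -/
theorem sum_units_sink_le {N : Network n} {h : ℕ} {augs : List (List (Fin n) × ℕ)}
    (ha : ∀ a ∈ augs, N.IsHPath h a.1) :
    ∑ v ∈ N.inner, units augs (v, N.t) ≤ ∑ v ∈ N.inner, units augs (N.s, v) := by
  induction augs with
  | nil => simp [units]
  | cons a augs ih =>
    have h1 := ih fun b hb => ha b (List.mem_cons_of_mem _ hb)
    have h2 := (ha a List.mem_cons_self).sum_sink_le a.2
    have h3 : ∀ e, units (a :: augs) e = (if e ∈ pathEdges a.1 then a.2 else 0) + units augs e :=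
      fun e => by simp [units]
    simp only [h3, Finset.sum_add_distrib]
    omega

theorem pathEdges_length_le_m {N : Network n} {P : List (Fin n)} (hP : P.Nodup)
    (he : ∀ e ∈ pathEdges P, e ∈ N.edges) : (pathEdges P).length ≤ N.m := by
  rw [← List.toFinset_card_of_nodup (pathEdges_nodup hP)]
  exact Finset.card_le_card fun e h => he e (List.mem_toFinset.1 h)

theorem pathEdges_length_le_pathLen {N : Network n} {P : List (Fin n)}
    (he : ∀ e ∈ pathEdges P, e ∈ N.edges) : (pathEdges P).length ≤ N.pathLen P := by
  have := List.card_nsmul_le_sum ((pathEdges P).map fun e => N.len e.1 e.2) 1 (by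
    intro x hx
    obtain ⟨e, h1, rfl⟩ := List.mem_map.1 hx
    exact N.len_pos e.1 e.2 (mem_edges.1 (he e h1)))
  simpa [pathLen] using this

end Network

/-- The size, in multiples of the initial weight, of the excess weights. -/
noncomputable def Input.vol (I : Input n) (g : Fin n × Fin n → ℕ) : ℝ :=
  ∑ e ∈ I.N.edges, (I.N.U e.1 e.2 : ℝ) * I.wt g e

namespace Input

variable {I : Input n} {g g' : Fin n × Fin n → ℕ}

theorem vol_nonneg (H : I.Good) : 0 ≤ I.vol g :=
  Finset.sum_nonneg fun _ _ => mul_nonneg (Nat.cast_nonneg _) (wt_nonneg H)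

theorem vol_mono (H : I.Good) (hg : ∀ e, g e ≤ g' e) : I.vol g ≤ I.vol g' :=
  Finset.sum_le_sum fun e _ => mul_le_mul_of_nonneg_left (wt_mono H (hg e)) (Nat.cast_nonneg _)

theorem sum_wt_nonneg (H : I.Good) (L : List (Fin n × Fin n)) : 0 ≤ (L.map (I.wt g)).sum :=
  List.sum_nonneg fun x hx => by
    obtain ⟨e, -, rfl⟩ := List.mem_map.1 hx
    exact wt_nonneg H

theorem wt_le_sum (H : I.Good) {L : List (Fin n × Fin n)} {e : Fin n × Fin n} (he : e ∈ L) :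
    I.wt g e ≤ (L.map (I.wt g)).sum :=
  List.single_le_sum (fun x hx => by
    obtain ⟨e, -, rfl⟩ := List.mem_map.1 hx
    exact wt_nonneg H) _ (List.mem_map_of_mem he)

/-- `wt_add_le` summed over the edges of the path. The summand `L.length` appears because the growth
is proportional to the full weight, which is the excess plus `1` on every edge. -/
theorem vol_add_le (H : I.Good) {b : ℕ} {L : List (Fin n × Fin n)} (hL : L.Nodup)
    (hE : ∀ e ∈ L, e ∈ I.N.edges) (hb : ∀ e ∈ L, b ≤ I.N.U e.1 e.2)
    (hg : ∀ e, g' e = g e + if e ∈ L then b else 0) :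
    I.vol g' ≤ I.vol g + I.δ / 6 * b * ((L.map (I.wt g)).sum + L.length) := by
  have h1 : ∀ e, (I.N.U e.1 e.2 : ℝ) * I.wt g' e ≤ I.N.U e.1 e.2 * I.wt g e +
      if e ∈ L.toFinset then I.δ / 6 * b * (I.wt g e + 1) else 0 := by
    intro e
    by_cases he : e ∈ L
    · rw [if_pos (List.mem_toFinset.2 he)]
      exact wt_add_le H (hb e he) (by rw [hg, if_pos he])
    · rw [if_neg (by simpa using he), wt_congr (g := g) (g' := g') (by rw [hg, if_neg he]; rfl),
        add_zero]
  have h2 : (∑ e ∈ I.N.edges, if e ∈ L.toFinset then I.δ / 6 * b * (I.wt g e + 1) else 0) =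
      I.δ / 6 * b * ((L.map (I.wt g)).sum + L.length) := by
    rw [← Finset.sum_filter]
    have h3 : I.N.edges.filter (· ∈ L.toFinset) = L.toFinset := by
      ext e
      simp only [Finset.mem_filter, List.mem_toFinset, and_iff_right_iff_imp]
      exact hE e
    rw [h3, List.sum_toFinset _ hL, List.sum_map_mul_left, List.sum_map_add]
    simp
  unfold vol
  rw [← h2, ← Finset.sum_add_distrib]
  exact Finset.sum_le_sum fun e _ => h1 e

end Input

/-! ### The abstract algorithm -/

/-- A state of the algorithm: the augmentations done so far, the list of the edges that carry flow,
labels and arc pointers of vertices with a length budget, the current path (the vertices `pre` and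
then `cur`) with the remaining length budget, and the recorded cut with its size, given as a
fraction. -/
structure State (n : ℕ) where
  augs : List (List (Fin n) × ℕ)
  touched : List (Fin n × Fin n)
  lab : Fin n → ℕ → ℕ
  ptr : Fin n → ℕ → ℕ
  pre : List (Fin n)
  cur : Fin n
  d : ℕ
  num : ℝ
  den : ℝ
  cut : Fin n × Fin n → ℝ

/-- Overwrite one value of a function of two arguments. -/
def put (f : Fin n → ℕ → ℕ) (v : Fin n) (d x : ℕ) : Fin n → ℕ → ℕ :=
  fun v' d' => if v' = v ∧ d' = d then x else f v' d'

namespace State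

/-- The flow through the edges. -/
def g (st : State n) : Fin n × Fin n → ℕ := units st.augs

/-- The current path. -/
def path (st : State n) : List (Fin n) := st.pre ++ [st.cur]

/-- The label of the source. -/
def top (st : State n) (I : Input n) : ℕ := st.lab I.N.s I.h

/-- Restart the search. -/
def restart (st : State n) (I : Input n) : State n :=
  { st with pre := [], cur := I.N.s, d := I.h }

/-- Send `b` units along the current path. -/
def augment (st : State n) (I : Input n) (b : ℕ) : State n :=
  restart { st with
    augs := st.augs ++ [(st.path ++ [I.N.t], b)]
    touched := st.touched ++ (pathEdges (st.path ++ [I.N.t])).filter fun e => st.g e = 0 } I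

/-- Extend the current path to `x`, cutting off a cycle. -/
def push (st : State n) (I : Input n) (x : Fin n) : State n :=
  { st with
    pre := st.path.takeWhile (· ≠ x)
    cur := x
    d := st.d - I.N.len st.cur x }

/-- Advance the arc pointer. -/
def skip (st : State n) : State n :=
  { st with ptr := put st.ptr st.cur st.d (st.ptr st.cur st.d + 1) }

/-- Increase the label of the current vertex and restart. -/
def relabel (st : State n) (I : Input n) : State n :=
  restart { st with
    lab := put st.lab st.cur st.d (st.lab st.cur st.d + 1)
    ptr := put st.ptr st.cur st.d 0 } I

/-- Record the current cut. -/
noncomputable def record (st : State n) (I : Input n) : State n :=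
  { st with
    num := I.vol st.g
    den := I.certified (st.top I)
    cut := fun e => I.wt st.g e / I.certified (st.top I) }

end State

/-- Vertices whose arcs other than that to the sink may have been scanned. -/
def Input.Sat (I : Input n) (g : Fin n × Fin n → ℕ) (v : Fin n) : Prop :=
  v ≠ I.N.t ∧ (I.N.sinkCap v = 0 ∨ 1 / (4 * (I.h : ℝ)) < I.wt g (v, I.N.t))

/-- Vertices that may have been visited. -/
def Input.Vis (I : Input n) (g : Fin n × Fin n → ℕ) (v : Fin n) : Prop :=
  v = I.N.s ∨ ∃ u, I.Sat g u ∧ v ∈ I.N.out u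

theorem Input.Sat.mono {I : Input n} (H : I.Good) {g g' : Fin n × Fin n → ℕ} (hg : ∀ e, g e ≤ g' e)
    {v : Fin n} (h : I.Sat g v) : I.Sat g' v :=
  ⟨h.1, h.2.imp id fun h => h.trans_le (Input.wt_mono H (hg _))⟩

theorem Input.Vis.mono {I : Input n} (H : I.Good) {g g' : Fin n × Fin n → ℕ} (hg : ∀ e, g e ≤ g' e)
    {v : Fin n} (h : I.Vis g v) : I.Vis g' v :=
  h.imp id fun ⟨u, h1, h2⟩ => ⟨u, h1.mono H hg, h2⟩

/-- The invariant of the flow and of the recorded cut. -/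
structure FlowInv (I : Input n) (st : State n) : Prop where
  augs_path : ∀ a ∈ st.augs, I.N.IsHPath I.h a.1
  augs_cap : ∀ a ∈ st.augs, ∃ e ∈ pathEdges a.1, a.2 = I.N.U e.1 e.2
  wt_le : ∀ e ∈ I.N.edges, I.wt st.g e + 1 ≤ 2 * I.thr
  touched_nodup : st.touched.Nodup
  mem_touched : ∀ e, e ∈ st.touched ↔ 0 < st.g e
  sat_of_flow : ∀ u x, 0 < st.g (u, x) → x ≠ I.N.t → I.Sat st.g u
  vol_le : I.vol st.g ≤ 3 * (I.δ / 6) * I.thr * total st.augs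
  -- Here `β` is any lower bound for the recorded ratio. By the first part it also bounds the
  -- current ratio of volume to certified distance from below, and this turns the increments of the
  -- volume into exponential growth. Stated for all `β`, the claim survives a new record, which only
  -- shrinks the set of admissible `β`.
  potential : ∀ β : ℝ, 0 < β → β * st.den ≤ st.num →
    β * I.certified (st.top I) ≤ I.vol st.g ∧
    I.vol st.g + β * I.N.m ≤ β * I.N.m * Real.exp (5 / 3 * (I.δ / 6) / β * total st.augs)
  den_nonneg : 0 ≤ st.den
  -- The initial fraction `1/0` plays the role of infinity: as long as nothing is recorded, every
  -- `β` is admissible.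
  num_nonneg : 0 ≤ st.num
  num_pos : st.den = 0 → 0 < st.num
  cut : 0 < st.den → I.N.IsMovingCut I.h st.cut ∧ I.N.cutSize st.cut = st.num / st.den

/-- The invariant of labels and pointers. -/
structure LabelInv (I : Input n) (st : State n) : Prop where
  lab_le : ∀ v d, st.lab v d ≤ st.top I + 1
  base_le : I.base ^ st.top I ≤ 2 * I.thr
  -- The slack is one gap because a relabelling raises a level by at most `gap (top)`. The budget
  -- inequality is strict, since something must be left for a last edge into the sink.
  arc : ∀ v d x, x ∈ I.N.out v → x ≠ I.N.t → I.N.len v x < d →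
    I.level (st.lab v d) ≤
      I.wt st.g (v, x) + I.gap (st.top I) + I.level (st.lab x (d - I.N.len v x))
  sink : ∀ v d, 0 < I.N.sinkCap v → I.level (st.lab v d) ≤ I.wt st.g (v, I.N.t) + I.gap (st.top I)
  -- Rejected arcs satisfy a strict inequality without slack, and continue to do so while weights
  -- and labels of heads grow; the slack is thus fully available at the next relabelling.
  scanned : ∀ v d i x, i < st.ptr v d → (I.N.out v)[i]? = some x → x ≠ I.N.t → I.N.len v x < d →
    I.level (st.lab v d) < I.wt st.g (v, x) + I.level (st.lab x (d - I.N.len v x))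
  ptr_le : ∀ v d, st.ptr v d ≤ I.N.outDeg v
  -- Outside this local set labels and pointers keep the default value `0`, so they cost neither
  -- initialization nor work.
  active : ∀ v d, 0 < st.lab v d ∨ 0 < st.ptr v d → I.Sat st.g v ∧ I.Vis st.g v ∧ d ≤ I.h

/-- The invariant of the current path. -/
structure PathInv (I : Input n) (st : State n) : Prop where
  head : st.path.head? = some I.N.s
  nodup : st.path.Nodup
  sink_notMem : I.N.t ∉ st.path
  edges : ∀ e ∈ pathEdges st.path, e ∈ I.N.edges
  len_le : I.N.pathLen st.path + st.d ≤ I.h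
  d_pos : 0 < st.d
  -- An arc is followed only if the level drops by at least its excess weight, so these inequalities
  -- telescope with no loss per edge.
  wt_le : ((pathEdges st.path).map (I.wt st.g)).sum + I.level (st.lab st.cur st.d) ≤
    I.level (st.top I)
  sat : ∀ v ∈ st.pre, I.Sat st.g v
  vis : I.Vis st.g st.cur

theorem PathInv.restart {I : Input n} (H : I.Good) (st : State n) : PathInv I (st.restart I) where
  head := rfl
  nodup := by simp [State.path, State.restart]
  sink_notMem := by simpa [State.path, State.restart] using I.N.s_ne_t.symm
  edges := by simp [State.path, State.restart, pathEdges]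
  len_le := by simp [State.path, State.restart, pathEdges, Network.pathLen]
  d_pos := H.one_le_h
  wt_le := by simp [State.path, State.restart, pathEdges, State.top]
  sat := by simp [State.restart]
  vis := Or.inl rfl

end

/-! ### The invariants at the start and under the moves of the search -/

section

variable {n : ℕ} {I : Input n} {st : State n}

/-- The initial state. -/
def State.start (I : Input n) : State n :=
  ⟨[], [], fun _ _ => 0, fun _ _ => 0, [], I.N.s, I.h, 1, 0, fun _ => 0⟩

theorem FlowInv.start (H : I.Good) : FlowInv I (State.start I) := by
  have hg : ∀ e, (State.start I).g e = 0 := fun _ => rfl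
  have hw : ∀ e, I.wt (State.start I).g e = 0 := fun e => Input.wt_of_eq_zero (hg e)
  have hv : I.vol (State.start I).g = 0 := Finset.sum_eq_zero fun e _ => by rw [hw, mul_zero]
  have ht : total (State.start I).augs = 0 := rfl
  have hthr := H.le_thr
  refine ⟨by simp [State.start], by simp [State.start], ?_, by simp [State.start], ?_, ?_, ?_, ?_,
    le_rfl, zero_le_one, fun _ => zero_lt_one, fun h => absurd h (lt_irrefl _)⟩
  · intro e _
    rw [hw]; linarith
  · intro e
    rw [hg]; simp [State.start]
  · intro u x h
    simp [hg] at h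
  · rw [hv, ht]; simp
  · intro β hβ _
    rw [hv, ht, H.certified_eq]
    simp only [State.top, State.start, pow_zero, Nat.cast_zero, mul_zero, Real.exp_zero]
    constructor
    · linarith
    · linarith

theorem LabelInv.start (H : I.Good) : LabelInv I (State.start I) := by
  have hthr := H.le_thr
  refine ⟨fun _ _ => Nat.zero_le _, ?_, ?_, ?_, ?_, fun _ _ => Nat.zero_le _, ?_⟩
  · simp only [State.top, State.start, pow_zero]; linarith
  · intro v d x _ _ _
    have h1 := Input.wt_nonneg (g := (State.start I).g) (e := (v, x)) H
    have h2 := H.gap_pos ((State.start I).top I)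
    simp only [State.start, Input.Good.level_zero] at *
    linarith
  · intro v d _
    have h1 := Input.wt_nonneg (g := (State.start I).g) (e := (v, I.N.t)) H
    have h2 := H.gap_pos ((State.start I).top I)
    simp only [State.start, Input.Good.level_zero] at *
    linarith
  · intro v d i x h
    simp [State.start] at h
  · intro v d h
    simp [State.start] at h

/-- The label of the current vertex is at most that of the source. -/
theorem PathInv.lab_le_top (H : I.Good) (hp : PathInv I st) :
    st.lab st.cur st.d ≤ st.top I := by
  have h1 := hp.wt_le
  have h2 := Input.sum_wt_nonneg (g := st.g) H (pathEdges st.path)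
  exact H.le_of_level_le (by linarith)

theorem PathInv.cur_ne (hp : PathInv I st) : st.cur ≠ I.N.t := fun h =>
  hp.sink_notMem (by simp [State.path, h])

theorem PathInv.d_le (hp : PathInv I st) : st.d ≤ I.h := (Nat.le_add_left _ _).trans hp.len_le

theorem pathEdges_path_append (st : State n) (x : Fin n) :
    pathEdges (st.path ++ [x]) = pathEdges st.path ++ [(st.cur, x)] :=
  pathEdges_append_pair st.pre st.cur x

/-- The remaining budget is positive and edges into the sink have length `1`, so the last edge
always fits. This is the role of the hypothesis on these lengths. -/
theorem PathInv.isHPath (H : I.Good) (hp : PathInv I st) (hc : 0 < I.N.sinkCap st.cur) :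
    I.N.IsHPath I.h (st.path ++ [I.N.t]) := by
  have hout : I.N.t ∈ I.N.out st.cur := Network.U_pos_iff.1 hc
  refine ⟨?_, by simp, ?_, ?_, ?_⟩
  · rw [List.head?_append, hp.head]; rfl
  · rw [List.nodup_append]
    refine ⟨hp.nodup, by simp, ?_⟩
    intro a ha b hb hab
    simp only [List.mem_singleton] at hb
    exact hp.sink_notMem (by rw [← hb, ← hab]; exact ha)
  · intro e he
    rw [pathEdges_path_append, List.mem_append, List.mem_singleton] at he
    rcases he with he | rfl
    · exact hp.edges e he
    · exact Network.mem_edges.2 hout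
  · have h1 := hp.len_le
    have h2 := hp.d_pos
    have h3 := H.len_sink _ hout
    unfold Network.pathLen at *
    rw [pathEdges_path_append]
    simp only [List.map_append, List.map_cons, List.map_nil, List.sum_append, List.sum_singleton,
      h3]
    omega

/-! #### Moving along an arc -/

/-- The new path is a prefix of the old one extended by `x`, so cutting off a cycle can only lower
its length and weight. The budget nevertheless pays for the arc, which bounds the number of pushes
between restarts. -/
theorem PathInv.push (H : I.Good) (hp : PathInv I st) {x : Fin n} (hx : x ∈ I.N.out st.cur)
    (hxt : x ≠ I.N.t) (hlen : I.N.len st.cur x < st.d)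
    (hw : I.wt st.g (st.cur, x) + I.level (st.lab x (st.d - I.N.len st.cur x)) ≤
      I.level (st.lab st.cur st.d)) (hsat : I.Sat st.g st.cur) : PathInv I (st.push I x) := by
  have hpre : (st.push I x).path <+: st.path ++ [x] := takeWhile_append_prefix st.path x
  have hE := pathEdges_prefix hpre
  rw [pathEdges_path_append] at hE
  have hne : (st.push I x).path ≠ [] := by simp [State.path]
  have hsub : ∀ v ∈ (st.push I x).pre, v ∈ st.path := fun v hv =>
    (List.takeWhile_sublist _).subset hv
  refine ⟨?_, takeWhile_append_nodup hp.nodup x, ?_, ?_, ?_, ?_, ?_, ?_, Or.inr ⟨st.cur, hsat, hx⟩⟩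
  · have h1 : (st.path ++ [x]).head? = some I.N.s := by
      rw [List.head?_append, hp.head]; rfl
    rw [← h1]
    obtain ⟨r, hr⟩ := hpre
    rw [← hr, List.head?_append_of_ne_nil _ hne]
  · intro ht
    simp only [State.path, List.mem_append, List.mem_singleton] at ht
    rcases ht with ht | ht
    · exact hp.sink_notMem (hsub _ ht)
    · exact hxt ht.symm
  · intro e he
    have := hE.subset he
    rw [List.mem_append, List.mem_singleton] at this
    rcases this with h | rfl
    · exact hp.edges e h
    · exact Network.mem_edges.2 hx
  · have h1 := hp.len_le
    have h2 : I.N.pathLen (st.push I x).path ≤ I.N.pathLen st.path + I.N.len st.cur x := by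
      have := (hE.sublist.map fun e => I.N.len e.1 e.2).sum_le_sum (fun _ _ => Nat.zero_le _)
      simpa [Network.pathLen] using this
    have h3 : (st.push I x).d = st.d - I.N.len st.cur x := rfl
    omega
  · exact Nat.sub_pos_of_lt hlen
  · have h1 := hp.wt_le
    have h2 : ((pathEdges (st.push I x).path).map (I.wt st.g)).sum ≤
        ((pathEdges st.path).map (I.wt st.g)).sum + I.wt st.g (st.cur, x) := by
      have := (hE.sublist.map (I.wt st.g)).sum_le_sum (fun y hy => by
        obtain ⟨e, -, rfl⟩ := List.mem_map.1 hy
        exact Input.wt_nonneg H)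
      simpa using this
    have h3 : (st.push I x).g = st.g := rfl
    have h4 : (st.push I x).lab (st.push I x).cur (st.push I x).d =
      st.lab x (st.d - I.N.len st.cur x) := rfl
    have h5 : (st.push I x).top I = st.top I := rfl
    rw [h3, h4, h5]
    linarith
  · intro v hv
    have h3 : (st.push I x).g = st.g := rfl
    rw [h3]
    have := hsub v hv
    simp only [State.path, List.mem_append, List.mem_singleton] at this
    rcases this with h | rfl
    · exact hp.sat v h
    · exact hsat

theorem LabelInv.push (hl : LabelInv I st) (x : Fin n) : LabelInv I (st.push I x) :=
  ⟨hl.lab_le, hl.base_le, hl.arc, hl.sink, hl.scanned, hl.ptr_le, hl.active⟩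

theorem FlowInv.push (hf : FlowInv I st) (x : Fin n) : FlowInv I (st.push I x) :=
  ⟨hf.augs_path, hf.augs_cap, hf.wt_le, hf.touched_nodup, hf.mem_touched, hf.sat_of_flow,
    hf.vol_le, hf.potential, hf.den_nonneg, hf.num_nonneg, hf.num_pos, hf.cut⟩

/-! #### Advancing the arc pointer -/

theorem PathInv.skip (hp : PathInv I st) : PathInv I st.skip :=
  ⟨hp.head, hp.nodup, hp.sink_notMem, hp.edges, hp.len_le, hp.d_pos, hp.wt_le, hp.sat, hp.vis⟩

theorem FlowInv.skip (hf : FlowInv I st) : FlowInv I st.skip :=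
  ⟨hf.augs_path, hf.augs_cap, hf.wt_le, hf.touched_nodup, hf.mem_touched, hf.sat_of_flow,
    hf.vol_le, hf.potential, hf.den_nonneg, hf.num_nonneg, hf.num_pos, hf.cut⟩

theorem LabelInv.skip (hl : LabelInv I st) (hp : PathInv I st) (hsat : I.Sat st.g st.cur)
    (hptr : st.ptr st.cur st.d < I.N.outDeg st.cur)
    (hw : ∀ x, (I.N.out st.cur)[st.ptr st.cur st.d]? = some x → x ≠ I.N.t →
      I.N.len st.cur x < st.d → I.level (st.lab st.cur st.d) <
        I.wt st.g (st.cur, x) + I.level (st.lab x (st.d - I.N.len st.cur x))) :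
    LabelInv I st.skip := by
  refine ⟨hl.lab_le, hl.base_le, hl.arc, hl.sink, ?_, ?_, ?_⟩
  · intro v d i x hi hx hxt hlen
    by_cases hvd : v = st.cur ∧ d = st.d
    · obtain ⟨rfl, rfl⟩ := hvd
      have hi' : i < st.ptr st.cur st.d + 1 := by simpa [State.skip, put] using hi
      rcases Nat.lt_succ_iff_lt_or_eq.1 hi' with h | rfl
      · exact hl.scanned _ _ i x h hx hxt hlen
      · exact hw x hx hxt hlen
    · refine hl.scanned v d i x ?_ hx hxt hlen
      simpa [State.skip, put, hvd] using hi
  · intro v d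
    by_cases hvd : v = st.cur ∧ d = st.d
    · obtain ⟨rfl, rfl⟩ := hvd
      simpa [State.skip, put] using hptr
    · simpa [State.skip, put, hvd] using hl.ptr_le v d
  · intro v d h
    by_cases hvd : v = st.cur ∧ d = st.d
    · obtain ⟨rfl, rfl⟩ := hvd
      exact ⟨hsat, hp.vis, hp.d_le⟩
    · exact hl.active v d (by simpa [State.skip, put, hvd] using h)

/-! #### Relabelling -/

theorem State.top_relabel_le (st : State n) (I : Input n) :
    st.top I ≤ (st.relabel I).top I ∧ (st.relabel I).top I ≤ st.top I + 1 := by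
  simp only [State.relabel, State.restart, State.top, put]
  split_ifs with h
  · rw [h.1, h.2]; omega
  · omega

/-- When the pointer is at the end of the list, every relevant arc has been rejected strictly, and
raising the level by at most one gap uses exactly the slack allowed in `LabelInv.arc`. -/
theorem LabelInv.relabel (H : I.Good) (hl : LabelInv I st) (hp : PathInv I st)
    (hsat : I.Sat st.g st.cur) (hrun : I.certified (st.top I) < I.thr)
    (hptr : I.N.outDeg st.cur ≤ st.ptr st.cur st.d)
    (hsink : 0 < I.N.sinkCap st.cur →
      I.level (st.lab st.cur st.d) + I.gap (st.top I) < I.wt st.g (st.cur, I.N.t)) :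
    LabelInv I (st.relabel I) := by
  have htop := st.top_relabel_le I
  have hle := hp.lab_le_top H
  have hgap : I.level (st.lab st.cur st.d + 1) ≤ I.level (st.lab st.cur st.d) + I.gap (st.top I) := by
    rw [Input.Good.level_succ]
    linarith [H.gap_mono hle]
  have hgap' := H.gap_mono htop.1
  have hmono : ∀ v d, st.lab v d ≤ (st.relabel I).lab v d := by
    intro v d
    simp only [State.relabel, State.restart, put]
    split_ifs with h
    · rw [h.1, h.2]; omega
    · exact le_rfl
  have hlab : (st.relabel I).lab st.cur st.d = st.lab st.cur st.d + 1 := by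
    simp [State.relabel, State.restart, put]
  have hlab' : ∀ v d, ¬ (v = st.cur ∧ d = st.d) → (st.relabel I).lab v d = st.lab v d := by
    intro v d h
    simp [State.relabel, State.restart, put, h]
  have hg : (st.relabel I).g = st.g := rfl
  refine ⟨?_, ?_, ?_, ?_, ?_, ?_, ?_⟩
  · intro v d
    by_cases hvd : v = st.cur ∧ d = st.d
    · obtain ⟨rfl, rfl⟩ := hvd
      rw [hlab]; omega
    · rw [hlab' v d hvd]
      have := hl.lab_le v d
      omega
  · have h1 : I.base ^ (st.relabel I).top I ≤ I.base ^ (st.top I + 1) :=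
      pow_le_pow_right₀ H.one_lt_base.le htop.2
    rw [H.certified_eq] at hrun
    -- The guard bounds `3/4 · base ^ top - 1` by `thr`; one more factor `base ≤ 5/4` gives `5/3 ·
    -- (thr + 1) ≤ 2 · thr`.
    have h2 := mul_le_mul H.base_le (by linarith : I.base ^ st.top I ≤ 4 / 3 * (I.thr + 1))
      (pow_pos H.base_pos _).le (by norm_num)
    rw [← pow_succ'] at h2
    linarith [H.le_thr]
  · intro v d x hx hxt hlen
    have hx' := H.level_mono (hmono x (d - I.N.len v x))
    rw [hg]
    by_cases hvd : v = st.cur ∧ d = st.d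
    · obtain ⟨rfl, rfl⟩ := hvd
      obtain ⟨i, hi⟩ := List.mem_iff_getElem?.1 hx
      have hi' : i < st.ptr st.cur st.d := by
        refine lt_of_lt_of_le ?_ hptr
        exact (List.getElem?_eq_some_iff.1 hi).1
      have := hl.scanned _ _ i x hi' hi hxt hlen
      rw [hlab]
      linarith
    · rw [hlab' v d hvd]
      linarith [hl.arc v d x hx hxt hlen]
  · intro v d hv
    rw [hg]
    by_cases hvd : v = st.cur ∧ d = st.d
    · obtain ⟨rfl, rfl⟩ := hvd
      rw [hlab]
      linarith [hsink hv, H.gap_pos ((st.relabel I).top I)]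
    · rw [hlab' v d hvd]
      linarith [hl.sink v d hv]
  · intro v d i x hi hx hxt hlen
    have hx' := H.level_mono (hmono x (d - I.N.len v x))
    rw [hg]
    by_cases hvd : v = st.cur ∧ d = st.d
    · simp [State.relabel, State.restart, put, hvd] at hi
    · rw [hlab' v d hvd]
      have hi' : i < st.ptr v d := by
        simpa [State.relabel, State.restart, put, hvd] using hi
      linarith [hl.scanned v d i x hi' hx hxt hlen]
  · intro v d
    simp only [State.relabel, State.restart, put]
    split_ifs
    · exact Nat.zero_le _
    · exact hl.ptr_le v d
  · intro v d h
    by_cases hvd : v = st.cur ∧ d = st.d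
    · obtain ⟨rfl, rfl⟩ := hvd
      exact ⟨hsat, hp.vis, hp.d_le⟩
    · exact hl.active v d (by simpa [State.relabel, State.restart, put, hvd] using h)

theorem FlowInv.relabel_of_ne (hf : FlowInv I st) (h : ¬ (st.cur = I.N.s ∧ st.d = I.h)) :
    FlowInv I (st.relabel I) := by
  have ht : (st.relabel I).top I = st.top I := by
    have : ¬ (I.N.s = st.cur ∧ I.h = st.d) := fun h' => h ⟨h'.1.symm, h'.2.symm⟩
    simp [State.relabel, State.restart, State.top, put, this]
  exact ⟨hf.augs_path, hf.augs_cap, hf.wt_le, hf.touched_nodup, hf.mem_touched, hf.sat_of_flow,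
    hf.vol_le, by rw [ht]; exact hf.potential, hf.den_nonneg, hf.num_nonneg, hf.num_pos, hf.cut⟩

/-- Labels bound the weights of paths. -/
theorem LabelInv.level_le_sum (H : I.Good) (hl : LabelInv I st) {P : List (Fin n)} {v : Fin n}
    {d : ℕ} (hv : v ≠ I.N.t) (hlast : (v :: P).getLast? = some I.N.t) (hnd : (v :: P).Nodup)
    (he : ∀ e ∈ pathEdges (v :: P), e ∈ I.N.edges) (hlen : I.N.pathLen (v :: P) ≤ d) :
    I.level (st.lab v d) ≤ ((pathEdges (v :: P)).map (I.wt st.g)).sum +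
      (pathEdges (v :: P)).length * I.gap (st.top I) := by
  induction P generalizing v d with
  | nil => simp at hlast; exact absurd hlast hv
  | cons x P ih =>
    have hcons : pathEdges (v :: x :: P) = (v, x) :: pathEdges (x :: P) := rfl
    have hL : I.N.pathLen (v :: x :: P) = I.N.len v x + I.N.pathLen (x :: P) := by
      simp [Network.pathLen, hcons]
    have hx : x ∈ I.N.out v := Network.mem_edges.1 (he (v, x) (by rw [hcons]; simp))
    rw [hcons]
    simp only [List.map_cons, List.sum_cons, List.length_cons, Nat.cast_add, Nat.cast_one]
    have hgap := H.gap_pos (st.top I)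
    have hsum := Input.sum_wt_nonneg (g := st.g) H (pathEdges (x :: P))
    by_cases hxt : x = I.N.t
    · subst hxt
      have h1 := hl.sink v d (Network.U_pos_iff.2 hx)
      have h2 : (0 : ℝ) ≤ (pathEdges (I.N.t :: P)).length * I.gap (st.top I) := by positivity
      linarith
    · have he' : ∀ e ∈ pathEdges (x :: P), e ∈ I.N.edges := fun e h =>
        he e (by rw [hcons]; exact List.mem_cons_of_mem _ h)
      have hlast' : (x :: P).getLast? = some I.N.t := by simpa using hlast
      -- Since `x` is not the sink, another edge follows; this gives the strict inequality that
      -- `arc` asks for.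
      have hpos : 0 < I.N.pathLen (x :: P) := by
        refine lt_of_lt_of_le ?_ (Network.pathEdges_length_le_pathLen he')
        cases P with
        | nil => simp at hlast'; exact absurd hlast' hxt
        | cons y P => simp [pathEdges]
      have h1 := hl.arc v d x hx hxt (by omega)
      have h2 := ih hxt hlast' hnd.of_cons he' (d := d - I.N.len v x) (by omega)
      linarith

/-- The label of the source certifies a lower bound for the weights of all paths. -/
theorem LabelInv.certified_le (H : I.Good) (hl : LabelInv I st) {P : List (Fin n)}
    (hP : I.N.IsHPath I.h P) :
    I.certified (st.top I) ≤ ((pathEdges P).map (I.wt st.g)).sum := by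
  obtain ⟨x, l, rfl⟩ := hP.eq_cons
  obtain ⟨-, h2, h3, h4, h5⟩ := hP
  have h6 := hl.level_le_sum H I.N.s_ne_t h2 h3 h4 h5
  have h7 : ((pathEdges (I.N.s :: x :: l)).length : ℝ) ≤ I.h := by
    exact_mod_cast (Network.pathEdges_length_le_pathLen h4).trans h5
  have h8 := mul_le_mul_of_nonneg_right h7 (H.gap_pos (st.top I)).le
  have h9 : I.level (st.top I) = I.level (st.lab I.N.s I.h) := rfl
  unfold Input.certified
  linarith

theorem cutSize_eq_vol_div (I : Input n) (g : Fin n × Fin n → ℕ) (c : ℝ) :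
    I.N.cutSize (fun e => I.wt g e / c) = I.vol g / c := by
  unfold Network.cutSize Input.vol
  rw [Finset.sum_div]
  exact Finset.sum_congr rfl fun e _ => by ring

/-- Raising the label of the source without recording the cut. -/
theorem FlowInv.relabel_of_le (hf : FlowInv I st)
    (H : I.Good)
    (hc : st.num * I.certified ((st.relabel I).top I) ≤ I.vol st.g * st.den) :
    FlowInv I (st.relabel I) := by
  refine ⟨hf.augs_path, hf.augs_cap, hf.wt_le, hf.touched_nodup, hf.mem_touched, hf.sat_of_flow,
    hf.vol_le, ?_, hf.den_nonneg, hf.num_nonneg, hf.num_pos, hf.cut⟩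
  intro β hβ hadm
  change β * st.den ≤ st.num at hadm
  change β * I.certified ((st.relabel I).top I) ≤ I.vol st.g ∧ _
  refine ⟨?_, (hf.potential β hβ hadm).2⟩
  set c := I.certified ((st.relabel I).top I)
  have hvol := Input.vol_nonneg (g := st.g) H
  rcases le_or_gt c 0 with h0 | h0
  · exact (mul_nonpos_of_nonneg_of_nonpos hβ.le h0).trans hvol
  · rcases hf.den_nonneg.eq_or_lt with h1 | h1
    -- With denominator `0` the recorded ratio is infinite, and any positive certificate would have
    -- beaten it.
    · have h2 := hf.num_pos h1.symm
      rw [← h1, mul_zero] at hc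
      exact absurd (mul_pos h2 h0) (not_lt.2 hc)
    · refine le_of_mul_le_mul_right ?_ h1
      have := mul_le_mul_of_nonneg_right hadm h0.le
      linarith

/-- Raising the label of the source and recording the cut. -/
theorem FlowInv.record (H : I.Good) (hf : FlowInv I st) (hl : LabelInv I (st.relabel I))
    (hc : I.vol st.g * st.den < st.num * I.certified ((st.relabel I).top I)) :
    FlowInv I ((st.relabel I).record I) := by
  have hvol := Input.vol_nonneg (g := st.g) H
  have hcut : 0 < I.certified ((st.relabel I).top I) :=
    pos_of_mul_pos_right (lt_of_le_of_lt (mul_nonneg hvol hf.den_nonneg) hc) hf.num_nonneg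
  refine ⟨hf.augs_path, hf.augs_cap, hf.wt_le, hf.touched_nodup, hf.mem_touched, hf.sat_of_flow,
    hf.vol_le, ?_, hcut.le, hvol, fun h => absurd h hcut.ne', fun _ => ⟨⟨?_, ?_⟩, ?_⟩⟩
  · intro β hβ hadm
    change β * I.certified ((st.relabel I).top I) ≤ I.vol st.g at hadm
    -- The new ratio is below the old one, so a `β` admissible now was admissible before.
    refine ⟨hadm, (hf.potential β hβ ?_).2⟩
    set c := I.certified ((st.relabel I).top I)
    refine le_of_mul_le_mul_right ?_ hcut
    have := mul_le_mul_of_nonneg_right hadm hf.den_nonneg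
    linarith
  · intro e _
    exact div_nonneg (Input.wt_nonneg H) hcut.le
  · intro P hP
    change 1 ≤ ((pathEdges P).map fun e => I.wt st.g e / I.certified ((st.relabel I).top I)).sum
    have h1 := hl.certified_le H hP
    simp only [div_eq_mul_inv]
    rw [List.sum_map_mul_right, ← div_eq_mul_inv, one_le_div hcut]
    exact h1
  · exact cutSize_eq_vol_div I st.g _

theorem LabelInv.record (hl : LabelInv I st) : LabelInv I (st.record I) :=
  ⟨hl.lab_le, hl.base_le, hl.arc, hl.sink, hl.scanned, hl.ptr_le, hl.active⟩

theorem PathInv.record (hp : PathInv I st) : PathInv I (st.record I) :=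
  ⟨hp.head, hp.nodup, hp.sink_notMem, hp.edges, hp.len_le, hp.d_pos, hp.wt_le, hp.sat, hp.vis⟩

end

section

variable {n : ℕ} {I : Input n} {st : State n}

/-! #### Augmentation -/

theorem map_fst_pathEdges (P : List (Fin n)) : (pathEdges P).map Prod.fst = P.dropLast := by
  induction P with
  | nil => rfl
  | cons a P ih =>
    cases P with
    | nil => rfl
    | cons c P =>
      have : pathEdges (a :: c :: P) = (a, c) :: pathEdges (c :: P) := rfl
      rw [this, List.map_cons, ih]; rfl

theorem State.g_augment (st : State n) (I : Input n) (b : ℕ) (e : Fin n × Fin n) :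
    (st.augment I b).g e = st.g e + if e ∈ pathEdges (st.path ++ [I.N.t]) then b else 0 :=
  units_append _ _ _ _

theorem State.g_le_augment (st : State n) (I : Input n) (b : ℕ) (e : Fin n × Fin n) :
    st.g e ≤ (st.augment I b).g e := by
  rw [st.g_augment]; exact Nat.le_add_right _ _

/-- Augmenting only raises weights, and these stand on the larger side of every inequality of the
invariant. -/
theorem LabelInv.augment (H : I.Good) (hl : LabelInv I st) (b : ℕ) :
    LabelInv I (st.augment I b) := by
  have hg := st.g_le_augment I b
  refine ⟨hl.lab_le, hl.base_le, ?_, ?_, ?_, hl.ptr_le, ?_⟩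
  · intro v d x hx hxt hlen
    have h1 := Input.wt_mono H (hg (v, x))
    have h2 := hl.arc v d x hx hxt hlen
    change I.level (st.lab v d) ≤ _ + I.gap (st.top I) + I.level (st.lab x _)
    linarith
  · intro v d hv
    have h1 := Input.wt_mono H (hg (v, I.N.t))
    have h2 := hl.sink v d hv
    change I.level (st.lab v d) ≤ _ + I.gap (st.top I)
    linarith
  · intro v d i x hi hx hxt hlen
    have h1 := Input.wt_mono H (hg (v, x))
    have h2 := hl.scanned v d i x hi hx hxt hlen
    change I.level (st.lab v d) < _ + I.level (st.lab x _)
    linarith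
  · intro v d h
    obtain ⟨h1, h2, h3⟩ := hl.active v d h
    exact ⟨h1.mono H hg, h2.mono H hg, h3⟩

/-- The weight of an augmenting path. -/
theorem PathInv.sum_wt_le (hp : PathInv I st)
    (hw : I.wt st.g (st.cur, I.N.t) ≤ I.level (st.lab st.cur st.d) + I.gap (st.top I)) :
    ((pathEdges (st.path ++ [I.N.t])).map (I.wt st.g)).sum ≤ I.level (st.top I + 1) := by
  rw [pathEdges_path_append, List.map_append, List.sum_append, Input.Good.level_succ]
  have := hp.wt_le
  simp only [List.map_cons, List.map_nil, List.sum_singleton]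
  linarith

/-- The ratio `5/3` is `5/4` for rounding up to the next level divided by `3/4` for the loss along a
path. Its distance from `2` leaves room for the other losses. -/
theorem level_succ_le (H : I.Good) (j : ℕ) :
    I.level (j + 1) ≤ 5 / 3 * (I.certified j + 1) - 1 := by
  rw [H.certified_eq]
  have := mul_le_mul_of_nonneg_right H.base_le (pow_pos H.base_pos j).le
  unfold Input.level
  rw [pow_succ']
  linarith

/-- An exponential potential keeps up with a multiplicative growth. -/
theorem add_le_mul_exp {x y a c κ t b : ℝ} (hκ : 0 ≤ κ) (ha : 0 ≤ a)
    (h1 : x + a ≤ a * Real.exp (κ * t)) (h2 : y ≤ x + κ * b * (c + a)) (hb : 0 ≤ b) (hc : c ≤ x) :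
    y + a ≤ a * Real.exp (κ * (t + b)) := by
  have h3 : y + a ≤ (x + a) * (1 + κ * b) := by
    have := mul_le_mul_of_nonneg_left (add_le_add_left hc a) (mul_nonneg hκ hb)
    linarith
  have h4 : 1 + κ * b ≤ Real.exp (κ * b) := by
    rw [add_comm]; exact Real.add_one_le_exp _
  calc y + a ≤ (x + a) * (1 + κ * b) := h3
    _ ≤ a * Real.exp (κ * t) * (1 + κ * b) :=
        mul_le_mul_of_nonneg_right h1 (by positivity)
    _ ≤ a * Real.exp (κ * t) * Real.exp (κ * b) :=
        mul_le_mul_of_nonneg_left h4 (by positivity)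
    _ = _ := by rw [mul_add, Real.exp_add, mul_assoc]

theorem FlowInv.augment (H : I.Good) (hf : FlowInv I st) (hp : PathInv I st)
    (hrun : I.certified (st.top I) < I.thr) (hc : 0 < I.N.sinkCap st.cur)
    (hw : I.wt st.g (st.cur, I.N.t) ≤ I.level (st.lab st.cur st.d) + I.gap (st.top I))
    {b : ℕ} (hb : ∀ e ∈ pathEdges (st.path ++ [I.N.t]), b ≤ I.N.U e.1 e.2)
    (hb' : ∃ e ∈ pathEdges (st.path ++ [I.N.t]), b = I.N.U e.1 e.2) :
    FlowInv I (st.augment I b) := by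
  have hP := hp.isHPath H hc
  have hnd := hP.2.2.1
  have hE := hP.2.2.2.1
  have hg := st.g_le_augment I b
  have hsum := hp.sum_wt_le hw
  have hlev := level_succ_le H (st.top I)
  have hthr := H.le_thr
  have hδ := H.delta_pos
  have hm := H.m_ge
  have hmthr := H.m_le_thr
  have hvol := Input.vol_add_le H (pathEdges_nodup hnd) hE hb (st.g_augment I b)
  have hlen : ((pathEdges (st.path ++ [I.N.t])).length : ℝ) ≤ I.N.m := by
    exact_mod_cast Network.pathEdges_length_le_m hnd hE
  have htotal : (total (st.augment I b).augs : ℝ) = total st.augs + b := by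
    rw [← Nat.cast_add, ← total_append]; rfl
  have hpos : 0 < b := by
    obtain ⟨e, he, rfl⟩ := hb'
    exact Network.U_pos_iff.2 (Network.mem_edges.1 (hE e he))
  set P := st.path ++ [I.N.t] with hPdef
  refine ⟨?_, ?_, ?_, ?_, ?_, ?_, ?_, ?_, hf.den_nonneg, hf.num_nonneg, hf.num_pos, hf.cut⟩
  · intro a ha
    rcases List.mem_append.1 ha with ha | ha
    · exact hf.augs_path a ha
    · rw [List.mem_singleton.1 ha]; exact hP
  · intro a ha
    rcases List.mem_append.1 ha with ha | ha
    · exact hf.augs_cap a ha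
    · rw [List.mem_singleton.1 ha]; exact hb'
  · intro e he
    have h1 := st.g_augment I b e
    split_ifs at h1 with h
    · have h2 := Input.wt_add_le_mul H (hb e h) h1
      have h3 := Input.wt_le_sum (g := st.g) H h
      have h4 := mul_le_mul H.growth_le
        (by linarith : I.wt st.g e + 1 ≤ 5 / 3 * (I.thr + 1))
        (by linarith [Input.wt_nonneg (g := st.g) (e := e) H]) (by norm_num)
      linarith
    · rw [Input.wt_congr (g' := st.g) h1]
      exact hf.wt_le e he
  · refine List.Nodup.append hf.touched_nodup ((pathEdges_nodup hnd).filter _) ?_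
    intro e h1 h2
    have h3 := (hf.mem_touched e).1 h1
    have h4 := (List.mem_filter.1 h2).2
    simp only [decide_eq_true_eq] at h4
    omega
  · intro e
    have h1 := st.g_augment I b e
    have h2 := hf.mem_touched e
    change e ∈ st.touched ++ _ ↔ _
    rw [List.mem_append, List.mem_filter, h2, h1]
    simp only [decide_eq_true_eq]
    rw [← hPdef]
    by_cases h : e ∈ pathEdges P
    · simp only [h, if_true, true_and]; omega
    · simp [h]
  · intro u x hx hxt
    rw [st.g_augment] at hx
    rcases Nat.eq_zero_or_pos (st.g (u, x)) with h0 | h0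
    · have hmem : (u, x) ∈ pathEdges P := by
        by_contra h
        rw [h0, if_neg h] at hx
        exact absurd hx (lt_irrefl _)
      rw [hPdef, pathEdges_path_append, List.mem_append, List.mem_singleton] at hmem
      rcases hmem with h | h
      · have hu : u ∈ st.path := fst_mem_of_mem_pathEdges h
        rw [State.path, List.mem_append, List.mem_singleton] at hu
        rcases hu with hu | rfl
        · exact (hp.sat u hu).mono H hg
        -- `cur` is the last vertex of a simple path and hence is not the tail of one of its edges;
        -- the only new flow leaving it goes to the sink.
        · exfalso
          have h1 : (pathEdges st.path).map Prod.fst ++ [st.cur] = st.path := by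
            rw [map_fst_pathEdges]; simp [State.path]
          have h2 := hp.nodup
          rw [← h1, List.nodup_append] at h2
          exact h2.2.2 _ (List.mem_map_of_mem (f := Prod.fst) h) _ (List.mem_singleton_self _) rfl
      · exact absurd (congrArg Prod.snd h) hxt
    · exact (hf.sat_of_flow u x h0 hxt).mono H hg
  · rw [htotal]
    -- The path weighs at most `5/3 · (thr + 1) - 1` and has at most `m ≤ thr` edges.
    have h1 := mul_le_mul_of_nonneg_left
      (by linarith : ((pathEdges P).map (I.wt st.g)).sum + (pathEdges P).length ≤ 3 * I.thr)
      (by positivity : 0 ≤ I.δ / 6 * b)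
    have h2 := hf.vol_le
    linarith
  · intro β hβ hadm
    obtain ⟨h1, h2⟩ := hf.potential β hβ hadm
    refine ⟨h1.trans (Input.vol_mono H hg), ?_⟩
    rw [htotal]
    -- Scaling by `β` makes `certified` comparable with the volume; the summand `a = β·m` pays for
    -- the edges of the path.
    refine add_le_mul_exp (c := β * I.certified (st.top I)) (by positivity) (by positivity) h2 ?_
      (Nat.cast_nonneg b) h1
    have h3 := mul_le_mul_of_nonneg_left
      (by linarith : ((pathEdges P).map (I.wt st.g)).sum + (pathEdges P).length ≤
        5 / 3 * (I.certified (st.top I) + I.N.m))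
      (by positivity : 0 ≤ I.δ / 6 * b)
    have h4 : 5 / 3 * (I.δ / 6) / β * b * (β * I.certified (st.top I) + β * I.N.m) =
        I.δ / 6 * b * (5 / 3 * (I.certified (st.top I) + I.N.m)) := by
      field_simp
    linarith

/-! ### Consequences of the invariants -/

/-- At the end the volume is at least `β·thr`, so `β` cancels against `β·m` and logarithms compare.
The second alternative replaces a positivity hypothesis. -/
theorem exp_bound {κ G m thr β x : ℝ} (hm : 1 ≤ m) (hβ : 0 < β) (h1 : β * thr ≤ x)
    (h2 : x + β * m ≤ β * m * Real.exp (κ * G)) : Real.log thr - Real.log m ≤ κ * G ∨ thr ≤ 0 := by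
  by_cases h0 : thr ≤ 0
  · exact Or.inr h0
  left
  push Not at h0
  have h3 : β * thr ≤ β * (m * Real.exp (κ * G)) := by
    have : 0 < β * m := by positivity
    linarith
  have h4 := le_of_mul_le_mul_left h3 hβ
  have h5 := Real.log_le_log h0 h4
  rw [Real.log_mul (by linarith) (Real.exp_pos _).ne', Real.log_exp] at h5
  linarith

theorem log_thr (H : I.Good) : Real.log I.thr = (6 / I.δ + 3) * Real.log I.N.m :=
  Real.log_rpow (by linarith [H.m_ge]) _

/-- The recorded cut is small when the source has a large label. -/
theorem FlowInv.num_div_den_le (H : I.Good) (hf : FlowInv I st)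
    (hdone : I.thr ≤ I.certified (st.top I)) (hden : 0 < st.den) :
    st.num / st.den ≤ (2 + I.δ) * (I.eta * total st.augs) := by
  have hη := H.eta_pos
  have hδ := H.delta_pos
  have hδ1 := H.delta_lt
  rcases hf.num_nonneg.eq_or_lt with h0 | h0
  · rw [← h0, zero_div]; positivity
  set β := st.num / st.den with hβdef
  have hβ : 0 < β := div_pos h0 hden
  obtain ⟨h1, h2⟩ := hf.potential β hβ (by rw [hβdef, div_mul_cancel₀ _ hden.ne'])
  have h3 : β * I.thr ≤ I.vol st.g := (mul_le_mul_of_nonneg_left hdone hβ.le).trans h1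
  rcases exp_bound (by linarith [H.m_ge]) hβ h3 h2 with h4 | h4
  swap
  · linarith [H.le_thr]
  rw [log_thr H] at h4
  have hlm := H.log_m_pos
  have hlg := H.log_growth_pos
  have h5 := H.le_log_growth
  set G : ℝ := (total st.augs : ℝ)
  have hG : 0 ≤ G := Nat.cast_nonneg _
  have h6 : β * ((6 / I.δ + 2) * Real.log I.N.m) ≤ 5 / 3 * (I.δ / 6) * G := by
    have := mul_le_mul_of_nonneg_left h4 hβ.le
    have h7 : β * (5 / 3 * (I.δ / 6) / β * G) = 5 / 3 * (I.δ / 6) * G := by field_simp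
    rw [h7] at this
    linarith
  have h8 : Real.log I.growth = I.eta * ((6 / I.δ + 4) * Real.log I.N.m) := by
    unfold Input.eta
    field_simp
  have h9 : β * ((6 / I.δ + 2) * Real.log I.N.m) ≤
      5 / 3 * (1 + I.δ / 6) * (I.eta * ((6 / I.δ + 4) * Real.log I.N.m)) * G := by
    rw [← h8]
    have := mul_le_mul_of_nonneg_right h5 hG
    linarith
  have h10 : (β * (6 / I.δ + 2)) * Real.log I.N.m ≤
      (5 / 3 * (1 + I.δ / 6) * (I.eta * (6 / I.δ + 4)) * G) * Real.log I.N.m := by linarith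
  have h11 := le_of_mul_le_mul_right h10 hlm
  -- After multiplication by `δ` this reads `10 + 25/3·δ + 10/9·δ² ≤ 12 + 10·δ + 2·δ²`. The
  -- exponents come from feasibility (`6/δ + 4`) and from `log thr - log m` (`6/δ + 2`).
  have h12 : 5 / 3 * (1 + I.δ / 6) * (6 / I.δ + 4) ≤ (2 + I.δ) * (6 / I.δ + 2) := by
    have h13 : 6 / I.δ + 4 = (6 + 4 * I.δ) / I.δ := by field_simp
    have h14 : 6 / I.δ + 2 = (6 + 2 * I.δ) / I.δ := by field_simp
    rw [h13, h14, ← mul_div_assoc, ← mul_div_assoc, div_le_div_iff_of_pos_right hδ]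
    nlinarith
  have h13 := mul_le_mul_of_nonneg_right h12 (mul_nonneg hη.le hG)
  have h14 : 0 < 6 / I.δ + 2 := by positivity
  refine le_of_mul_le_mul_right ?_ h14
  linarith

/-- Had no cut been recorded, every positive `β` would be admissible in `potential`, although the
ratio of volume to certified distance is finite. -/
theorem FlowInv.den_pos (H : I.Good) (hf : FlowInv I st)
    (hdone : I.thr ≤ I.certified (st.top I)) : 0 < st.den := by
  rcases hf.den_nonneg.eq_or_lt with h | h
  · have h1 := hf.num_pos h.symm
    have h2 : 0 < I.certified (st.top I) := by linarith [H.le_thr]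
    have h3 := Input.vol_nonneg (g := st.g) H
    have h4 := (hf.potential ((I.vol st.g + 1) / I.certified (st.top I)) (by positivity)
      (by rw [← h, mul_zero]; exact h1.le)).1
    rw [div_mul_cancel₀ _ h2.ne'] at h4
    linarith
  · exact h

end

section

variable {n : ℕ} {I : Input n} {st : State n}

/-! ### The computed flow and the computed cut -/

/-- The flow that consists of paths with amounts in multiples of `η`. -/
noncomputable def flowOf (η : ℝ) (augs : List (List (Fin n) × ℕ)) : List (Fin n) →₀ ℝ :=
  (augs.map fun a => Finsupp.single a.1 (η * a.2)).sum

theorem flowOf_cons (η : ℝ) (a : List (Fin n) × ℕ) (augs : List (List (Fin n) × ℕ)) :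
    flowOf η (a :: augs) = Finsupp.single a.1 (η * a.2) + flowOf η augs := by
  simp [flowOf]

theorem flowOf_apply (η : ℝ) (augs : List (List (Fin n) × ℕ)) (P : List (Fin n)) :
    flowOf η augs P = η * ((augs.map fun a => if a.1 = P then a.2 else 0).sum : ℕ) := by
  induction augs with
  | nil => simp [flowOf]
  | cons a augs ih =>
    rw [flowOf_cons, Finsupp.add_apply, ih, Finsupp.single_apply]
    simp only [List.map_cons, List.sum_cons, Nat.cast_add]
    split_ifs <;> simp [mul_add]

theorem edgeFlow_flowOf (η : ℝ) (augs : List (List (Fin n) × ℕ)) (e : Fin n × Fin n) :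
    edgeFlow (flowOf η augs) e = η * units augs e := by
  induction augs with
  | nil => simp [flowOf, edgeFlow, units]
  | cons a augs ih =>
    have h : units (a :: augs) e = (if e ∈ pathEdges a.1 then a.2 else 0) + units augs e := by
      simp [units]
    rw [flowOf_cons, edgeFlow, Finsupp.sum_add_index', Finsupp.sum_single_index, h]
    · change _ + edgeFlow (flowOf η augs) e = _
      rw [ih, Nat.cast_add, mul_add]
      split_ifs <;> simp
    · simp
    · simp
    · intro P x y
      split_ifs <;> simp

theorem flowValue_flowOf (η : ℝ) (augs : List (List (Fin n) × ℕ)) :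
    flowValue (flowOf η augs) = η * total augs := by
  induction augs with
  | nil => simp [flowOf, flowValue, total]
  | cons a augs ih =>
    have h : total (a :: augs) = a.2 + total augs := by simp [total]
    rw [flowOf_cons, flowValue, Finsupp.sum_add_index', Finsupp.sum_single_index, h]
    · change _ + flowValue (flowOf η augs) = _
      rw [ih, Nat.cast_add, mul_add]
    · rfl
    · simp
    · simp

theorem FlowInv.isHLengthFlow (H : I.Good) (hf : FlowInv I st) :
    I.N.IsHLengthFlow I.h (flowOf I.eta st.augs) := by
  have hη := H.eta_pos
  refine ⟨fun P => ?_, fun P hP => ?_, fun e he => ?_⟩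
  · rw [flowOf_apply]; positivity
  · rw [Finsupp.mem_support_iff, flowOf_apply] at hP
    have h1 : (st.augs.map fun a => if a.1 = P then a.2 else 0).sum ≠ 0 := by
      intro h; rw [h] at hP; simp at hP
    obtain ⟨x, hx, hx0⟩ := List.exists_mem_ne_zero_of_sum_ne_zero h1
    obtain ⟨a, ha, rfl⟩ := List.mem_map.1 hx
    by_cases haP : a.1 = P
    · rw [← haP]; exact hf.augs_path a ha
    · simp [haP] at hx0
  · rw [edgeFlow_flowOf]
    exact H.eta_mul_le (Network.U_pos_iff.2 (Network.mem_edges.1 he)) (hf.wt_le e he)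

/-- The weights that the flow determines. -/
noncomputable def Input.weight (I : Input n) (g : Fin n × Fin n → ℕ) (e : Fin n × Fin n) : ℝ :=
  (I.wt g e + 1) / I.thr

theorem weight_eq (H : I.Good) (st : State n) (e : Fin n × Fin n) :
    I.weight st.g e = (1 + I.δ / 6) ^
      (edgeFlow (flowOf I.eta st.augs) e / (I.eta * I.N.U e.1 e.2)) /
        (I.N.m : ℝ) ^ (6 / I.δ + 3) := by
  have hη := H.eta_pos
  rw [edgeFlow_flowOf, mul_div_mul_left _ _ hη.ne']
  simp [Input.weight, Input.wt, Input.thr, Input.growth, State.g]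

theorem LabelInv.isMovingCut (H : I.Good) (hl : LabelInv I st)
    (hdone : I.thr ≤ I.certified (st.top I)) : I.N.IsMovingCut I.h (I.weight st.g) := by
  have hthr := H.le_thr
  refine ⟨fun e _ => ?_, fun P hP => ?_⟩
  · have := Input.wt_nonneg (g := st.g) (e := e) H
    unfold Input.weight
    exact div_nonneg (by linarith) (by linarith)
  · have h1 := hl.certified_le H hP
    have h2 : ((pathEdges P).map (I.wt st.g)).sum / I.thr ≤
        ((pathEdges P).map (I.weight st.g)).sum := by
      rw [div_eq_mul_inv, ← List.sum_map_mul_right]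
      refine List.sum_le_sum fun e _ => ?_
      unfold Input.weight
      rw [← div_eq_mul_inv]
      exact div_le_div_of_nonneg_right (by linarith) (by linarith)
    refine le_trans ?_ h2
    rw [one_le_div (by linarith)]
    linarith

theorem log_growth_eq (H : I.Good) :
    Real.log I.growth = I.eta * ((6 / I.δ + 4) * Real.log I.N.m) := by
  have hδ := H.delta_pos
  have := H.log_m_pos
  unfold Input.eta
  field_simp

/-- The size of the cut in terms of the value of the flow. -/
theorem cutSize_weight_le (H : I.Good) (hf : FlowInv I st) (hl : LabelInv I st)
    (hdone : I.thr ≤ I.certified (st.top I)) (hP : ∃ P, I.N.IsHPath I.h P) :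
    I.N.cutSize (I.weight st.g) ≤
      140 * (Real.log n / I.δ) * flowValue (flowOf I.eta st.augs) := by
  obtain ⟨P, hP⟩ := hP
  have hthr := H.le_thr
  have hδ := H.delta_pos
  have hδ1 := H.delta_lt
  have hη := H.eta_pos
  set G : ℝ := (total st.augs : ℝ)
  have hG : 0 ≤ G := Nat.cast_nonneg _
  have h1 : I.N.cutSize (I.weight st.g) ≤ I.vol st.g / I.thr + 1 := by
    have h2 : I.N.cutSize (I.weight st.g) =
        I.vol st.g / I.thr + (∑ e ∈ I.N.edges, (I.N.U e.1 e.2 : ℝ)) / I.thr := by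
      unfold Network.cutSize Input.vol Input.weight
      rw [Finset.sum_div, Finset.sum_div, ← Finset.sum_add_distrib]
      exact Finset.sum_congr rfl fun e _ => by ring
    have h3 : (∑ e ∈ I.N.edges, (I.N.U e.1 e.2 : ℝ)) / I.thr ≤ 1 :=
      div_le_one_of_le₀ H.cap_sum (by linarith)
    linarith
  -- The initial weights contribute at most `1` to the size. An existing path, with capacities at
  -- least `1`, forces `vol / thr ≥ 1`, so this contribution at most doubles the size.
  have h2 : I.thr ≤ I.vol st.g := by
    refine hdone.trans ((hl.certified_le H hP).trans ?_)
    rw [← List.sum_toFinset _ (pathEdges_nodup hP.2.2.1)]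
    refine (Finset.sum_le_sum (g := fun e => (I.N.U e.1 e.2 : ℝ) * I.wt st.g e)
      fun e he => ?_).trans (Finset.sum_le_sum_of_subset_of_nonneg ?_ ?_)
    · have h3 : 0 < I.N.U e.1 e.2 :=
        Network.U_pos_iff.2 (Network.mem_edges.1 (hP.2.2.2.1 e (List.mem_toFinset.1 he)))
      have h4 : (1 : ℝ) ≤ I.N.U e.1 e.2 := by exact_mod_cast h3
      exact le_mul_of_one_le_left (Input.wt_nonneg H) h4
    · exact fun e he => hP.2.2.2.1 e (List.mem_toFinset.1 he)
    · exact fun e _ _ => mul_nonneg (Nat.cast_nonneg _) (Input.wt_nonneg H)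
  have h3 : I.vol st.g / I.thr ≤ I.δ / 2 * G := by
    rw [div_le_iff₀ (by linarith)]
    linarith [hf.vol_le]
  have h4 : 1 ≤ I.vol st.g / I.thr := by rwa [one_le_div (by linarith)]
  rw [flowValue_flowOf]
  have h5 : I.δ / 6 ≤ 7 / 6 * (I.eta * (10 / I.δ * (2 * Real.log n))) := by
    have h6 := H.le_log_growth
    have h7 := H.log_growth_pos
    have h8 : 6 / I.δ + 4 ≤ 10 / I.δ := by
      rw [div_add' _ _ _ hδ.ne', div_le_div_iff_of_pos_right hδ]; linarith
    have h9 : (6 / I.δ + 4) * Real.log I.N.m ≤ 10 / I.δ * (2 * Real.log n) :=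
      mul_le_mul h8 H.log_m_le H.log_m_pos.le (by positivity)
    calc I.δ / 6 ≤ (1 + I.δ / 6) * Real.log I.growth := h6
      _ ≤ 7 / 6 * Real.log I.growth := by gcongr; linarith
      _ = 7 / 6 * (I.eta * ((6 / I.δ + 4) * Real.log I.N.m)) := by rw [← log_growth_eq H]
      _ ≤ _ := by gcongr
  -- The size is at most `2 · (δ/2) · G = 6 · (δ/6) · G`, whence `140 = 6 · 7/6 · 10 · 2`.
  have h6 : 7 / 6 * (I.eta * (10 / I.δ * (2 * Real.log n))) * G * 6 =
      140 * (Real.log n / I.δ) * (I.eta * G) := by ring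
  have h7 := mul_le_mul_of_nonneg_right h5 hG
  linarith

/-- The identity is `δ · log growth = η · (6 + 4δ) · log m`, with `log growth` between `δ/7` and
`δ/6` and `6 + 4δ` between `6` and `10`. -/
theorem eta_bounds (H : I.Good) :
    1 / 70 * (I.δ ^ 2 / Real.log I.N.m) ≤ I.eta ∧ I.eta ≤ 1 / 36 * (I.δ ^ 2 / Real.log I.N.m) := by
  have hδ := H.delta_pos
  have hδ1 := H.delta_lt
  have hlm := H.log_m_pos
  have h0 := H.log_growth_pos
  have h1 := log_growth_eq H
  have hη := H.eta_pos
  have h2 : Real.log I.growth * I.δ = I.eta * (6 + 4 * I.δ) * Real.log I.N.m := by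
    rw [h1]; field_simp
  constructor
  · rw [← mul_div_assoc, div_le_iff₀ hlm]
    have h3 : I.δ / 6 ≤ 7 / 6 * Real.log I.growth := by
      refine H.le_log_growth.trans ?_
      gcongr; linarith
    have h4 := mul_le_mul_of_nonneg_right h3 hδ.le
    have h5 : I.eta * (6 + 4 * I.δ) * Real.log I.N.m ≤ I.eta * 10 * Real.log I.N.m := by
      gcongr; linarith
    nlinarith
  · rw [← mul_div_assoc, le_div_iff₀ hlm]
    have h4 := mul_le_mul_of_nonneg_right H.log_growth_le hδ.le
    have h5 : I.eta * 6 * Real.log I.N.m ≤ I.eta * (6 + 4 * I.δ) * Real.log I.N.m := by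
      gcongr; linarith
    nlinarith

end

section

variable {n : ℕ} {I : Input n} {st : State n}

/-! ### The amount of work -/

/-- The work done in scanning adjacency lists. -/
def State.scans (st : State n) (I : Input n) : ℕ :=
  ∑ v, ∑ d ∈ Finset.range (I.h + 1),
    (st.lab v d * (I.N.outDeg v + (I.h + 1) * (I.h + 1)) + st.ptr v d)

/-- A bound for the work done so far. -/
def State.work (st : State n) (I : Input n) : ℕ :=
  st.scans I + (I.h + 1) * (I.h + 1) * st.augs.length +
    st.top I * (st.touched.length + 1) + (I.h + 1) * (I.h - st.d)

/-- A push takes time `O(h + 1)` and is paid by the drop of the budget. A restart forfeits at most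
`(h + 1)·h` of that credit, which the `(h + 1)²` granted for each augmentation and each relabelling
replaces. -/
theorem State.work_push (hp : PathInv I st) {x : Fin n} (hx : x ∈ I.N.out st.cur)
    (hlen : I.N.len st.cur x < st.d) : st.work I + (I.h + 1) ≤ (st.push I x).work I := by
  have h1 := I.N.len_pos st.cur x hx
  have h2 := hp.d_le
  have h3 : I.h - st.d + 1 ≤ I.h - (st.d - I.N.len st.cur x) := by omega
  have h4 := Nat.mul_le_mul_left (I.h + 1) h3
  have h5 : (st.push I x).work I = st.scans I + (I.h + 1) * (I.h + 1) * st.augs.length +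
    st.top I * (st.touched.length + 1) + (I.h + 1) * (I.h - (st.d - I.N.len st.cur x)) := rfl
  rw [h5, State.work]
  rw [mul_add, mul_one] at h4
  omega

/-- Changing one summand of a double sum. -/
theorem sum_put_le {F F' : Fin n → ℕ → ℕ} {v : Fin n} {d k x : ℕ} (hd : d ≤ k)
    (h1 : F v d + x ≤ F' v d) (h2 : ∀ v' d', F v' d' ≤ F' v' d') :
    (∑ v, ∑ d ∈ Finset.range (k + 1), F v d) + x ≤ ∑ v, ∑ d ∈ Finset.range (k + 1), F' v d := by
  rw [← Finset.sum_product', ← Finset.sum_product']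
  have hmem : (v, d) ∈ (Finset.univ : Finset (Fin n)) ×ˢ Finset.range (k + 1) := by
    simp; omega
  rw [← Finset.add_sum_erase _ _ hmem, ← Finset.add_sum_erase _ (fun y => F' y.1 y.2) hmem]
  have h3 := Finset.sum_le_sum
    (s := ((Finset.univ : Finset (Fin n)) ×ˢ Finset.range (k + 1)).erase (v, d))
    fun y _ => h2 y.1 y.2
  simp only at h1 ⊢
  omega

theorem State.work_skip (hp : PathInv I st) : st.work I + 1 ≤ st.skip.work I := by
  have h1 : st.scans I + 1 ≤ st.skip.scans I := by
    refine sum_put_le (v := st.cur) (d := st.d) hp.d_le ?_ ?_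
    · simp [State.skip, put, add_assoc]
    · intro v d
      simp only [State.skip, put]
      split_ifs with h
      · rw [h.1, h.2]; omega
      · exact le_rfl
  have h2 : st.skip.work I = st.skip.scans I + (I.h + 1) * (I.h + 1) * st.augs.length +
    st.top I * (st.touched.length + 1) + (I.h + 1) * (I.h - st.d) := rfl
  rw [h2, State.work]
  omega

theorem State.work_augment (st : State n) (I : Input n) (b : ℕ) :
    st.work I + (I.h + 1) ≤ (st.augment I b).work I := by
  have h1 : (st.augment I b).work I = st.scans I +
    (I.h + 1) * (I.h + 1) * (st.augs ++ [(st.path ++ [I.N.t], b)]).length +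
    st.top I * ((st.touched ++ (pathEdges (st.path ++ [I.N.t])).filter
      fun e => st.g e = 0).length + 1) + (I.h + 1) * (I.h - I.h) := rfl
  rw [h1, State.work]
  simp only [List.length_append, List.length_singleton]
  have h2 : (I.h + 1) * (I.h - st.d) ≤ (I.h + 1) * I.h := Nat.mul_le_mul_left _ (Nat.sub_le _ _)
  have h3 : ∀ k, st.top I * (st.touched.length + 1) ≤ st.top I * (st.touched.length + k + 1) :=
    fun k => Nat.mul_le_mul_left _ (by omega)
  have h4 := h3 ((pathEdges (st.path ++ [I.N.t])).filter fun e => st.g e = 0).length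
  rw [mul_add (_ * _) _ 1, mul_one, show (I.h + 1) * (I.h + 1) = (I.h + 1) * I.h + (I.h + 1) by ring]
  omega

theorem State.work_relabel_aux (hl : LabelInv I st) (hp : PathInv I st) :
    st.scans I + (I.h + 1) * (I.h + 1) ≤ (st.relabel I).scans I := by
  refine sum_put_le (v := st.cur) (d := st.d) hp.d_le ?_ ?_
  · have := hl.ptr_le st.cur st.d
    simp only [State.relabel, State.restart, put, and_self, if_true, add_mul (st.lab _ _) 1, one_mul,
      add_zero]
    omega
  · intro v d
    simp only [State.relabel, State.restart, put]
    split_ifs with h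
    · have := hl.ptr_le st.cur st.d
      rw [h.1, h.2, add_mul (st.lab _ _) 1, one_mul]
      omega
    · exact le_rfl

theorem State.work_relabel (hl : LabelInv I st) (hp : PathInv I st) :
    st.work I + 1 ≤ (st.relabel I).work I := by
  have h1 := State.work_relabel_aux hl hp
  have h2 : (st.relabel I).work I = (st.relabel I).scans I +
    (I.h + 1) * (I.h + 1) * st.augs.length +
    (st.relabel I).top I * (st.touched.length + 1) + (I.h + 1) * (I.h - I.h) := rfl
  rw [h2, State.work]
  have h3 : (I.h + 1) * (I.h - st.d) ≤ (I.h + 1) * I.h := Nat.mul_le_mul_left _ (Nat.sub_le _ _)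
  have h4 := Nat.mul_le_mul_right (st.touched.length + 1) (st.top_relabel_le I).1
  rw [show (I.h + 1) * (I.h + 1) = (I.h + 1) * I.h + (I.h + 1) by ring] at h1 ⊢
  omega

/-- Recording a cut takes time proportional to the number of touched edges, and happens only when
the label of the source rises. -/
theorem State.work_relabel_top (hl : LabelInv I st) (hp : PathInv I st)
    (h : st.cur = I.N.s ∧ st.d = I.h) :
    st.work I + (st.touched.length + 1) ≤ (st.relabel I).work I := by
  have h1 := State.work_relabel_aux hl hp
  have h2 : (st.relabel I).work I = (st.relabel I).scans I +
    (I.h + 1) * (I.h + 1) * st.augs.length +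
    (st.relabel I).top I * (st.touched.length + 1) + (I.h + 1) * (I.h - I.h) := rfl
  have h5 : (st.relabel I).top I = st.top I + 1 := by
    simp [State.relabel, State.restart, State.top, put, h.1, h.2]
  rw [h2, State.work, h5, h.2, add_mul (st.top I) 1, one_mul]
  omega

/-! #### Bounding the work by the local size -/

open Classical in
/-- The total out-degree of the vertices that may have been scanned. -/
noncomputable def satDeg (I : Input n) (g : Fin n × Fin n → ℕ) : ℕ :=
  ∑ v ∈ Finset.univ.filter (I.Sat g), I.N.outDeg v

theorem FlowInv.flow_le (H : I.Good) (hf : FlowInv I st) (e : Fin n × Fin n) :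
    I.eta * st.g e ≤ I.N.U e.1 e.2 := by
  by_cases he : e ∈ I.N.edges
  · exact H.eta_mul_le (Network.U_pos_iff.2 (Network.mem_edges.1 he)) (hf.wt_le e he)
  · have : st.g e = 0 := by
      refine List.sum_eq_zero fun x hx => ?_
      obtain ⟨a, ha, rfl⟩ := List.mem_map.1 hx
      exact if_neg fun h => he ((hf.augs_path a ha).2.2.2.1 e h)
    rw [this]; simp

theorem FlowInv.sum_sink_le (H : I.Good) (hf : FlowInv I st) :
    I.eta * ∑ v ∈ I.N.inner, (st.g (v, I.N.t) : ℝ) ≤ ∑ v ∈ I.N.inner, (I.N.srcCap v : ℝ) := by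
  have h1 : (∑ v ∈ I.N.inner, (st.g (v, I.N.t) : ℝ)) ≤ ∑ v ∈ I.N.inner, (st.g (I.N.s, v) : ℝ) := by
    exact_mod_cast Network.sum_units_sink_le hf.augs_path
  refine (mul_le_mul_of_nonneg_left h1 H.eta_pos.le).trans ?_
  rw [Finset.mul_sum]
  exact Finset.sum_le_sum fun v _ => hf.flow_le H (I.N.s, v)

/-- Capacities are at least `1`; the `2` allows for a loop at the source and for the edge to the
sink. -/
theorem outDeg_source_le (N : Network n) : N.outDeg N.s ≤ (∑ v ∈ N.inner, N.srcCap v) + 2 := by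
  have h1 : N.outDeg N.s = (N.out N.s).toFinset.card :=
    (List.toFinset_card_of_nodup (N.nodup _)).symm
  have h2 : (N.out N.s).toFinset ⊆
      (N.inner.filter fun v => 0 < N.srcCap v) ∪ {N.s, N.t} := by
    intro v hv
    have hv' : 0 < N.srcCap v := Network.U_pos_iff.2 (List.mem_toFinset.1 hv)
    simp only [Finset.mem_union, Finset.mem_filter, Finset.mem_insert, Finset.mem_singleton,
      Network.inner, Finset.mem_univ, true_and]
    tauto
  have h3 : (N.inner.filter fun v => 0 < N.srcCap v).card ≤ ∑ v ∈ N.inner, N.srcCap v := by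
    rw [Finset.card_filter]
    exact Finset.sum_le_sum fun v _ => by split_ifs <;> omega
  rw [h1]
  exact (Finset.card_le_card h2).trans ((Finset.card_union_le _ _).trans
    (add_le_add h3 Finset.card_le_two))

/-- The heart of locality: `deg⁺(v) ≤ max(deg⁺(v) - c·∇(v), 0) + c·∇(v)`, a scanned inner vertex has
`∇(v) ≤ h·g(v,t)`, and `η` times the total flow from inner vertices into the sink is at most the sum
of the source capacities. -/
theorem FlowInv.satDeg_le (H : I.Good) (hf : FlowInv I st) {c : ℝ} (hc : 1 ≤ c) :
    I.eta * satDeg I st.g ≤ (2 * I.eta + I.eta + I.h) * (1 + I.N.localSize c) := by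
  classical
  have hη := H.eta_pos
  have hh := H.h_pos
  set A : ℝ := ∑ v ∈ I.N.inner, (I.N.srcCap v : ℝ)
  set B : ℝ := ∑ v ∈ I.N.inner, max ((I.N.outDeg v : ℝ) - c * I.N.sinkCap v) 0
  set F : ℝ := ∑ v ∈ I.N.inner, (st.g (v, I.N.t) : ℝ)
  have hA : 0 ≤ A := Finset.sum_nonneg fun _ _ => Nat.cast_nonneg _
  have hB : 0 ≤ B := Finset.sum_nonneg fun _ _ => le_max_right _ _
  have hX : I.N.localSize c = c * A + B := by
    rw [Finset.mul_sum, ← Finset.sum_add_distrib]; rfl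
  have h1 : (satDeg I st.g : ℝ) ≤ I.N.outDeg I.N.s + (B + c * I.h * F) := by
    have h2 : (satDeg I st.g : ℝ) ≤
        ∑ v ∈ insert I.N.s (I.N.inner.filter (I.Sat st.g)), (I.N.outDeg v : ℝ) := by
      unfold satDeg
      rw [Nat.cast_sum]
      refine Finset.sum_le_sum_of_subset_of_nonneg (fun v hv => ?_) fun _ _ _ => Nat.cast_nonneg _
      have hv' := (Finset.mem_filter.1 hv).2
      simp only [Finset.mem_insert, Finset.mem_filter, Network.inner, Finset.mem_univ, true_and]
      have := hv'.1
      tauto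
    refine h2.trans ?_
    rw [Finset.sum_insert (by simp [Network.inner])]
    refine add_le_add le_rfl ?_
    have h3 : B + c * I.h * F = ∑ v ∈ I.N.inner,
        (max ((I.N.outDeg v : ℝ) - c * I.N.sinkCap v) 0 + c * I.h * st.g (v, I.N.t)) := by
      rw [Finset.sum_add_distrib, Finset.mul_sum]
    rw [h3]
    refine (Finset.sum_le_sum (g := fun v => max ((I.N.outDeg v : ℝ) - c * I.N.sinkCap v) 0 +
      c * I.h * st.g (v, I.N.t)) fun v hv => ?_).trans
      (Finset.sum_le_sum_of_subset_of_nonneg (Finset.filter_subset _ _) fun v _ _ => ?_)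
    · have h4 : (I.N.sinkCap v : ℝ) ≤ I.h * st.g (v, I.N.t) := by
        rcases (Finset.mem_filter.1 hv).2.2 with h | h
        · rw [h, Nat.cast_zero]; positivity
        · exact_mod_cast Input.cap_le_of_wt H h
      have h5 := mul_le_mul_of_nonneg_left h4 (by linarith : 0 ≤ c)
      have h6 := le_max_left ((I.N.outDeg v : ℝ) - c * I.N.sinkCap v) 0
      linarith
    · have := le_max_right ((I.N.outDeg v : ℝ) - c * I.N.sinkCap v) 0
      positivity
  have h2 : (I.N.outDeg I.N.s : ℝ) ≤ A + 2 := by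
    have h := Nat.cast_le (α := ℝ).2 (outDeg_source_le I.N)
    push_cast at h
    exact h
  have h3 : I.eta * F ≤ A := hf.sum_sink_le H
  have h4 := mul_le_mul_of_nonneg_left h3 (by positivity : 0 ≤ c * I.h)
  have h5 : A ≤ c * A := le_mul_of_one_le_left hA hc
  have h6 := mul_le_mul_of_nonneg_left (h1.trans (add_le_add_left h2 _)) hη.le
  have h7 : I.h * (c * A) ≤ I.h * (c * A + B) := by gcongr; linarith
  have h8 := mul_le_mul_of_nonneg_left h5 hη.le
  rw [hX]
  have h9 : 0 ≤ I.eta * (c * A + B) := by positivity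
  nlinarith

/-- A touched edge not entering the sink leaves a vertex counted in `satDeg`; one entering it from
an inner vertex carries at least one unit. The tails `s` and `t` account for the `2`. -/
theorem FlowInv.touched_le (H : I.Good) (hf : FlowInv I st) :
    (st.touched.length : ℝ) ≤ satDeg I st.g + 2 + ∑ v ∈ I.N.inner, (st.g (v, I.N.t) : ℝ) := by
  classical
  have h0 : st.touched.length ≤ satDeg I st.g + (2 + ∑ v ∈ I.N.inner, st.g (v, I.N.t)) := by
    rw [← List.toFinset_card_of_nodup hf.touched_nodup]
    have h1 : st.touched.toFinset ⊆
        ((Finset.univ.filter (I.Sat st.g)).biUnion fun u =>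
          (I.N.out u).toFinset.image fun x => (u, x)) ∪
        (({I.N.s, I.N.t} ∪ I.N.inner.filter fun v => 0 < st.g (v, I.N.t)).image
          fun v => (v, I.N.t)) := by
      rintro ⟨u, x⟩ he
      have hg := (hf.mem_touched _).1 (List.mem_toFinset.1 he)
      have hU : 0 < I.N.U u x := by
        have h1 := hf.flow_le H (u, x)
        have h2 : (0 : ℝ) < I.eta * st.g (u, x) := by
          have := H.eta_pos
          have : (0 : ℝ) < st.g (u, x) := by exact_mod_cast hg
          positivity
        exact_mod_cast h2.trans_le h1
      rw [Finset.mem_union]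
      by_cases hx : x = I.N.t
      · right
        subst hx
        refine Finset.mem_image_of_mem _ ?_
        simp only [Network.inner, Finset.mem_union, Finset.mem_insert, Finset.mem_singleton,
          Finset.mem_filter, Finset.mem_univ, true_and]
        tauto
      · left
        rw [Finset.mem_biUnion]
        refine ⟨u, Finset.mem_filter.2 ⟨Finset.mem_univ _, hf.sat_of_flow u x hg hx⟩, ?_⟩
        exact Finset.mem_image_of_mem _ (List.mem_toFinset.2 (Network.U_pos_iff.1 hU))
    refine (Finset.card_le_card h1).trans ((Finset.card_union_le _ _).trans (add_le_add ?_ ?_))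
    · refine Finset.card_biUnion_le.trans (Finset.sum_le_sum fun u _ => ?_)
      exact Finset.card_image_le.trans (List.toFinset_card_le _)
    · refine Finset.card_image_le.trans ((Finset.card_union_le _ _).trans
        (add_le_add Finset.card_le_two ?_))
      rw [Finset.card_filter]
      exact Finset.sum_le_sum fun v _ => by split_ifs <;> omega
  have h1 : (st.touched.length : ℝ) ≤
      (satDeg I st.g + (2 + ∑ v ∈ I.N.inner, st.g (v, I.N.t)) : ℕ) := by exact_mod_cast h0
  push_cast at h1
  linarith

/-- Every augmentation saturates a fraction `η` of an edge. -/
theorem FlowInv.augs_length_le (H : I.Good) (hf : FlowInv I st) :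
    I.eta * st.augs.length ≤ st.touched.length := by
  have hη := H.eta_pos
  have h1 : (st.augs.length : ℝ) ≤ ∑ e ∈ st.touched.toFinset, (st.g e : ℝ) / I.N.U e.1 e.2 := by
    have h2 : ∀ (T : Finset (Fin n × Fin n)) (augs : List (List (Fin n) × ℕ)),
        (∀ a ∈ augs, ∃ e ∈ T, e ∈ pathEdges a.1 ∧ 0 < I.N.U e.1 e.2 ∧ a.2 = I.N.U e.1 e.2) →
        (augs.length : ℝ) ≤ ∑ e ∈ T, (units augs e : ℝ) / I.N.U e.1 e.2 := by
      intro T augs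
      induction augs with
      | nil => intro _; simp [units]
      | cons a augs ih =>
        intro h
        have h3 := ih fun b hb => h b (List.mem_cons_of_mem _ hb)
        obtain ⟨e, heT, heP, hU, hae⟩ := h a List.mem_cons_self
        have h4 : ∀ e, (units (a :: augs) e : ℝ) / I.N.U e.1 e.2 =
            (if e ∈ pathEdges a.1 then a.2 else 0 : ℕ) / I.N.U e.1 e.2 +
              units augs e / I.N.U e.1 e.2 := by
          intro e
          rw [← add_div, ← Nat.cast_add]
          simp [units]
        simp only [h4, Finset.sum_add_distrib, List.length_cons, Nat.cast_add, Nat.cast_one]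
        have h5 := Finset.single_le_sum (f := fun e : Fin n × Fin n =>
          ((if e ∈ pathEdges a.1 then a.2 else 0 : ℕ) : ℝ) / I.N.U e.1 e.2)
          (fun _ _ => by positivity) heT
        have hU' : (I.N.U e.1 e.2 : ℝ) ≠ 0 := by exact_mod_cast hU.ne'
        have h6 : ((if e ∈ pathEdges a.1 then a.2 else 0 : ℕ) : ℝ) / I.N.U e.1 e.2 = 1 := by
          rw [if_pos heP, hae, div_self hU']
        simp only [h6] at h5
        linarith
    refine h2 _ _ fun a ha => ?_
    obtain ⟨e, he, hae⟩ := hf.augs_cap a ha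
    have hU : 0 < I.N.U e.1 e.2 :=
      Network.U_pos_iff.2 (Network.mem_edges.1 ((hf.augs_path a ha).2.2.2.1 e he))
    refine ⟨e, ?_, he, hU, hae⟩
    rw [List.mem_toFinset, hf.mem_touched]
    refine lt_of_lt_of_le (hae ▸ hU : 0 < a.2) ?_
    refine List.single_le_sum (fun _ _ => Nat.zero_le _) _ ?_
    refine List.mem_map.2 ⟨a, ha, if_pos he⟩
  have h2 : I.eta * ∑ e ∈ st.touched.toFinset, (st.g e : ℝ) / I.N.U e.1 e.2 ≤
      st.touched.toFinset.card := by
    rw [Finset.mul_sum, Finset.card_eq_sum_ones, Nat.cast_sum]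
    refine Finset.sum_le_sum fun e _ => ?_
    rw [← mul_div_assoc, Nat.cast_one]
    exact div_le_one_of_le₀ (hf.flow_le H e) (Nat.cast_nonneg _)
  rw [List.toFinset_card_of_nodup hf.touched_nodup] at h2
  exact (mul_le_mul_of_nonneg_left h1 hη.le).trans h2

/-- Only vertices in both `Sat` and `Vis` contribute. `Sat` alone could contain many vertices of
out-degree `0`; `Vis` bounds the number, since such a vertex is the source or the head of an arc
leaving a vertex in `Sat`. -/
theorem LabelInv.scans_le (hl : LabelInv I st) :
    st.scans I ≤ (I.h + 1) * ((st.top I + 1) *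
      (satDeg I st.g + (I.h + 1) * (I.h + 1) * (satDeg I st.g + 1)) + satDeg I st.g) := by
  classical
  set S := Finset.univ.filter (I.Sat st.g) with hS
  set T := S.filter (I.Vis st.g) with hT
  have hcard : T.card ≤ satDeg I st.g + 1 := by
    have h1 : T ⊆ S.biUnion (fun u => (I.N.out u).toFinset) ∪ {I.N.s} := by
      intro v hv
      rcases (Finset.mem_filter.1 hv).2 with h | ⟨u, hu, hv⟩
      · simp [h]
      · rw [Finset.mem_union, Finset.mem_biUnion]
        exact Or.inl ⟨u, by simpa [hS] using hu, List.mem_toFinset.2 hv⟩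
    refine (Finset.card_le_card h1).trans ((Finset.card_union_le _ _).trans
      (add_le_add ?_ (Finset.card_singleton _).le))
    exact Finset.card_biUnion_le.trans (Finset.sum_le_sum fun u _ => List.toFinset_card_le _)
  have hdeg : ∑ v ∈ T, I.N.outDeg v ≤ satDeg I st.g :=
    Finset.sum_le_sum_of_subset (Finset.filter_subset _ _)
  have h1 : st.scans I ≤ ∑ v ∈ T, (I.h + 1) * ((st.top I + 1) *
      (I.N.outDeg v + (I.h + 1) * (I.h + 1)) + I.N.outDeg v) := by
    unfold State.scans
    rw [← Finset.sum_subset (Finset.subset_univ T)]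
    · refine Finset.sum_le_sum fun v _ => ?_
      have := Finset.sum_le_card_nsmul (Finset.range (I.h + 1))
        (fun d => st.lab v d * (I.N.outDeg v + (I.h + 1) * (I.h + 1)) + st.ptr v d)
        ((st.top I + 1) * (I.N.outDeg v + (I.h + 1) * (I.h + 1)) + I.N.outDeg v)
        fun d _ => add_le_add (Nat.mul_le_mul_right _ (hl.lab_le v d)) (hl.ptr_le v d)
      simpa using this
    · intro v _ hv
      refine Finset.sum_eq_zero fun d _ => ?_
      have h0 : ¬ (0 < st.lab v d ∨ 0 < st.ptr v d) := fun h => by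
        obtain ⟨h1, h2, -⟩ := hl.active v d h
        exact hv (by simp [hT, hS, h1, h2])
      have h1 : st.lab v d = 0 := by omega
      have h2 : st.ptr v d = 0 := by omega
      simp [h1, h2]
  refine h1.trans ?_
  rw [← Finset.mul_sum, Finset.sum_add_distrib, ← Finset.mul_sum, Finset.sum_add_distrib,
    Finset.sum_const, smul_eq_mul]
  have h2 : T.card * ((I.h + 1) * (I.h + 1)) ≤
      (I.h + 1) * (I.h + 1) * (satDeg I st.g + 1) := by
    rw [mul_comm]; exact Nat.mul_le_mul_left _ hcard
  gcongr

end

/-! ### Polynomial bounds for labels, augmentations and work -/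

section

variable {n : ℕ} {I : Input n} {st : State n}

/-- The parameter in which the running time is polynomial. -/
noncomputable def Input.par (I : Input n) : ℝ := I.h + 1 / I.δ + Real.log n

theorem log_n_pos (H : I.Good) : 0 < Real.log n := by
  linarith [H.log_m_pos, H.log_m_le]

theorem par_bounds (H : I.Good) : 1 ≤ I.par ∧ (I.h : ℝ) ≤ I.par ∧ 1 / I.δ ≤ I.par ∧
    Real.log n ≤ I.par := by
  have h1 := H.h_pos
  have h2 := H.inv_delta
  have h3 := log_n_pos H
  unfold Input.par
  refine ⟨?_, ?_, ?_, ?_⟩ <;> linarith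

/-- `1/η ≤ 70 · log m / δ²`, and `log m ≤ 2 · log n`. -/
theorem one_le_eta_mul (H : I.Good) : 1 ≤ 140 * I.par ^ 3 * I.eta := by
  obtain ⟨h1, -, h2, h3⟩ := par_bounds H
  have hδ := H.delta_pos
  have hlm := H.log_m_pos
  have h4 := (eta_bounds H).1
  have h5 : 140 * I.par ^ 3 * (1 / 70 * (I.δ ^ 2 / Real.log I.N.m)) ≤ 140 * I.par ^ 3 * I.eta := by
    gcongr
  refine le_trans ?_ h5
  have h6 : 1 ≤ I.par * I.δ := by rwa [div_le_iff₀ hδ] at h2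
  have h7 : Real.log I.N.m ≤ 2 * I.par := by linarith [H.log_m_le]
  have h8 : 140 * I.par ^ 3 * (1 / 70 * (I.δ ^ 2 / Real.log I.N.m)) =
      (I.par * I.δ) ^ 2 * (2 * I.par) / Real.log I.N.m := by ring
  rw [h8, le_div_iff₀ hlm, one_mul]
  calc Real.log I.N.m ≤ 1 ^ 2 * (2 * I.par) := by linarith
    _ ≤ _ := by gcongr

/-- Logarithms of `base ^ top ≤ 2 · thr`, with `log base ≥ 1/(5h)`. This gives `100`; `140` is used
so that a single quantity bounds `h`, `top` and `1/η` in `work_le`. -/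
theorem LabelInv.top_le (H : I.Good) (hl : LabelInv I st) :
    (st.top I : ℝ) ≤ 140 * I.par ^ 3 := by
  obtain ⟨h1, h2, h3, h4⟩ := par_bounds H
  have hδ := H.delta_pos
  have hδ1 := H.delta_lt
  have hh := H.h_pos
  have h5 := Real.log_le_log (pow_pos H.base_pos _) hl.base_le
  have hthr := H.le_thr
  rw [Real.log_pow, Real.log_mul (by norm_num) (by linarith), log_thr H] at h5
  have h6 : Real.log 2 ≤ Real.log I.N.m := Real.log_le_log (by norm_num) H.m_ge
  have h7 : 1 ≤ 5 * (I.h : ℝ) * Real.log I.base := by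
    have h8 := Real.one_sub_inv_le_log_of_pos H.base_pos
    have h9 : 1 - I.base⁻¹ = 1 / (4 * I.h + 1) := by
      unfold Input.base
      field_simp
      ring
    have h10 : 1 / (5 * (I.h : ℝ)) ≤ 1 / (4 * I.h + 1) :=
      one_div_le_one_div_of_le (by linarith) (by linarith)
    have h11 : 1 / (5 * (I.h : ℝ)) ≤ Real.log I.base := by linarith
    rw [div_le_iff₀ (by linarith)] at h11
    linarith
  have h8 : 6 / I.δ + 4 ≤ 10 * I.par := by
    have : 6 / I.δ = 6 * (1 / I.δ) := by ring
    linarith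
  have h9 : (6 / I.δ + 4) * Real.log I.N.m ≤ 10 * I.par * (2 * I.par) :=
    mul_le_mul h8 (by linarith [H.log_m_le]) H.log_m_pos.le (by linarith)
  have h10 : (st.top I : ℝ) * Real.log I.base ≤ 10 * I.par * (2 * I.par) := by linarith
  calc (st.top I : ℝ) ≤ st.top I * (5 * (I.h : ℝ) * Real.log I.base) :=
        le_mul_of_one_le_right (Nat.cast_nonneg _) h7
    _ = 5 * I.h * (st.top I * Real.log I.base) := by ring
    _ ≤ 5 * I.par * (10 * I.par * (2 * I.par)) := by
        have := mul_nonneg (Nat.cast_nonneg (α := ℝ) (st.top I)) (Real.log_pos H.one_lt_base).le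
        gcongr
    _ ≤ 140 * I.par ^ 3 := by nlinarith [pow_pos (by linarith : 0 < I.par) 3]

/-- A polynomial bound for the sum of all contributions to the work. -/
theorem poly_bound {M Y h J S t N : ℝ} (hM : 1 ≤ M) (hY : 1 ≤ Y) (h0 : 0 ≤ h) (hh : h ≤ M)
    (hJ0 : 0 ≤ J) (hJ : J ≤ M) (hS0 : 0 ≤ S) (hS : S ≤ 4 * M ^ 2 * Y)
    (ht : t ≤ 7 * M ^ 2 * Y) (ht0 : 0 ≤ t) (hN : N ≤ 7 * M ^ 3 * Y) :
    (h + 1) * ((J + 1) * (S + (h + 1) * (h + 1) * (S + 1)) + S) + (h + 1) * (h + 1) * N +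
      J * (t + 1) + (h + 1) * h + (t + 2) ≤ 151 * M ^ 6 * Y := by
  have p : ∀ {i j : ℕ}, i ≤ j → M ^ i * Y ≤ M ^ j * Y := fun hij => by gcongr
  have h1 : h + 1 ≤ 2 * M := by linarith
  have h2 : J + 1 ≤ 2 * M := by linarith
  have q1 : M ≤ M ^ 2 * Y := by
    calc M = M ^ 1 * 1 := by ring
      _ ≤ M ^ 2 * Y := by gcongr; norm_num
  have q2 : (1 : ℝ) ≤ M ^ 2 * Y := by linarith
  have h3 : S + 1 ≤ 5 * (M ^ 2 * Y) := by linarith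
  have h4 : (h + 1) * (h + 1) * (S + 1) ≤ 20 * (M ^ 4 * Y) := by
    calc (h + 1) * (h + 1) * (S + 1) ≤ (2 * M) * (2 * M) * (5 * (M ^ 2 * Y)) := by gcongr
      _ = _ := by ring
  have h5 : S + (h + 1) * (h + 1) * (S + 1) ≤ 24 * (M ^ 4 * Y) := by
    linarith [p (show 2 ≤ 4 by norm_num)]
  have h6 : (J + 1) * (S + (h + 1) * (h + 1) * (S + 1)) ≤ 48 * (M ^ 5 * Y) := by
    calc _ ≤ 2 * M * (24 * (M ^ 4 * Y)) := by gcongr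
      _ = _ := by ring
  have h7 : (J + 1) * (S + (h + 1) * (h + 1) * (S + 1)) + S ≤ 52 * (M ^ 5 * Y) := by
    linarith [p (show 2 ≤ 5 by norm_num)]
  have h8 : (h + 1) * ((J + 1) * (S + (h + 1) * (h + 1) * (S + 1)) + S) ≤ 104 * (M ^ 6 * Y) := by
    calc _ ≤ 2 * M * (52 * (M ^ 5 * Y)) := by gcongr
      _ = _ := by ring
  have h9 : (h + 1) * (h + 1) * N ≤ 28 * (M ^ 5 * Y) := by
    calc (h + 1) * (h + 1) * N ≤ (h + 1) * (h + 1) * (7 * M ^ 3 * Y) := by gcongr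
      _ ≤ (2 * M) * (2 * M) * (7 * M ^ 3 * Y) := by gcongr
      _ = _ := by ring
  have h10 : J * (t + 1) ≤ 8 * (M ^ 3 * Y) := by
    calc J * (t + 1) ≤ M * (8 * (M ^ 2 * Y)) := by gcongr; linarith
      _ = _ := by ring
  have h11 : (h + 1) * h ≤ 2 * (M ^ 2 * Y) := by
    calc (h + 1) * h ≤ 2 * M * M := by gcongr
      _ = 2 * (M ^ 2 * 1) := by ring
      _ ≤ _ := by gcongr
  linarith [p (show 2 ≤ 6 by norm_num), p (show 3 ≤ 6 by norm_num), p (show 5 ≤ 6 by norm_num)]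

/-- The constant in the bound for the running time. -/
noncomputable def workConst : ℝ := 151 * 140 ^ 6

/-- With `M = 140 · par³`, scanned degrees and touched edges are `O(M²)` and augmentations `O(M³)`
times the local size plus `1`. The relabelling of at most `h + 1` budgets up to `top + 1` times, at
`(h + 1)²` each, leads to `M⁶`. -/
theorem work_le (H : I.Good) (hf : FlowInv I st) (hl : LabelInv I st) {c : ℝ} (hc : 1 ≤ c) :
    (st.work I : ℝ) + (st.touched.length + 2) ≤
      workConst * I.par ^ 18 * (1 + I.N.localSize c) := by
  obtain ⟨h1, h2, -, -⟩ := par_bounds H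
  have hη := H.eta_pos
  have hηM := one_le_eta_mul H
  have hJ := hl.top_le H
  have hpM : I.par ≤ 140 * I.par ^ 3 := by
    have := le_self_pow₀ h1 (show 3 ≠ 0 by norm_num)
    linarith
  set M := 140 * I.par ^ 3 with hMdef
  have hX0 : (∑ v ∈ I.N.inner, (I.N.srcCap v : ℝ)) ≤ I.N.localSize c := by
    refine Finset.sum_le_sum fun v _ => ?_
    have h3 := le_max_right ((I.N.outDeg v : ℝ) - c * I.N.sinkCap v) 0
    have h4 : (I.N.srcCap v : ℝ) ≤ c * I.N.srcCap v :=
      le_mul_of_one_le_left (Nat.cast_nonneg _) hc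
    linarith
  have hX : 0 ≤ I.N.localSize c :=
    (Finset.sum_nonneg fun _ _ => Nat.cast_nonneg _).trans hX0
  set Y := 1 + I.N.localSize c with hY
  have hM : 1 ≤ M := by linarith
  have hS : (satDeg I st.g : ℝ) ≤ 4 * M ^ 2 * Y := by
    have h3 := hf.satDeg_le H hc
    have h4 : (I.h : ℝ) ≤ M * (M * I.eta) :=
      (h2.trans hpM).trans (le_mul_of_one_le_right (by linarith) hηM)
    refine le_of_mul_le_mul_left ?_ hη
    refine h3.trans ?_
    calc (2 * I.eta + I.eta + I.h) * Y ≤ (2 * I.eta * 1 + I.eta * 1 + M * (M * I.eta)) * Y := by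
          rw [mul_one, mul_one]; gcongr
      _ ≤ (2 * I.eta * M ^ 2 + I.eta * M ^ 2 + M * (M * I.eta)) * Y := by
          have : 1 ≤ M ^ 2 := one_le_pow₀ hM
          gcongr
      _ = _ := by ring
  have hF : (∑ v ∈ I.N.inner, (st.g (v, I.N.t) : ℝ)) ≤ M * Y := by
    refine le_of_mul_le_mul_left ?_ hη
    calc _ ≤ I.N.localSize c := (hf.sum_sink_le H).trans hX0
      _ ≤ 1 * Y := by linarith
      _ ≤ M * I.eta * Y := by gcongr
      _ = _ := by ring
  have hMY : M * Y ≤ M ^ 2 * Y := by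
    have := le_self_pow₀ hM (show 2 ≠ 0 by norm_num)
    gcongr
  have hYM : Y ≤ M * Y := le_mul_of_one_le_left (by linarith) hM
  have ht : (st.touched.length : ℝ) ≤ 7 * M ^ 2 * Y := by
    have := hf.touched_le H
    linarith
  have hN : (st.augs.length : ℝ) ≤ 7 * M ^ 3 * Y := by
    refine le_of_mul_le_mul_left ?_ hη
    calc _ ≤ 1 * (st.touched.length : ℝ) := by rw [one_mul]; exact hf.augs_length_le H
      _ ≤ (M * I.eta) * (7 * M ^ 2 * Y) := by gcongr
      _ = _ := by ring
  have hscan : (st.scans I : ℝ) ≤ (I.h + 1) * ((st.top I + 1) *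
      (satDeg I st.g + (I.h + 1) * (I.h + 1) * (satDeg I st.g + 1)) + satDeg I st.g) := by
    exact_mod_cast hl.scans_le
  have hlast : ((I.h + 1) * (I.h - st.d) : ℕ) ≤ ((I.h : ℝ) + 1) * I.h := by
    have : (I.h + 1) * (I.h - st.d) ≤ (I.h + 1) * I.h := Nat.mul_le_mul_left _ (Nat.sub_le _ _)
    exact_mod_cast this
  have hfinal := poly_bound (N := st.augs.length) hM (by linarith : 1 ≤ Y) (Nat.cast_nonneg I.h)
    (h2.trans hpM) (Nat.cast_nonneg (st.top I)) hJ (Nat.cast_nonneg (satDeg I st.g)) hS ht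
    (Nat.cast_nonneg _) hN
  have hw : (st.work I : ℝ) = st.scans I + (I.h + 1) * (I.h + 1) * st.augs.length +
      st.top I * (st.touched.length + 1) + ((I.h + 1) * (I.h - st.d) : ℕ) := by
    unfold State.work
    push_cast
    ring
  have hC : workConst * I.par ^ 18 * Y = 151 * M ^ 6 * Y := by
    rw [hMdef, workConst]; ring
  rw [hw, hC]
  linarith

end

section

variable {n : ℕ} {I : Input n}

/-! ### Reasoning about programs -/

/-- `p` started in `σ` halts after at most `T` steps in a memory with property `Q`. -/
def Run (I : Input n) (p : Cmd) (σ : Mem) (T : ℕ) (Q : Mem → Prop) : Prop :=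
  ∃ T' ≤ T, ∃ τ, Exec I p σ T' τ ∧ Q τ

namespace Cmd

/-- Programs without loops. -/
def loopFree : Cmd → Bool
  | skip | setN .. | setR .. => true
  | seq p q | ite _ p q => p.loopFree && q.loopFree
  | loop .. => false

/-- A bound for the running time of programs without loops. -/
def time : Cmd → ℕ
  | skip => 1
  | setN _ i j x => i.cost + j.cost + x.cost + 1
  | setR _ i j x => i.cost + j.cost + x.cost + 1
  | seq p q => p.time + q.time
  | ite b p q => b.cost + max p.time q.time
  | loop .. => 0

open Classical in
/-- The effect of programs without loops. -/
noncomputable def effect (I : Input n) : Cmd → Mem → Mem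
  | skip, σ => σ
  | setN a i j x, σ => σ.setNat a (i.eval I σ) (j.eval I σ) (x.eval I σ)
  | setR a i j x, σ => σ.setReal a (i.eval I σ) (j.eval I σ) (x.eval I σ)
  | seq p q, σ => q.effect I (p.effect I σ)
  | ite b p q, σ => if b.Holds I σ then p.effect I σ else q.effect I σ
  | loop .., σ => σ

/-- Sequential composition. -/
def block : List Cmd → Cmd
  | [] => skip
  | p :: l => seq p (block l)

end Cmd

namespace Run

variable {p q : Cmd} {b : BExp} {σ : Mem} {S T T' : ℕ} {Q Q' : Mem → Prop}

theorem mono (h : Run I p σ T Q) (hT : T ≤ T') (hQ : ∀ τ, Q τ → Q' τ) : Run I p σ T' Q' :=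
  let ⟨T₀, h0, τ, h1, h2⟩ := h
  ⟨T₀, h0.trans hT, τ, h1, hQ τ h2⟩

theorem seq (h : Run I p σ S fun τ => Run I q τ T Q) : Run I (.seq p q) σ (S + T) Q := by
  obtain ⟨S', h0, τ, h1, T₀, h2, ρ, h3, h4⟩ := h
  exact ⟨_, add_le_add h0 h2, ρ, .seq h1 h3, h4⟩

theorem ite {B : ℕ} (hB : b.cost ≤ B) (h1 : b.Holds I σ → Run I p σ T Q)
    (h2 : ¬ b.Holds I σ → Run I q σ T Q) : Run I (.ite b p q) σ (B + T) Q := by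
  by_cases hb : b.Holds I σ
  · obtain ⟨T₀, h0, τ, h3, h4⟩ := h1 hb
    exact ⟨_, add_le_add hB h0, τ, .ite_true hb h3, h4⟩
  · obtain ⟨T₀, h0, τ, h3, h4⟩ := h2 hb
    exact ⟨_, add_le_add hB h0, τ, .ite_false hb h3, h4⟩

theorem exec_effect (hp : p.loopFree = true) (σ : Mem) :
    ∃ T' ≤ p.time, Exec I p σ T' (p.effect I σ) := by
  induction p generalizing σ with
  | skip => exact ⟨_, le_rfl, .skip σ⟩
  | setN => exact ⟨_, le_rfl, .setN ..⟩
  | setR => exact ⟨_, le_rfl, .setR ..⟩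
  | seq p q ihp ihq =>
    simp only [Cmd.loopFree, Bool.and_eq_true] at hp
    obtain ⟨S, h1, h2⟩ := ihp hp.1 σ
    obtain ⟨T, h3, h4⟩ := ihq hp.2 (p.effect I σ)
    exact ⟨_, add_le_add h1 h3, .seq h2 h4⟩
  | ite b p q ihp ihq =>
    simp only [Cmd.loopFree, Bool.and_eq_true] at hp
    by_cases hb : b.Holds I σ
    · obtain ⟨S, h1, h2⟩ := ihp hp.1 σ
      refine ⟨_, Nat.add_le_add_left (h1.trans (le_max_left _ _)) _, ?_⟩
      simpa [Cmd.effect, hb] using Exec.ite_true hb h2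
    · obtain ⟨S, h1, h2⟩ := ihq hp.2 σ
      refine ⟨_, Nat.add_le_add_left (h1.trans (le_max_right _ _)) _, ?_⟩
      simpa [Cmd.effect, hb] using Exec.ite_false hb h2
  | loop => simp [Cmd.loopFree] at hp

theorem straight (hp : p.loopFree = true) (hT : p.time ≤ T) (hQ : Q (p.effect I σ)) :
    Run I p σ T Q := by
  obtain ⟨T', h1, h2⟩ := exec_effect (I := I) hp σ
  exact ⟨T', h1.trans hT, _, h2, hQ⟩

/-- A loop with a known number of iterations. -/
theorem loop (N : ℕ) (P : ℕ → Mem → Prop) {B : ℕ} (hB : b.cost ≤ B) (h0 : P 0 σ)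
    (hstep : ∀ k < N, ∀ τ, P k τ → b.Holds I τ ∧ Run I p τ T (P (k + 1)))
    (hend : ∀ τ, P N τ → ¬ b.Holds I τ) :
    Run I (.loop b p) σ (N * (B + T) + B) (P N) := by
  have key : ∀ j k, k + j = N → ∀ τ, P k τ →
      Run I (.loop b p) τ (j * (B + T) + B) (P N) := by
    intro j
    induction j with
    | zero =>
      intro k hk τ hτ
      rw [add_zero] at hk
      subst hk
      exact ⟨_, by simpa using hB, τ, .loop_false (hend τ hτ), hτ⟩
    | succ j ih =>
      intro k hk τ hτ
      obtain ⟨hb, S, h1, ρ, h2, h3⟩ := hstep k (by omega) τ hτ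
      obtain ⟨T', h4, ρ', h5, h6⟩ := ih (k + 1) (by omega) ρ h3
      refine ⟨_, ?_, ρ', .loop_true hb h2 h5, h6⟩
      rw [add_mul, one_mul]
      omega
  exact key N 0 (Nat.zero_add N) σ h0

/-- A loop whose running time is charged to an increasing bounded potential. -/
theorem loop_potential {α : Type*} (R : Mem → α → Prop) (W : α → ℕ) (B : ℕ)
    (hB : ∀ τ x, R τ x → W x ≤ B) (hb : 0 < b.cost)
    (hstep : ∀ τ x, R τ x → b.Holds I τ → ∃ y T, Run I p τ T (fun ρ => R ρ y) ∧
      b.cost + T + W x ≤ W y) {x : α} (h0 : R σ x) :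
    ∃ T τ y, Exec I (.loop b p) σ T τ ∧ R τ y ∧ ¬ b.Holds I τ ∧ T + W x ≤ W y + b.cost := by
  -- Induction on the potential that is left. As a test has positive cost, every iteration raises
  -- `W`, so termination comes with the time bound.
  have key : ∀ j σ x, R σ x → B - W x ≤ j →
      ∃ T τ y, Exec I (.loop b p) σ T τ ∧ R τ y ∧ ¬ b.Holds I τ ∧ T + W x ≤ W y + b.cost := by
    intro j
    induction j with
    | zero =>
      intro σ x hσ hj
      by_cases hb' : b.Holds I σ
      · obtain ⟨y, T, ⟨-, -, ρ, -, h3⟩, h2⟩ := hstep σ x hσ hb'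
        have := hB ρ y h3
        omega
      · exact ⟨_, σ, x, .loop_false hb', hσ, hb', by omega⟩
    | succ j ih =>
      intro σ x hσ hj
      by_cases hb' : b.Holds I σ
      · obtain ⟨y, T, ⟨T', h1, ρ, h4, h3⟩, h2⟩ := hstep σ x hσ hb'
        have := hB ρ y h3
        obtain ⟨S, τ, z, h5, h6, h7, h8⟩ := ih ρ y h3 (by omega)
        exact ⟨_, τ, z, .loop_true hb' h4 h5, h6, h7, by omega⟩
      · exact ⟨_, σ, x, .loop_false hb', hσ, hb', by omega⟩
  exact key _ σ x h0 le_rfl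

end Run

namespace Mem

variable (σ : Mem) (a i j x : ℕ) (y : ℝ)

@[simp] theorem setNat_real : (σ.setNat a i j x).real = σ.real := rfl

@[simp] theorem setReal_nat : (σ.setReal a i j y).nat = σ.nat := rfl

theorem setNat_nat (a' i' j' : ℕ) : (σ.setNat a i j x).nat a' i' j' =
    if a' = a ∧ i' = i ∧ j' = j then x else σ.nat a' i' j' := rfl

theorem setReal_real (a' i' j' : ℕ) : (σ.setReal a i j y).real a' i' j' =
    if a' = a ∧ i' = i ∧ j' = j then y else σ.real a' i' j' := rfl

theorem setNat_nat_of_ne {a' : ℕ} (h : a' ≠ a) : (σ.setNat a i j x).nat a' = σ.nat a' := by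
  funext i' j'
  simp [setNat_nat, h]

theorem setReal_real_of_ne {a' : ℕ} (h : a' ≠ a) : (σ.setReal a i j y).real a' = σ.real a' := by
  funext i' j'
  simp [setReal_real, h]

theorem setNat_nat_self : (σ.setNat a i j x).nat a =
    fun i' j' => if i' = i ∧ j' = j then x else σ.nat a i' j' := by
  funext i' j'
  simp [setNat_nat]

end Mem

/-- `τ` agrees with `σ` except on the arrays of naturals in `S` and the arrays of reals in `R`. -/
def Frame (S R : List ℕ) (σ τ : Mem) : Prop :=
  (∀ a, a ∉ S → τ.nat a = σ.nat a) ∧ ∀ a, a ∉ R → τ.real a = σ.real a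

/-! ### The program -/

namespace Prog

open Cmd

/-- A scalar variable. -/
def var (a : ℕ) : NExp := .get a (.const 0) (.const 0)

/-- A scalar variable. -/
def rvar (a : ℕ) : RExp := .get a (.const 0) (.const 0)

/-- Assignment to a scalar variable. -/
def set (a : ℕ) (x : NExp) : Cmd := .setN a (.const 0) (.const 0) x

/-- Assignment to a scalar variable. -/
def setr (a : ℕ) (x : RExp) : Cmd := .setR a (.const 0) (.const 0) x

/-- A numeral. -/
def num (k : ℕ) : RExp := .ofNat (.const k)

/-- Increment of a scalar variable. -/
def inc (a : ℕ) : Cmd := set a (.add (var a) (.const 1))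

/-- Inequality of natural numbers. -/
def ne (x y : NExp) : BExp := .not (.and (.not (.ltN x y)) (.not (.ltN y x)))

/-- The comparison `x ≤ y`. -/
def leN (x y : NExp) : BExp := .not (.ltN y x)

/-- The comparison `x ≤ y`. -/
def leR (x y : RExp) : BExp := .not (.ltR y x)

def growthE : RExp := .add (num 1) (.div .inδ (num 6))

def stepE : RExp := .div (num 1) (.mul (num 4) (.ofNat .inH))

def baseE : RExp := .add (num 1) stepE

def thrE : RExp := .pow (.ofNat .inM) (.add (.div (num 6) .inδ) (num 3))

def etaE : RExp :=
  .div (.log growthE) (.mul (.add (.div (num 6) .inδ) (num 4)) (.log (.ofNat .inM)))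

def levelE (j : NExp) : RExp := .sub (.pow baseE (.ofNat j)) (num 1)

def gapE (j : NExp) : RExp := .mul stepE (.pow baseE (.ofNat j))

/-- The excess weight of the edge `(u, v)` of capacity `c`. -/
def wtE (u v c : NExp) : RExp :=
  .sub (.pow growthE (.div (.ofNat (.get 7 u v)) (.ofNat c))) (num 1)

def topE : NExp := .get 8 .inS .inH

def certE : RExp := .sub (levelE topE) (.mul (.ofNat .inH) (gapE topE))

def labE : NExp := .get 8 (var 11) (var 5)

def ptrE : NExp := .get 9 (var 11) (var 5)

/-- The excess weight of the `i`-th touched edge. -/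
def touchedWt (i : NExp) : RExp :=
  wtE (.get 2 (.const 1) i) (.get 2 (.const 2) i) (.get 14 (.const 0) i)

/-- Arrays of naturals: `0` number and lengths of the output paths, `1` their vertices, `2` touched
edges, `3` edges of the recorded cut, `4` index of `cur` on the path, `5` budget, `6` capacities
along the path, `7` flow units, `8` labels, `9` arc pointers, `10` counter, `11` current vertex,
`12` and `13` scratch, `14` capacities of touched edges, `15` bottleneck. Arrays of reals: `0` path
values, `2` and `3` cut values, `4` and `5` the recorded fraction, `6` the volume. The current path
is built in the next free row of array `1`, so an augmentation copies nothing. -/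
def restart : Cmd :=
  block [.setN 1 (var 0) (.const 0) .inS, set 4 (.const 0), set 5 .inH, set 11 .inS]

def pushLoop : Cmd :=
  .loop (.and (leN (var 10) (var 4)) (ne (.get 1 (var 0) (var 10)) (var 12))) (inc 10)

/-- The capacity is saved while the position of the arc is known: apart from sink capacities,
queries take positions in adjacency lists, not pairs of vertices. -/
def push : Cmd :=
  .seq (block [.setN 6 (.const 0) (var 4) (.cap (var 11) ptrE), set 10 (.const 0)])
    (.seq pushLoop
      (block [set 4 (var 10), .setN 1 (var 0) (var 10) (var 12), set 5 (.sub (var 5) (var 13)),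
        set 11 (var 12)]))

def minLoop : Cmd :=
  .loop (leN (var 10) (var 4))
    (.seq (.ite (.ltN (.get 6 (.const 0) (var 10)) (var 15))
      (set 15 (.get 6 (.const 0) (var 10))) .skip) (inc 10))

def sendLoop : Cmd :=
  .loop (leN (var 10) (var 4))
    (block [set 12 (.get 1 (var 0) (var 10)), set 13 (.get 1 (var 0) (.add (var 10) (.const 1))),
      .ite (.ltN (.get 7 (var 12) (var 13)) (.const 1))
        (block [.setN 2 (.const 1) (var 2) (var 12), .setN 2 (.const 2) (var 2) (var 13),
          .setN 14 (.const 0) (var 2) (.get 6 (.const 0) (var 10)), inc 2]) .skip,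
      .setN 7 (var 12) (var 13) (.add (.get 7 (var 12) (var 13)) (var 15)), inc 10])

def augment : Cmd :=
  .seq (block [.setN 6 (.const 0) (var 4) (.sinkCap (var 11)),
      .setN 1 (var 0) (.add (var 4) (.const 1)) .inT, set 15 (.get 6 (.const 0) (.const 0)),
      set 10 (.const 0)])
    (.seq minLoop
      (.seq (set 10 (.const 0))
        (.seq sendLoop
          (block [.setR 0 (.const 0) (var 0) (.mul etaE (.ofNat (var 15))),
            .setN 0 (.const 1) (var 0) (.add (var 4) (.const 2)), inc 0, restart]))))

def volLoop : Cmd :=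
  .loop (.ltN (var 10) (var 2))
    (.seq (setr 6 (.add (rvar 6) (.mul (.ofNat (.get 14 (.const 0) (var 10))) (touchedWt (var 10)))))
      (inc 10))

def copyLoop : Cmd :=
  .loop (.ltN (var 10) (var 2))
    (block [.setN 3 (.const 1) (var 10) (.get 2 (.const 1) (var 10)),
      .setN 3 (.const 2) (var 10) (.get 2 (.const 2) (var 10)),
      .setR 3 (.const 1) (var 10) (.div (touchedWt (var 10)) certE), inc 10])

def record : Cmd :=
  .seq (block [setr 6 (num 0), set 10 (.const 0)])
    (.seq volLoop
      (.ite (.ltR (.mul (rvar 6) (rvar 5)) (.mul (rvar 4) certE))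
        (.seq (set 10 (.const 0))
          (.seq copyLoop (block [set 3 (var 2), setr 3 (num 0), setr 4 (rvar 6), setr 5 certE])))
        .skip))

/-- A cut is considered only when the source is relabelled at full budget: the certified distance
depends on this label alone, and in between the volume only grows, so no better ratio is missed. -/
def relabel : Cmd :=
  .seq (block [.setN 9 (var 11) (var 5) (.const 0),
      .setN 8 (var 11) (var 5) (.add labE (.const 1))])
    (.seq (.ite (.and (.not (ne (var 11) .inS)) (.not (ne (var 5) .inH))) record .skip) restart)

def skipArc : Cmd := .setN 9 (var 11) (var 5) (.add ptrE (.const 1))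

def canAugment : BExp :=
  .and (.ltN (.const 0) (.sinkCap (var 11)))
    (leR (wtE (var 11) .inT (.sinkCap (var 11))) (.add (levelE labE) (gapE topE)))

def canPush : BExp :=
  .and (ne (var 12) .inT) (.and (.ltN (var 13) (var 5))
    (leR (.add (wtE (var 11) (var 12) (.cap (var 11) ptrE))
      (levelE (.get 8 (var 12) (.sub (var 5) (var 13))))) (levelE labE)))

def step : Cmd :=
  .ite canAugment augment
    (.ite (.ltN ptrE (.deg (var 11)))
      (.seq (block [set 12 (.head (var 11) ptrE), set 13 (.len (var 11) ptrE)])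
        (.ite canPush push skipArc))
      relabel)

def guard : BExp := .ltR certE thrE

def main : Cmd := .loop guard step

def outLoop : Cmd :=
  .loop (.ltN (var 10) (var 2))
    (.seq (.setR 2 (.const 1) (var 10) (.div (.add (touchedWt (var 10)) (num 1)) thrE)) (inc 10))

/-- The algorithm. -/
def program : Cmd :=
  .seq (block [restart, setr 4 (num 1)])
    (.seq main
      (.seq (block [setr 2 (.div (num 1) thrE), set 10 (.const 0)]) outLoop))

variable (σ : Mem)

theorem ne_holds (x y : NExp) : (ne x y).Holds I σ ↔ x.eval I σ ≠ y.eval I σ := by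
  simp only [ne, BExp.Holds]
  omega

theorem leN_holds (x y : NExp) : (leN x y).Holds I σ ↔ x.eval I σ ≤ y.eval I σ := by
  simp [leN, BExp.Holds]

theorem leR_holds (x y : RExp) : (leR x y).Holds I σ ↔ x.eval I σ ≤ y.eval I σ := by
  simp [leR, BExp.Holds]

theorem var_eval (a : ℕ) : (var a).eval I σ = σ.nat a 0 0 := rfl

theorem rvar_eval (a : ℕ) : (rvar a).eval I σ = σ.real a 0 0 := rfl

theorem num_eval (k : ℕ) : (num k).eval I σ = k := rfl

theorem growthE_eval : growthE.eval I σ = I.growth := by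
  simp [growthE, RExp.eval, num_eval, Input.growth]

theorem stepE_eval : stepE.eval I σ = 1 / (4 * (I.h : ℝ)) := by
  simp [stepE, RExp.eval, num_eval, NExp.eval]

theorem baseE_eval : baseE.eval I σ = I.base := by
  simp [baseE, RExp.eval, num_eval, stepE_eval, Input.base]

theorem thrE_eval : thrE.eval I σ = I.thr := by
  simp [thrE, RExp.eval, num_eval, NExp.eval, Input.thr]

theorem etaE_eval : etaE.eval I σ = I.eta := by
  simp [etaE, RExp.eval, num_eval, NExp.eval, growthE_eval, Input.eta]

theorem levelE_eval (j : NExp) : (levelE j).eval I σ = I.level (j.eval I σ) := by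
  simp [levelE, RExp.eval, num_eval, baseE_eval, Input.level]

theorem gapE_eval (j : NExp) : (gapE j).eval I σ = I.gap (j.eval I σ) := by
  simp [gapE, RExp.eval, stepE_eval, baseE_eval, Input.gap]

theorem certE_eval : certE.eval I σ = I.certified (σ.nat 8 I.N.s I.h) := by
  simp [certE, RExp.eval, levelE_eval, gapE_eval, topE, NExp.eval, Input.certified]

theorem wtE_eval {g : Fin n × Fin n → ℕ} (hg : ∀ u v : Fin n, σ.nat 7 u v = g (u, v))
    {u v c : NExp} {e : Fin n × Fin n} (hu : u.eval I σ = e.1) (hv : v.eval I σ = e.2)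
    (hc : c.eval I σ = I.N.U e.1 e.2) : (wtE u v c).eval I σ = I.wt g e := by
  simp [wtE, RExp.eval, num_eval, growthE_eval, NExp.eval, hu, hv, hc, hg, Input.wt]

end Prog

end

section

variable {n : ℕ} {I : Input n} {st : State n} {σ τ : Mem}

/-! ### Memories that represent states -/

theorem Frame.refl (S R : List ℕ) (σ : Mem) : Frame S R σ σ := ⟨fun _ _ => rfl, fun _ _ => rfl⟩

theorem Frame.trans {S R : List ℕ} {ρ : Mem} (h1 : Frame S R σ τ) (h2 : Frame S R τ ρ) :
    Frame S R σ ρ :=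
  ⟨fun a ha => (h2.1 a ha).trans (h1.1 a ha), fun a ha => (h2.2 a ha).trans (h1.2 a ha)⟩

theorem Frame.setNat {S R : List ℕ} (h : Frame S R σ τ) {a : ℕ} (ha : a ∈ S) (i j x : ℕ) :
    Frame S R σ (τ.setNat a i j x) :=
  ⟨fun a' ha' => (Mem.setNat_nat_of_ne τ a i j x (fun e => ha' (by rw [e]; exact ha))).trans (h.1 a' ha'), h.2⟩

theorem Frame.setReal {S R : List ℕ} (h : Frame S R σ τ) {a : ℕ} (ha : a ∈ R) (i j : ℕ) (x : ℝ) :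
    Frame S R σ (τ.setReal a i j x) :=
  ⟨h.1, fun a' ha' => (Mem.setReal_real_of_ne τ a i j x (fun e => ha' (by rw [e]; exact ha))).trans (h.2 a' ha')⟩

/-- The list of augmentations is stored. -/
def OutRep (I : Input n) (augs : List (List (Fin n) × ℕ)) (σ : Mem) : Prop :=
  σ.nat 0 0 0 = augs.length ∧ ∀ j a, augs[j]? = some a →
    σ.outPath j = a.1.map Fin.val ∧ σ.real 0 0 j = I.eta * a.2

/-- The vertices of `P` are stored in a row of the array of paths. -/
def RowRep (P : List (Fin n)) (row : ℕ) (σ : Mem) : Prop :=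
  ∀ (i : ℕ) (v : Fin n), P[i]? = some v → σ.nat 1 row i = v

/-- The capacities of a list of edges are stored. -/
def CapRep (I : Input n) (L : List (Fin n × Fin n)) (σ : Mem) : Prop :=
  ∀ i e, L[i]? = some e → σ.nat 6 0 i = I.N.U e.1 e.2

/-- The list of touched edges is stored. -/
def TouchedRep (I : Input n) (L : List (Fin n × Fin n)) (σ : Mem) : Prop :=
  σ.nat 2 0 0 = L.length ∧ ∀ i e, L[i]? = some e →
    σ.nat 2 1 i = e.1 ∧ σ.nat 2 2 i = e.2 ∧ σ.nat 14 0 i = I.N.U e.1 e.2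

/-- The flow through the edges is stored. -/
def FlowRep (g : Fin n × Fin n → ℕ) (σ : Mem) : Prop := ∀ u v : Fin n, σ.nat 7 u v = g (u, v)

/-- `σ` represents `st` apart from the current path. -/
structure BaseRep (I : Input n) (σ : Mem) (st : State n) : Prop where
  out : OutRep I st.augs σ
  flow : FlowRep st.g σ
  lab : ∀ (v : Fin n) d, σ.nat 8 v d = st.lab v d
  ptr : ∀ (v : Fin n) d, σ.nat 9 v d = st.ptr v d
  touched : TouchedRep I st.touched σ
  snap : HoldsCut I σ 3 st.cut
  num : σ.real 4 0 0 = st.num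
  den : σ.real 5 0 0 = st.den

/-- `σ` represents `st`. -/
structure Rep (I : Input n) (σ : Mem) (st : State n) : Prop extends BaseRep I σ st where
  row : RowRep st.path st.augs.length σ
  cap : CapRep I (pathEdges st.path) σ
  k : σ.nat 4 0 0 = st.pre.length
  d : σ.nat 5 0 0 = st.d
  cur : σ.nat 11 0 0 = st.cur

theorem OutRep.congr {augs : List (List (Fin n) × ℕ)} (h : OutRep I augs σ)
    (h0 : τ.nat 0 = σ.nat 0) (h1 : ∀ j < augs.length, τ.nat 1 j = σ.nat 1 j)
    (h2 : τ.real 0 = σ.real 0) : OutRep I augs τ := by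
  refine ⟨by rw [h0]; exact h.1, fun j a hj => ?_⟩
  have hlt : j < augs.length := (List.getElem?_eq_some_iff.1 hj).1
  obtain ⟨h3, h4⟩ := h.2 j a hj
  refine ⟨?_, by rw [h2]; exact h4⟩
  rw [← h3]
  simp only [Mem.outPath, h0, h1 j hlt]

theorem TouchedRep.congr {L : List (Fin n × Fin n)} (h : TouchedRep I L σ)
    (h0 : τ.nat 2 = σ.nat 2) (h1 : τ.nat 14 = σ.nat 14) : TouchedRep I L τ := by
  unfold TouchedRep
  rw [h0, h1]; exact h

theorem HoldsCut.congr {a : ℕ} {w : Fin n × Fin n → ℝ} (h : HoldsCut I σ a w)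
    (h0 : τ.nat a = σ.nat a) (h1 : τ.real a = σ.real a) : HoldsCut I τ a w := by
  unfold HoldsCut
  rw [h0, h1]; exact h

namespace Network

theorem degQuery_val (N : Network n) (v : Fin n) : N.degQuery v = N.outDeg v := by
  simp [degQuery]

theorem sinkQuery_val (N : Network n) (v : Fin n) : N.sinkQuery v = N.sinkCap v := by
  simp [sinkQuery]

theorem entryQuery_val (N : Network n) (f : Fin n → Fin n → ℕ) (v : Fin n) {i : ℕ} {x : Fin n}
    (hx : (N.out v)[i]? = some x) : N.entryQuery f v i = f v x := by
  simp [entryQuery, hx]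

theorem U_of_getElem? (N : Network n) (v : Fin n) {i : ℕ} {x : Fin n}
    (hx : (N.out v)[i]? = some x) : N.U v x = N.cap v x :=
  if_pos (List.mem_of_getElem? hx)

end Network

theorem getElem?_takeWhile_ne (l : List (Fin n)) (x : Fin n) {j : ℕ}
    (hj : j < (l.takeWhile (· ≠ x)).length) : ∃ v, l[j]? = some v ∧ v ≠ x := by
  have h1 := List.getElem_mem hj
  have h2 := List.mem_takeWhile_imp h1
  refine ⟨(l.takeWhile (· ≠ x))[j], ?_, by simpa using h2⟩
  rw [← List.getElem?_eq_getElem hj]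
  obtain ⟨r, hr⟩ := List.takeWhile_prefix (l := l) (· ≠ x)
  conv_lhs => rw [← hr]
  rw [List.getElem?_append_left hj]

theorem getElem?_length_takeWhile (l : List (Fin n)) (x : Fin n) :
    (l.takeWhile (· ≠ x)).length = l.length ∨ l[(l.takeWhile (· ≠ x)).length]? = some x := by
  induction l with
  | nil => simp
  | cons a l ih =>
    by_cases h : a = x
    · simp [h]
    · simpa [List.takeWhile_cons, h] using ih

theorem State.length_path (st : State n) : st.path.length = st.pre.length + 1 := by
  simp [State.path]

theorem State.length_pathEdges (st : State n) : (pathEdges st.path).length = st.pre.length := by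
  rw [LocalFlow.length_pathEdges, st.length_path]; simp

/-- A list of capacities is extended by one entry. -/
theorem CapRep.append {L : List (Fin n × Fin n)} {e : Fin n × Fin n} (h : CapRep I L σ)
    (h1 : ∀ i < L.length, τ.nat 6 0 i = σ.nat 6 0 i)
    (h2 : τ.nat 6 0 L.length = I.N.U e.1 e.2) : CapRep I (L ++ [e]) τ := by
  intro i e' hi
  rcases lt_trichotomy i L.length with hlt | rfl | hlt
  · rw [List.getElem?_append_left hlt] at hi
    rw [h1 i hlt]; exact h i e' hi
  · rw [List.getElem?_concat_length] at hi
    obtain rfl := Option.some.inj hi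
    exact h2
  · rw [List.getElem?_eq_none (by simp; omega)] at hi
    simp at hi

theorem CapRep.of_prefix {L L' : List (Fin n × Fin n)} (h : CapRep I L' σ) (hL : L <+: L') :
    CapRep I L σ := by
  intro i e hi
  obtain ⟨r, rfl⟩ := hL
  have hlt : i < L.length := (List.getElem?_eq_some_iff.1 hi).1
  exact h i e (by rw [List.getElem?_append_left hlt]; exact hi)

theorem RowRep.append {L : List (Fin n)} {v : Fin n} {row : ℕ} (h : RowRep L row σ)
    (h1 : ∀ i < L.length, τ.nat 1 row i = σ.nat 1 row i)
    (h2 : τ.nat 1 row L.length = v) : RowRep (L ++ [v]) row τ := by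
  intro i e' hi
  rcases lt_trichotomy i L.length with hlt | rfl | hlt
  · rw [List.getElem?_append_left hlt] at hi
    rw [h1 i hlt]; exact h i e' hi
  · rw [List.getElem?_concat_length] at hi
    obtain rfl := Option.some.inj hi
    exact h2
  · rw [List.getElem?_eq_none (by simp; omega)] at hi
    simp at hi

theorem RowRep.of_prefix {L L' : List (Fin n)} {row : ℕ} (h : RowRep L' row σ) (hL : L <+: L') :
    RowRep L row σ := by
  intro i e hi
  obtain ⟨r, rfl⟩ := hL
  have hlt : i < L.length := (List.getElem?_eq_some_iff.1 hi).1
  exact h i e (by rw [List.getElem?_append_left hlt]; exact hi)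

/-! #### Moving along an arc -/

theorem push_run (hp : PathInv I st) (hr : Rep I σ st) {x : Fin n}
    (hx : (I.N.out st.cur)[st.ptr st.cur st.d]? = some x) (h12 : σ.nat 12 0 0 = x)
    (h13 : σ.nat 13 0 0 = I.N.len st.cur x) :
    Run I Prog.push σ (1000 * (I.h + 1)) (Rep I · (st.push I x)) := by
  set p := (st.path.takeWhile (· ≠ x)).length with hpdef
  have hpk : p ≤ st.pre.length + 1 := by
    rw [← st.length_path]; exact (List.takeWhile_sublist _).length_le
  have hkh : st.pre.length ≤ I.h := by
    rw [← st.length_pathEdges]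
    exact (Network.pathEdges_length_le_pathLen hp.edges).trans
      ((Nat.le_add_right _ _).trans hp.len_le)
  set σ₁ := (σ.setNat 6 0 st.pre.length (I.N.U st.cur x)).setNat 10 0 0 0 with hσ₁
  have hE : Cmd.effect I (Cmd.block [.setN 6 (.const 0) (Prog.var 4) (.cap (Prog.var 11) Prog.ptrE),
      Prog.set 10 (.const 0)]) σ = σ₁ := by
    simp only [Cmd.block, Cmd.effect, Prog.set, Prog.var, Prog.ptrE, NExp.eval, hr.k, hr.cur, hr.d,
      hr.ptr, I.N.entryQuery_val _ _ hx, hσ₁, I.N.U_of_getElem? _ hx]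
  have hcap : CapRep I (pathEdges (st.path ++ [x])) σ₁ := by
    rw [pathEdges_path_append]
    refine hr.cap.append (fun i hi => ?_) ?_
    · rw [st.length_pathEdges] at hi
      simp [hσ₁, Mem.setNat_nat, hi.ne]
    · rw [st.length_pathEdges]
      simp [hσ₁, Mem.setNat_nat]
  have hcnt : σ₁.nat 0 0 0 = st.augs.length := hr.out.1
  refine (Run.seq (S := 200) (Run.straight rfl (by decide) ?_)).mono
    (T := 200 + (p * (200 + 200) + 200 + 200)) ?_ fun _ h => h
  swap
  · have : p * 400 ≤ (I.h + 1) * 400 := Nat.mul_le_mul_right _ (by omega)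
    omega
  rw [hE]
  -- The scan stops at the occurrence of `x`, or one past the end of the path if there is none; both
  -- positions are `p`.
  refine Run.seq (Run.mono (Run.loop p (fun j τ => Frame [10] [] σ₁ τ ∧ τ.nat 10 0 0 = j)
    (B := 200) (T := 200) (by decide) ⟨Frame.refl _ _ _, by simp [hσ₁, Mem.setNat_nat]⟩ ?_ ?_) le_rfl ?_)
  · rintro j hj τ ⟨hF, h10⟩
    constructor
    · simp only [BExp.Holds, Prog.leN_holds, Prog.ne_holds, Prog.var_eval, NExp.eval, h10]
      obtain ⟨v, hv, hvx⟩ := getElem?_takeWhile_ne st.path x hj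
      rw [hF.1 4 (by simp), hF.1 1 (by simp), hF.1 0 (by simp), hF.1 12 (by simp)]
      refine ⟨?_, ?_⟩
      · change j ≤ σ.nat 4 0 0
        rw [hr.k]; omega
      · change σ.nat 1 (σ.nat 0 0 0) j ≠ σ.nat 12 0 0
        rw [hr.out.1, hr.row j v hv, h12]
        exact fun h => hvx (Fin.ext h)
    · refine Run.straight rfl (by decide) ⟨?_, ?_⟩
      · exact hF.setNat (by simp) _ _ _
      · simp [Prog.inc, Prog.set, Cmd.effect, NExp.eval, Prog.var_eval, h10, Mem.setNat_nat]
  · rintro τ ⟨hF, h10⟩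
    simp only [BExp.Holds, Prog.leN_holds, Prog.ne_holds, Prog.var_eval, NExp.eval, h10]
    rw [hF.1 4 (by simp), hF.1 1 (by simp), hF.1 0 (by simp), hF.1 12 (by simp)]
    rintro ⟨h1, h2⟩
    change p ≤ σ.nat 4 0 0 at h1
    change σ.nat 1 (σ.nat 0 0 0) p ≠ σ.nat 12 0 0 at h2
    rw [hr.k] at h1
    rcases getElem?_length_takeWhile st.path x with h | h
    · rw [st.length_path] at h; omega
    · rw [hr.out.1, hr.row p x h, h12] at h2
      exact h2 rfl
  · rintro τ ⟨hF, h10⟩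
    refine Run.straight rfl (by decide) ?_
    have e0 : τ.nat 0 = σ.nat 0 := hF.1 0 (by simp)
    have e1 : τ.nat 1 = σ.nat 1 := hF.1 1 (by simp)
    have e5 : τ.nat 5 = σ.nat 5 := hF.1 5 (by simp)
    have e6 : τ.nat 6 = σ₁.nat 6 := hF.1 6 (by simp)
    have e12 : τ.nat 12 = σ.nat 12 := hF.1 12 (by simp)
    have e13 : τ.nat 13 = σ.nat 13 := hF.1 13 (by simp)
    have hE2 : Cmd.effect I (Cmd.block [Prog.set 4 (Prog.var 10),
        .setN 1 (Prog.var 0) (Prog.var 10) (Prog.var 12),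
        Prog.set 5 (.sub (Prog.var 5) (Prog.var 13)), Prog.set 11 (Prog.var 12)]) τ =
        (((τ.setNat 4 0 0 p).setNat 1 st.augs.length p x).setNat 5 0 0
          (st.d - I.N.len st.cur x)).setNat 11 0 0 x := by
      simp only [Cmd.block, Cmd.effect, Prog.set, Prog.var, NExp.eval, Mem.setNat_nat, e0, e5, e12,
        e13, h10, hr.out.1, h12, h13, hr.d]
      simp
    rw [hE2]
    have hpath : (st.push I x).path = st.path.takeWhile (· ≠ x) ++ [x] := rfl
    refine ⟨⟨?_, ?_, ?_, ?_, ?_, ?_, ?_, ?_⟩, ?_, ?_, ?_, ?_, ?_⟩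
    · refine hr.out.congr ?_ ?_ ?_
      · simp [Mem.setNat_nat_of_ne, e0]
      · intro j hj
        funext i
        simp [Mem.setNat_nat_of_ne, Mem.setNat_nat_self, e1, hj.ne]
      · simp [hF.2, hσ₁]
    · intro u v
      simp [Mem.setNat_nat_of_ne, hF.1, hσ₁]
      exact hr.flow u v
    · intro v d
      simp [Mem.setNat_nat_of_ne, hF.1, hσ₁]
      exact hr.lab v d
    · intro v d
      simp [Mem.setNat_nat_of_ne, hF.1, hσ₁]
      exact hr.ptr v d
    · refine hr.touched.congr ?_ ?_ <;> simp [Mem.setNat_nat_of_ne, hF.1, hσ₁]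
    · refine HoldsCut.congr hr.snap ?_ ?_ <;> simp [Mem.setNat_nat_of_ne, hF.1, hF.2, hσ₁]
    · simp [hF.2, hσ₁]; exact hr.num
    · simp [hF.2, hσ₁]; exact hr.den
    · rw [hpath]
      refine RowRep.append (σ := σ) (hr.row.of_prefix (List.takeWhile_prefix _)) ?_ ?_
      · intro i hi
        have : i ≠ p := hi.ne
        simp [Mem.setNat_nat_of_ne, Mem.setNat_nat_self, this, e1, State.push]
      · simp [Mem.setNat_nat_of_ne, Mem.setNat_nat_self, State.push, hpdef]
    · refine CapRep.of_prefix ?_ (pathEdges_prefix (takeWhile_append_prefix st.path x))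
      intro i e hi
      simpa [Mem.setNat_nat_of_ne, e6] using hcap i e hi
    · simp [Mem.setNat_nat, State.push, hpdef]
    · simp [Mem.setNat_nat, State.push]
    · simp [Mem.setNat_nat, State.push]

end

section

variable {n : ℕ} {I : Input n} {st : State n} {σ τ : Mem}

theorem restart_effect (σ : Mem) : Cmd.effect I Prog.restart σ =
    (((σ.setNat 1 (σ.nat 0 0 0) 0 I.N.s).setNat 4 0 0 0).setNat 5 0 0 I.h).setNat 11 0 0 I.N.s := by
  simp [Prog.restart, Cmd.block, Cmd.effect, Prog.set, Prog.var, NExp.eval]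

theorem BaseRep.restart (hr : BaseRep I σ st) :
    Rep I (Cmd.effect I Prog.restart σ) (st.restart I) := by
  rw [restart_effect, hr.out.1]
  refine ⟨⟨?_, ?_, ?_, ?_, ?_, ?_, ?_, ?_⟩, ?_, ?_, ?_, ?_, ?_⟩
  · refine hr.out.congr ?_ ?_ ?_
    · simp [Mem.setNat_nat_of_ne]
    · intro j hj
      have : j ≠ st.augs.length := hj.ne
      funext i
      simp [Mem.setNat_nat_of_ne, Mem.setNat_nat_self, this]
    · rfl
  · intro u v
    exact Eq.trans (by simp [Mem.setNat_nat_of_ne]) (hr.flow u v)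
  · intro v d
    exact Eq.trans (by simp [Mem.setNat_nat_of_ne]) (hr.lab v d)
  · intro v d
    exact Eq.trans (by simp [Mem.setNat_nat_of_ne]) (hr.ptr v d)
  · refine hr.touched.congr ?_ ?_ <;> simp [Mem.setNat_nat_of_ne]
  · refine HoldsCut.congr hr.snap ?_ ?_ <;> simp [Mem.setNat_nat_of_ne]
  · exact hr.num
  · exact hr.den
  · intro i v hi
    rcases i with _ | i
    · have : I.N.s = v := by simpa [State.path, State.restart] using hi
      simp [Mem.setNat_nat, State.restart, this]
    · simp [State.path, State.restart] at hi
  · intro i e hi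
    simp [State.path, State.restart, pathEdges] at hi
  · simp [Mem.setNat_nat, State.restart]
  · simp [Mem.setNat_nat, State.restart]
  · simp [Mem.setNat_nat, State.restart]

theorem RowRep.outPath {P : List (Fin n)} {row : ℕ} (h : RowRep P row σ)
    (hl : σ.nat 0 1 row = P.length) : σ.outPath row = P.map Fin.val := by
  refine List.ext_getElem (by simp [Mem.outPath, hl]) fun i h1 h2 => ?_
  have h3 : i < P.length := by simpa using h2
  simp only [Mem.outPath, List.getElem_map, List.getElem_range]
  exact h i P[i] (List.getElem?_eq_getElem h3)

theorem getElem?_pathEdges {P : List (Fin n)} {i : ℕ} {e : Fin n × Fin n}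
    (h : (pathEdges P)[i]? = some e) : P[i]? = some e.1 ∧ P[i + 1]? = some e.2 := by
  have := List.getElem?_zip_eq_some.1 h
  rwa [List.getElem?_tail] at this

theorem min_run {L : List (Fin n × Fin n)} {k b : ℕ} (hL : L.length = k + 1)
    (hcap : CapRep I L σ) (h4 : σ.nat 4 0 0 = k) (h10 : σ.nat 10 0 0 = 0)
    (h15 : σ.nat 15 0 0 = σ.nat 6 0 0) (hb : ∀ e ∈ L, b ≤ I.N.U e.1 e.2)
    (hb' : ∃ e ∈ L, b = I.N.U e.1 e.2) :
    Run I Prog.minLoop σ ((k + 1) * 400 + 200)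
      fun τ => Frame [10, 15] [] σ τ ∧ τ.nat 15 0 0 = b := by
  refine Run.mono (Run.loop (k + 1) (fun j τ => Frame [10, 15] [] σ τ ∧ τ.nat 10 0 0 = j ∧
    (∀ (i : ℕ) e, i < j → L[i]? = some e → τ.nat 15 0 0 ≤ I.N.U e.1 e.2) ∧
    ∃ e ∈ L, τ.nat 15 0 0 = I.N.U e.1 e.2) (B := 200) (T := 200) (by decide) ?_ ?_ ?_) le_rfl ?_
  · refine ⟨Frame.refl _ _ _, h10, fun i e hi => absurd hi (Nat.not_lt_zero _), ?_⟩
    have h0 : 0 < L.length := by omega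
    refine ⟨L[0], List.getElem_mem h0, ?_⟩
    rw [h15]
    exact hcap 0 _ (List.getElem?_eq_getElem h0)
  · rintro j hj τ ⟨hF, hj10, hle, hex⟩
    have h6 : τ.nat 6 = σ.nat 6 := hF.1 6 (by simp)
    have hjL : j < L.length := by omega
    have hcj := hcap j _ (List.getElem?_eq_getElem hjL)
    constructor
    · rw [Prog.leN_holds, Prog.var_eval, Prog.var_eval, hj10, hF.1 4 (by simp), h4]
      omega
    · refine Run.straight rfl (by decide) ?_
      by_cases hlt : I.N.U L[j].1 L[j].2 < τ.nat 15 0 0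
      · have hE : Cmd.effect I (.seq (.ite (.ltN (.get 6 (.const 0) (Prog.var 10)) (Prog.var 15))
            (Prog.set 15 (.get 6 (.const 0) (Prog.var 10))) .skip) (Prog.inc 10)) τ =
            (τ.setNat 15 0 0 (I.N.U L[j].1 L[j].2)).setNat 10 0 0 (j + 1) := by
          simp [Cmd.effect, BExp.Holds, NExp.eval, Prog.var, Prog.set, Prog.inc, hj10, h6, hcj, hlt,
            Mem.setNat_nat]
        rw [hE]
        refine ⟨(hF.setNat (by simp) _ _ _).setNat (by simp) _ _ _, by simp [Mem.setNat_nat], ?_,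
          L[j], List.getElem_mem hjL, by simp [Mem.setNat_nat]⟩
        intro i e hi he
        simp only [Mem.setNat_nat]
        rcases Nat.lt_succ_iff_lt_or_eq.1 hi with h | rfl
        · simpa using hlt.le.trans (hle i e h he)
        · rw [List.getElem?_eq_getElem hjL] at he
          obtain rfl := Option.some.inj he
          simp
      · have hE : Cmd.effect I (.seq (.ite (.ltN (.get 6 (.const 0) (Prog.var 10)) (Prog.var 15))
            (Prog.set 15 (.get 6 (.const 0) (Prog.var 10))) .skip) (Prog.inc 10)) τ =
            τ.setNat 10 0 0 (j + 1) := by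
          simp [Cmd.effect, BExp.Holds, NExp.eval, Prog.var, Prog.set, Prog.inc, hj10, h6, hcj, hlt]
        rw [hE]
        refine ⟨hF.setNat (by simp) _ _ _, by simp [Mem.setNat_nat], ?_,
          by simpa [Mem.setNat_nat] using hex⟩
        intro i e hi he
        simp only [Mem.setNat_nat]
        rcases Nat.lt_succ_iff_lt_or_eq.1 hi with h | rfl
        · simpa using hle i e h he
        · rw [List.getElem?_eq_getElem hjL] at he
          obtain rfl := Option.some.inj he
          simpa using hlt
  · rintro τ ⟨hF, hj10, -⟩
    rw [Prog.leN_holds, Prog.var_eval, Prog.var_eval, hj10, hF.1 4 (by simp), h4]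
    omega
  · rintro τ ⟨hF, -, hle, e, he, heq⟩
    refine ⟨hF, le_antisymm ?_ (heq ▸ hb e he)⟩
    obtain ⟨e', he', rfl⟩ := hb'
    obtain ⟨i, hi⟩ := List.mem_iff_getElem?.1 he'
    refine hle i e' ?_ hi
    have := (List.getElem?_eq_some_iff.1 hi).1
    omega

theorem send_run {P : List (Fin n)} {g : Fin n × Fin n → ℕ} {touched : List (Fin n × Fin n)}
    {k b row : ℕ} (hP : P.Nodup) (hL : (pathEdges P).length = k + 1)
    (hcap : CapRep I (pathEdges P) σ) (hrow : RowRep P row σ) (h0 : σ.nat 0 0 0 = row)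
    (h4 : σ.nat 4 0 0 = k) (h10 : σ.nat 10 0 0 = 0) (h15 : σ.nat 15 0 0 = b)
    (hflow : FlowRep g σ) (ht : TouchedRep I touched σ) :
    Run I Prog.sendLoop σ ((k + 1) * 400 + 200) fun τ => Frame [2, 7, 10, 12, 13, 14] [] σ τ ∧
      FlowRep (fun e => g e + if e ∈ pathEdges P then b else 0) τ ∧
      TouchedRep I (touched ++ (pathEdges P).filter fun e => g e = 0) τ := by
  set L := pathEdges P with hLdef
  have hLnd : L.Nodup := pathEdges_nodup hP
  refine Run.mono (Run.loop (k + 1) (fun j τ => Frame [2, 7, 10, 12, 13, 14] [] σ τ ∧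
    τ.nat 10 0 0 = j ∧ FlowRep (fun e => g e + if e ∈ L.take j then b else 0) τ ∧
    TouchedRep I (touched ++ (L.take j).filter fun e => g e = 0) τ)
    (B := 200) (T := 200) (by decide) ?_ ?_ ?_) le_rfl ?_
  · exact ⟨Frame.refl _ _ _, h10, by simpa using hflow, by simpa using ht⟩
  · rintro j hj τ ⟨hF, hj10, hfl, hto⟩
    have hjL : j < L.length := by omega
    obtain ⟨e, he⟩ : ∃ e, L[j]? = some e := ⟨_, List.getElem?_eq_getElem hjL⟩
    have hcj : τ.nat 6 0 j = I.N.U e.1 e.2 := by rw [hF.1 6 (by simp)]; exact hcap j _ he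
    obtain ⟨hu, hv⟩ := getElem?_pathEdges he
    have hru : τ.nat 1 row j = e.1 := by rw [hF.1 1 (by simp)]; exact hrow _ _ hu
    have hrv : τ.nat 1 row (j + 1) = e.2 := by rw [hF.1 1 (by simp)]; exact hrow _ _ hv
    have e0 : τ.nat 0 0 0 = row := by rw [hF.1 0 (by simp)]; exact h0
    have e15 : τ.nat 15 0 0 = b := by rw [hF.1 15 (by simp)]; exact h15
    have htake : L.take (j + 1) = L.take j ++ [e] := by rw [List.take_add_one, he]; rfl
    -- The edges of a simple path are distinct, so the test for a new touched edge still sees the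
    -- flow from before this augmentation.
    have hnot : e ∉ L.take j := by
      have h1 := hLnd.sublist (List.take_sublist (j + 1) L)
      rw [htake, List.nodup_append] at h1
      exact fun h => h1.2.2 e h e (List.mem_singleton_self e) rfl
    have hg : τ.nat 7 e.1 e.2 = g e := by
      have := hfl e.1 e.2
      simpa [hnot] using this
    have hflow' : ∀ ρ : Mem, (ρ.nat 7 = fun i' j' => if i' = (e.1 : ℕ) ∧ j' = (e.2 : ℕ) then g e + b
        else τ.nat 7 i' j') → FlowRep (fun e' => g e' + if e' ∈ L.take (j + 1) then b else 0) ρ := by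
      intro ρ hρ u v
      rw [hρ, htake]
      by_cases huv : u = e.1 ∧ v = e.2
      · obtain ⟨rfl, rfl⟩ := huv
        simp
      · have h1 : ¬ ((u : ℕ) = e.1 ∧ (v : ℕ) = e.2) := fun h => huv ⟨Fin.ext h.1, Fin.ext h.2⟩
        have h2 : (u, v) ≠ e := fun h => huv ⟨congrArg Prod.fst h, congrArg Prod.snd h⟩
        simp only [h1, if_false, List.mem_append, List.mem_singleton, h2, or_false]
        exact hfl u v
    constructor
    · rw [Prog.leN_holds, Prog.var_eval, Prog.var_eval, hj10, hF.1 4 (by simp), h4]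
      omega
    · refine Run.straight rfl (by decide) ?_
      by_cases hz : g e = 0
      · have hE : Cmd.effect I (Cmd.block [Prog.set 12 (.get 1 (Prog.var 0) (Prog.var 10)),
            Prog.set 13 (.get 1 (Prog.var 0) (.add (Prog.var 10) (.const 1))),
            .ite (.ltN (.get 7 (Prog.var 12) (Prog.var 13)) (.const 1))
              (Cmd.block [.setN 2 (.const 1) (Prog.var 2) (Prog.var 12),
                .setN 2 (.const 2) (Prog.var 2) (Prog.var 13),
                .setN 14 (.const 0) (Prog.var 2) (.get 6 (.const 0) (Prog.var 10)),
                Prog.inc 2]) .skip,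
            .setN 7 (Prog.var 12) (Prog.var 13) (.add (.get 7 (Prog.var 12) (Prog.var 13))
              (Prog.var 15)), Prog.inc 10]) τ =
            ((((((((τ.setNat 12 0 0 e.1).setNat 13 0 0 e.2).setNat 2 1 (τ.nat 2 0 0) e.1).setNat
              2 2 (τ.nat 2 0 0) e.2).setNat 14 0 (τ.nat 2 0 0) (I.N.U e.1 e.2)).setNat
              2 0 0 (τ.nat 2 0 0 + 1)).setNat 7 e.1 e.2 (g e + b)).setNat 10 0 0 (j + 1)) := by
          simp [Cmd.block, Cmd.effect, BExp.Holds, NExp.eval, Prog.var, Prog.set, Prog.inc, hj10,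
            e0, hru, hrv, e15, hcj, hg, hz, Mem.setNat_nat]
        rw [hE]
        refine ⟨?_, by simp [Mem.setNat_nat], hflow' _ ?_, ?_⟩
        · iterate 8 refine Frame.setNat ?_ (by simp) _ _ _
          exact hF
        · simp [Mem.setNat_nat_of_ne, Mem.setNat_nat_self]
        · rw [htake, List.filter_append, ← List.append_assoc]
          have hfe : ([e].filter fun e => g e = 0) = [e] := by simp [hz]
          rw [hfe]
          obtain ⟨hc, hx⟩ := hto
          refine ⟨?_, ?_⟩
          · simp [Mem.setNat_nat, hc, add_assoc]
          · intro i e' hi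
            set T := touched ++ (L.take j).filter fun e => g e = 0
            rcases lt_trichotomy i T.length with hlt | rfl | hlt
            · rw [List.getElem?_append_left hlt] at hi
              have := hx i e' hi
              simpa [Mem.setNat_nat, hc, hlt.ne] using this
            · rw [List.getElem?_concat_length] at hi
              obtain rfl := Option.some.inj hi
              simp [Mem.setNat_nat, hc]
            · rw [List.getElem?_eq_none (by simp; omega)] at hi
              simp at hi
      · have hE : Cmd.effect I (Cmd.block [Prog.set 12 (.get 1 (Prog.var 0) (Prog.var 10)),
            Prog.set 13 (.get 1 (Prog.var 0) (.add (Prog.var 10) (.const 1))),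
            .ite (.ltN (.get 7 (Prog.var 12) (Prog.var 13)) (.const 1))
              (Cmd.block [.setN 2 (.const 1) (Prog.var 2) (Prog.var 12),
                .setN 2 (.const 2) (Prog.var 2) (Prog.var 13),
                .setN 14 (.const 0) (Prog.var 2) (.get 6 (.const 0) (Prog.var 10)),
                Prog.inc 2]) .skip,
            .setN 7 (Prog.var 12) (Prog.var 13) (.add (.get 7 (Prog.var 12) (Prog.var 13))
              (Prog.var 15)), Prog.inc 10]) τ =
            ((((τ.setNat 12 0 0 e.1).setNat 13 0 0 e.2).setNat 7 e.1 e.2 (g e + b)).setNat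
              10 0 0 (j + 1)) := by
          simp [Cmd.block, Cmd.effect, BExp.Holds, NExp.eval, Prog.var, Prog.set, Prog.inc, hj10,
            e0, hru, hrv, e15, hg, hz, Mem.setNat_nat]
        rw [hE]
        refine ⟨?_, by simp [Mem.setNat_nat], hflow' _ ?_, ?_⟩
        · iterate 4 refine Frame.setNat ?_ (by simp) _ _ _
          exact hF
        · simp [Mem.setNat_nat_of_ne, Mem.setNat_nat_self]
        · rw [htake, List.filter_append, ← List.append_assoc]
          have hfe : ([e].filter fun e => g e = 0) = [] := by simp [hz]
          rw [hfe, List.append_nil]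
          refine hto.congr ?_ ?_ <;> simp [Mem.setNat_nat_of_ne]
  · rintro τ ⟨hF, hj10, -⟩
    rw [Prog.leN_holds, Prog.var_eval, Prog.var_eval, hj10, hF.1 4 (by simp), h4]
    omega
  · rintro τ ⟨hF, -, h1, h2⟩
    rw [← hL, List.take_length] at h1 h2
    exact ⟨hF, h1, h2⟩

end

section

variable {n : ℕ} {I : Input n} {st : State n} {σ τ : Mem}

/-! #### Augmentation -/

theorem exists_bottleneck (N : Network n) {L : List (Fin n × Fin n)} (hL : L ≠ []) :
    ∃ b, (∀ e ∈ L, b ≤ N.U e.1 e.2) ∧ ∃ e ∈ L, b = N.U e.1 e.2 := by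
  obtain ⟨e, he, hmin⟩ := Finset.exists_min_image L.toFinset (fun e => N.U e.1 e.2)
    (by simpa using hL)
  exact ⟨N.U e.1 e.2, fun e' he' => hmin e' (List.mem_toFinset.2 he'), e, List.mem_toFinset.1 he,
    rfl⟩

theorem OutRep.append {augs : List (List (Fin n) × ℕ)} {P : List (Fin n)} {b : ℕ}
    (h : OutRep I augs σ) (hrow : RowRep P augs.length σ) :
    OutRep I (augs ++ [(P, b)]) (((σ.setReal 0 0 augs.length (I.eta * b)).setNat 0 1 augs.length
      P.length).setNat 0 0 0 (augs.length + 1)) := by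
  refine ⟨by simp [Mem.setNat_nat], fun j a hj => ?_⟩
  rcases lt_trichotomy j augs.length with hlt | rfl | hlt
  · rw [List.getElem?_append_left hlt] at hj
    obtain ⟨h1, h2⟩ := h.2 j a hj
    refine ⟨?_, ?_⟩
    · rw [← h1]
      simp [Mem.outPath, Mem.setNat_nat, hlt.ne, Mem.setNat_nat_of_ne]
    · rw [← h2]
      simp [Mem.setReal_real, hlt.ne]
  · rw [List.getElem?_concat_length] at hj
    obtain rfl := Option.some.inj hj
    refine ⟨RowRep.outPath ?_ ?_, ?_⟩
    · intro i v hi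
      have := hrow i v hi
      simpa [Mem.setNat_nat] using this
    · simp [Mem.setNat_nat]
    · simp [Mem.setReal_real]
  · rw [List.getElem?_eq_none (by simp; omega)] at hj
    simp at hj

theorem augment_run (H : I.Good) (hp : PathInv I st) (hr : Rep I σ st)
    (hc : 0 < I.N.sinkCap st.cur) :
    ∃ b, (∀ e ∈ pathEdges (st.path ++ [I.N.t]), b ≤ I.N.U e.1 e.2) ∧
      (∃ e ∈ pathEdges (st.path ++ [I.N.t]), b = I.N.U e.1 e.2) ∧
      Run I Prog.augment σ (3000 * (I.h + 1)) (Rep I · (st.augment I b)) := by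
  have hP := hp.isHPath H hc
  have hPE : pathEdges (st.path ++ [I.N.t]) = pathEdges st.path ++ [(st.cur, I.N.t)] :=
    pathEdges_path_append st I.N.t
  obtain ⟨b, hb, hb'⟩ := exists_bottleneck I.N
    (L := pathEdges (st.path ++ [I.N.t])) (by rw [hPE]; simp)
  refine ⟨b, hb, hb', ?_⟩
  set P := st.path ++ [I.N.t] with hPdef
  set k := st.pre.length with hk
  have hlen : (pathEdges P).length = k + 1 := by rw [hPE]; simp [st.length_pathEdges, hk]
  have hPlen : P.length = k + 2 := by simp [hPdef, st.length_path, hk]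
  have hkh : k ≤ I.h := by
    rw [hk, ← st.length_pathEdges]
    exact (Network.pathEdges_length_le_pathLen hp.edges).trans
      ((Nat.le_add_right _ _).trans hp.len_le)
  set cnt := st.augs.length with hcnt
  have hcnt0 : σ.nat 0 0 0 = cnt := hr.out.1
  -- the preparation
  obtain ⟨c0, hE⟩ : ∃ c0, Cmd.effect I (Cmd.block [.setN 6 (.const 0) (Prog.var 4)
      (.sinkCap (Prog.var 11)), .setN 1 (Prog.var 0) (.add (Prog.var 4) (.const 1)) .inT,
      Prog.set 15 (.get 6 (.const 0) (.const 0)), Prog.set 10 (.const 0)]) σ =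
      (((σ.setNat 6 0 k (I.N.U st.cur I.N.t)).setNat 1 cnt (k + 1) I.N.t).setNat 15 0 0 c0).setNat
        10 0 0 0 ∧ c0 = (σ.setNat 6 0 k (I.N.U st.cur I.N.t)).nat 6 0 0 := by
    refine ⟨_, ?_, rfl⟩
    simp only [Cmd.block, Cmd.effect, Prog.set, Prog.var, NExp.eval, hr.k, hr.cur,
      I.N.sinkQuery_val, Mem.setNat_nat]
    simp [hcnt0, hk, Network.sinkCap]
  obtain ⟨hE, hc0⟩ := hE
  set σ₁ := (((σ.setNat 6 0 k (I.N.U st.cur I.N.t)).setNat 1 cnt (k + 1) I.N.t).setNat 15 0 0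
    c0).setNat 10 0 0 0 with hσ₁
  have hcap₁ : CapRep I (pathEdges P) σ₁ := by
    rw [hPE]
    refine hr.cap.append (fun i hi => ?_) ?_
    · rw [st.length_pathEdges] at hi
      have : i ≠ k := hi.ne
      simp [hσ₁, Mem.setNat_nat, this]
    · rw [st.length_pathEdges]
      simp [hσ₁, Mem.setNat_nat, hk]
  have hrow₁ : RowRep P cnt σ₁ := by
    refine hr.row.append (fun i hi => ?_) ?_
    · rw [st.length_path] at hi
      have : i ≠ k + 1 := hi.ne
      simp [hσ₁, Mem.setNat_nat, this]
    · rw [st.length_path]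
      simp [hσ₁, Mem.setNat_nat, hk, hcnt]
  have h15₁ : σ₁.nat 15 0 0 = σ₁.nat 6 0 0 := by
    simp [hσ₁, hc0, Mem.setNat_nat]
  have h4₁ : σ₁.nat 4 0 0 = k := hr.k
  have F₁ : Frame [6, 1, 15, 10] [] σ σ₁ := by
    iterate 4 refine Frame.setNat ?_ (by simp) _ _ _
    exact Frame.refl _ _ _
  refine (Run.seq (S := 200) (Run.straight rfl (by decide) ?_)).mono
    (T := 200 + (((k + 1) * 400 + 200) + (200 + (((k + 1) * 400 + 200) + 200)))) ?_ fun _ h => h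
  swap
  · have : (k + 1) * 400 ≤ (I.h + 1) * 400 := Nat.mul_le_mul_right _ (by omega)
    omega
  rw [hE]
  refine Run.seq ((min_run hlen hcap₁ h4₁ (by simp [hσ₁, Mem.setNat_nat]) h15₁ hb hb').mono le_rfl ?_)
  rintro τ₁ ⟨F₂, h15⟩
  refine Run.seq (Run.straight rfl (by decide) ?_)
  have hE2 : Cmd.effect I (Prog.set 10 (.const 0)) τ₁ = τ₁.setNat 10 0 0 0 := rfl
  rw [hE2]
  set σ₂ := τ₁.setNat 10 0 0 0 with hσ₂
  have F₃ : Frame [10, 15] [] σ₁ σ₂ := F₂.setNat (by simp) _ _ _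
  have hcap₂ : CapRep I (pathEdges P) σ₂ := by
    unfold CapRep; rw [F₃.1 6 (by simp)]; exact hcap₁
  have hrow₂ : RowRep P cnt σ₂ := by
    unfold RowRep; rw [F₃.1 1 (by simp)]; exact hrow₁
  have hflow₂ : FlowRep st.g σ₂ := by
    unfold FlowRep; rw [F₃.1 7 (by simp), F₁.1 7 (by simp)]; exact hr.flow
  have ht₂ : TouchedRep I st.touched σ₂ := by
    refine hr.touched.congr ?_ ?_
    · rw [F₃.1 2 (by simp), F₁.1 2 (by simp)]
    · rw [F₃.1 14 (by simp), F₁.1 14 (by simp)]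
  refine Run.seq ((send_run hP.2.2.1 hlen hcap₂ hrow₂ ?_ ?_ ?_ ?_ hflow₂ ht₂ (b := b)).mono
    le_rfl ?_)
  · rw [F₃.1 0 (by simp), F₁.1 0 (by simp)]; exact hcnt0
  · rw [F₃.1 4 (by simp)]; exact h4₁
  · simp [hσ₂, Mem.setNat_nat]
  · rw [← h15]; simp [hσ₂, Mem.setNat_nat]
  rintro τ₂ ⟨F₄, hflow, htouched⟩
  refine Run.straight rfl (by decide) ?_
  -- the completion
  have G0 : τ₂.nat 0 = σ.nat 0 := by rw [F₄.1 0 (by simp), F₃.1 0 (by simp), F₁.1 0 (by simp)]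
  have G1 : τ₂.nat 1 = σ₁.nat 1 := by rw [F₄.1 1 (by simp), F₃.1 1 (by simp)]
  have G4 : τ₂.nat 4 0 0 = k := by rw [F₄.1 4 (by simp), F₃.1 4 (by simp)]; exact h4₁
  have G15 : τ₂.nat 15 0 0 = b := by
    rw [F₄.1 15 (by simp), ← h15]; simp [hσ₂, Mem.setNat_nat]
  have G3 : τ₂.nat 3 = σ.nat 3 := by rw [F₄.1 3 (by simp), F₃.1 3 (by simp), F₁.1 3 (by simp)]
  have G8 : τ₂.nat 8 = σ.nat 8 := by rw [F₄.1 8 (by simp), F₃.1 8 (by simp), F₁.1 8 (by simp)]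
  have G9 : τ₂.nat 9 = σ.nat 9 := by rw [F₄.1 9 (by simp), F₃.1 9 (by simp), F₁.1 9 (by simp)]
  have GR : ∀ a, τ₂.real a = σ.real a := fun a => by
    rw [F₄.2 a (by simp), F₃.2 a (by simp), F₁.2 a (by simp)]
  have hcnt2 : τ₂.nat 0 0 0 = cnt := by rw [G0]; exact hcnt0
  set ρ := ((τ₂.setReal 0 0 cnt (I.eta * b)).setNat 0 1 cnt P.length).setNat 0 0 0 (cnt + 1)
    with hρ
  have hE3 : Cmd.effect I (Cmd.block [.setR 0 (.const 0) (Prog.var 0)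
      (.mul Prog.etaE (.ofNat (Prog.var 15))), .setN 0 (.const 1) (Prog.var 0)
      (.add (Prog.var 4) (.const 2)), Prog.inc 0, Prog.restart]) τ₂ =
      Cmd.effect I Prog.restart ρ := by
    simp [Cmd.block, Cmd.effect, NExp.eval, RExp.eval, Prog.var, Prog.set, Prog.inc, hcnt2,
      Prog.etaE_eval, G15, G4, hPlen, Mem.setNat_nat, hρ]
  rw [hE3]
  refine BaseRep.restart (st := { st with
    augs := st.augs ++ [(st.path ++ [I.N.t], b)]
    touched := st.touched ++ (pathEdges (st.path ++ [I.N.t])).filter fun e => st.g e = 0 })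
    ⟨?_, ?_, ?_, ?_, ?_, ?_, ?_, ?_⟩
  · refine OutRep.append (hr.out.congr G0 (fun j hj => ?_) (GR 0)) ?_
    · have : j ≠ cnt := hj.ne
      rw [G1]
      funext i
      simp [hσ₁, Mem.setNat_nat, this]
    · change RowRep P cnt τ₂
      unfold RowRep
      rw [G1]; exact hrow₁
  · intro u v
    refine Eq.trans ?_ ((hflow u v).trans (st.g_augment I b (u, v)).symm)
    simp [hρ, Mem.setNat_nat_of_ne]
  · intro v d
    exact Eq.trans (by simp [hρ, Mem.setNat_nat_of_ne, G8]) (hr.lab v d)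
  · intro v d
    exact Eq.trans (by simp [hρ, Mem.setNat_nat_of_ne, G9]) (hr.ptr v d)
  · refine htouched.congr ?_ ?_ <;> simp [hρ, Mem.setNat_nat_of_ne]
  · refine HoldsCut.congr hr.snap ?_ ?_
    · simp [hρ, Mem.setNat_nat_of_ne, G3]
    · simp [hρ, Mem.setReal_real_of_ne, GR]
  · exact Eq.trans (by simp [hρ, Mem.setReal_real_of_ne, GR]) hr.num
  · exact Eq.trans (by simp [hρ, Mem.setReal_real_of_ne, GR]) hr.den

end

section

variable {n : ℕ} {I : Input n} {st : State n} {σ τ : Mem}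

/-! #### Relabelling and recording the cut -/

theorem FlowInv.touched_edges (H : I.Good) (hf : FlowInv I st) {e : Fin n × Fin n}
    (he : e ∈ st.touched) : e ∈ I.N.edges := by
  have h1 := hf.flow_le H e
  have h2 : (0 : ℝ) < I.eta * st.g e := by
    have := H.eta_pos
    have : (0 : ℝ) < st.g e := by exact_mod_cast (hf.mem_touched e).1 he
    positivity
  exact Network.mem_edges.2 (Network.U_pos_iff.1 (by exact_mod_cast h2.trans_le h1))

/-- Edges without flow have excess `0`. Working with excess weights is what makes the volume
computable from the touched edges alone. -/
theorem FlowInv.vol_eq (H : I.Good) (hf : FlowInv I st) :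
    I.vol st.g = (st.touched.map fun e => (I.N.U e.1 e.2 : ℝ) * I.wt st.g e).sum := by
  rw [← List.sum_toFinset _ hf.touched_nodup]
  symm
  refine Finset.sum_subset (fun e he => hf.touched_edges H (List.mem_toFinset.1 he)) ?_
  intro e _ he
  rw [List.mem_toFinset, hf.mem_touched] at he
  rw [Input.wt_of_eq_zero (by omega), mul_zero]

theorem touchedWt_eval {L : List (Fin n × Fin n)} {g : Fin n × Fin n → ℕ}
    (ht : TouchedRep I L σ) (hg : FlowRep g σ) {x : NExp} {e : Fin n × Fin n}
    (hx : L[x.eval I σ]? = some e) : (Prog.touchedWt x).eval I σ = I.wt g e := by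
  obtain ⟨h1, h2, h3⟩ := ht.2 _ e hx
  exact Prog.wtE_eval σ hg h1 h2 h3

theorem vol_run {L : List (Fin n × Fin n)} {g : Fin n × Fin n → ℕ}
    (ht : TouchedRep I L σ) (hg : FlowRep g σ) (h10 : σ.nat 10 0 0 = 0) (h6 : σ.real 6 0 0 = 0) :
    Run I Prog.volLoop σ (L.length * 400 + 200) fun τ => Frame [10] [6] σ τ ∧
      τ.real 6 0 0 = (L.map fun e => (I.N.U e.1 e.2 : ℝ) * I.wt g e).sum := by
  refine Run.mono (Run.loop L.length (fun j τ => Frame [10] [6] σ τ ∧ τ.nat 10 0 0 = j ∧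
    τ.real 6 0 0 = ((L.take j).map fun e => (I.N.U e.1 e.2 : ℝ) * I.wt g e).sum)
    (B := 200) (T := 200) (by decide) ⟨Frame.refl _ _ _, h10, by simpa using h6⟩ ?_ ?_) le_rfl ?_
  · rintro j hj τ ⟨hF, hj10, hsum⟩
    have ht' : TouchedRep I L τ := ht.congr (hF.1 2 (by simp)) (hF.1 14 (by simp))
    have hg' : FlowRep g τ := by unfold FlowRep; rw [hF.1 7 (by simp)]; exact hg
    obtain ⟨e, he⟩ : ∃ e, L[j]? = some e := ⟨_, List.getElem?_eq_getElem hj⟩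
    have htake : L.take (j + 1) = L.take j ++ [e] := by rw [List.take_add_one, he]; rfl
    constructor
    · simp only [BExp.Holds, Prog.var_eval, hj10, ht'.1]; exact hj
    · refine Run.straight rfl (by decide) ?_
      have hw := touchedWt_eval ht' hg' (x := Prog.var 10) (e := e)
        (by rw [Prog.var_eval, hj10]; exact he)
      have hc : τ.nat 14 0 j = I.N.U e.1 e.2 := (ht'.2 j e he).2.2
      have hE : Cmd.effect I (.seq (Prog.setr 6 (.add (Prog.rvar 6)
          (.mul (.ofNat (.get 14 (.const 0) (Prog.var 10))) (Prog.touchedWt (Prog.var 10)))))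
          (Prog.inc 10)) τ = (τ.setReal 6 0 0 (τ.real 6 0 0 + I.N.U e.1 e.2 * I.wt g e)).setNat
            10 0 0 (j + 1) := by
        simp [Cmd.effect, Prog.setr, Prog.rvar, RExp.eval, NExp.eval, hw, Prog.var_eval, hj10, hc,
          Prog.inc, Prog.set]
      rw [hE]
      refine ⟨(hF.setReal (by simp) _ _ _).setNat (by simp) _ _ _, by simp [Mem.setNat_nat], ?_⟩
      rw [htake, List.map_append, List.sum_append, ← hsum]
      simp [Mem.setReal_real]
  · rintro τ ⟨hF, hj10, -⟩
    simp only [BExp.Holds, Prog.var_eval, hj10]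
    rw [hF.1 2 (by simp), ht.1]
    exact lt_irrefl _
  · rintro τ ⟨hF, -, h1⟩
    rw [List.take_length] at h1
    exact ⟨hF, h1⟩

theorem copy_run {L : List (Fin n × Fin n)} {g : Fin n × Fin n → ℕ} {c : ℝ}
    (ht : TouchedRep I L σ) (hg : FlowRep g σ) (h10 : σ.nat 10 0 0 = 0)
    (hc : I.certified (σ.nat 8 I.N.s I.h) = c) :
    Run I Prog.copyLoop σ (L.length * 400 + 200) fun τ => Frame [3, 10] [3] σ τ ∧
      ∀ (i : ℕ) e, L[i]? = some e → τ.nat 3 1 i = e.1 ∧ τ.nat 3 2 i = e.2 ∧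
        τ.real 3 1 i = I.wt g e / c := by
  refine Run.mono (Run.loop L.length (fun j τ => Frame [3, 10] [3] σ τ ∧ τ.nat 10 0 0 = j ∧
    ∀ (i : ℕ) e, i < j → L[i]? = some e → τ.nat 3 1 i = e.1 ∧ τ.nat 3 2 i = e.2 ∧
      τ.real 3 1 i = I.wt g e / c)
    (B := 200) (T := 200) (by decide)
    ⟨Frame.refl _ _ _, h10, fun i e hi => absurd hi (Nat.not_lt_zero _)⟩ ?_ ?_) le_rfl ?_
  · rintro j hj τ ⟨hF, hj10, hall⟩
    have ht' : TouchedRep I L τ := ht.congr (hF.1 2 (by simp)) (hF.1 14 (by simp))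
    have hg' : FlowRep g τ := by unfold FlowRep; rw [hF.1 7 (by simp)]; exact hg
    obtain ⟨e, he⟩ : ∃ e, L[j]? = some e := ⟨_, List.getElem?_eq_getElem hj⟩
    constructor
    · simp only [BExp.Holds, Prog.var_eval, hj10, ht'.1]; exact hj
    · refine Run.straight rfl (by decide) ?_
      obtain ⟨h1, h2, -⟩ := ht'.2 j e he
      set τ' := (τ.setNat 3 1 j e.1).setNat 3 2 j e.2 with hτ'
      have hF' : Frame [3, 10] [3] σ τ' := (hF.setNat (by simp) _ _ _).setNat (by simp) _ _ _
      have ht'' : TouchedRep I L τ' := ht.congr (hF'.1 2 (by simp)) (hF'.1 14 (by simp))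
      have hg'' : FlowRep g τ' := by unfold FlowRep; rw [hF'.1 7 (by simp)]; exact hg
      have h10' : τ'.nat 10 0 0 = j := by simp [hτ', Mem.setNat_nat, hj10]
      have hw := touchedWt_eval ht'' hg'' (x := Prog.var 10) (e := e)
        (by rw [Prog.var_eval, h10']; exact he)
      have hcert : Prog.certE.eval I τ' = c := by
        rw [Prog.certE_eval, hF'.1 8 (by simp), hc]
      have hE : Cmd.effect I (Cmd.block [.setN 3 (.const 1) (Prog.var 10) (.get 2 (.const 1)
          (Prog.var 10)), .setN 3 (.const 2) (Prog.var 10) (.get 2 (.const 2) (Prog.var 10)),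
          .setR 3 (.const 1) (Prog.var 10) (.div (Prog.touchedWt (Prog.var 10)) Prog.certE),
          Prog.inc 10]) τ = (τ'.setReal 3 1 j (I.wt g e / c)).setNat 10 0 0 (j + 1) := by
        have h3 : Cmd.effect I (Cmd.block [.setN 3 (.const 1) (Prog.var 10) (.get 2 (.const 1)
          (Prog.var 10)), .setN 3 (.const 2) (Prog.var 10) (.get 2 (.const 2) (Prog.var 10))]) τ =
            τ' := by
          simp [Cmd.block, Cmd.effect, NExp.eval, Prog.var, hj10, h1, h2, Mem.setNat_nat, hτ']
        simp only [Cmd.block, Cmd.effect] at h3 ⊢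
        rw [h3]
        simp [RExp.eval, hw, hcert, Prog.inc, Prog.set, Cmd.effect, NExp.eval, Prog.var_eval, h10']
      rw [hE]
      refine ⟨(hF'.setReal (by simp) _ _ _).setNat (by simp) _ _ _, by simp [Mem.setNat_nat], ?_⟩
      intro i e' hi he'
      rcases Nat.lt_succ_iff_lt_or_eq.1 hi with h | rfl
      · have := hall i e' h he'
        simpa [hτ', Mem.setNat_nat, Mem.setReal_real, h.ne] using this
      · rw [he] at he'
        obtain rfl := Option.some.inj he'
        simp [hτ', Mem.setNat_nat, Mem.setReal_real]
  · rintro τ ⟨hF, hj10, -⟩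
    simp only [BExp.Holds, Prog.var_eval, hj10]
    rw [hF.1 2 (by simp), ht.1]
    exact lt_irrefl _
  · rintro τ ⟨hF, -, h1⟩
    exact ⟨hF, fun i e he => h1 i e (List.getElem?_eq_some_iff.1 he).1 he⟩

theorem BaseRep.frame (hr : BaseRep I σ st) (hF : Frame [10] [6] σ τ) : BaseRep I τ st := by
  refine ⟨?_, ?_, ?_, ?_, ?_, ?_, ?_, ?_⟩
  · exact hr.out.congr (hF.1 0 (by simp)) (fun j _ => by rw [hF.1 1 (by simp)]) (hF.2 0 (by simp))
  · unfold FlowRep; rw [hF.1 7 (by simp)]; exact hr.flow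
  · rw [hF.1 8 (by simp)]; exact hr.lab
  · rw [hF.1 9 (by simp)]; exact hr.ptr
  · exact hr.touched.congr (hF.1 2 (by simp)) (hF.1 14 (by simp))
  · exact HoldsCut.congr hr.snap (hF.1 3 (by simp)) (hF.2 3 (by simp))
  · rw [hF.2 4 (by simp)]; exact hr.num
  · rw [hF.2 5 (by simp)]; exact hr.den

-- What is needed of `FlowInv` is listed as hypotheses, because this is applied in the middle of a
-- relabelling, to a state with the new label but without the restart.
open Classical in
theorem record_run (hr : BaseRep I σ st)
    (hvol : I.vol st.g = (st.touched.map fun e => (I.N.U e.1 e.2 : ℝ) * I.wt st.g e).sum)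
    (hE : ∀ e ∈ st.touched, e ∈ I.N.edges) (hg : ∀ e, e ∉ st.touched → st.g e = 0) :
    Run I Prog.record σ (800 * st.touched.length + 1200) (BaseRep I ·
      (if I.vol st.g * st.den < st.num * I.certified (st.top I) then st.record I else st)) := by
  set l := st.touched.length with hl
  refine (Run.seq (S := 200) (Run.straight rfl (by decide) ?_)).mono
    (T := 200 + ((l * 400 + 200) + (200 + (200 + (l * 400 + 200 + 200))))) (by omega) fun _ h => h
  have hE0 : Cmd.effect I (Cmd.block [Prog.setr 6 (Prog.num 0), Prog.set 10 (.const 0)]) σ =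
      (σ.setReal 6 0 0 0).setNat 10 0 0 0 := by
    simp [Cmd.block, Cmd.effect, Prog.setr, Prog.set, Prog.num_eval, NExp.eval]
  rw [hE0]
  set σ₁ := (σ.setReal 6 0 0 0).setNat 10 0 0 0 with hσ₁
  have hr₁ : BaseRep I σ₁ st :=
    hr.frame (((Frame.refl _ _ _).setReal (by simp) _ _ _).setNat (by simp) _ _ _)
  refine Run.seq ((vol_run hr₁.touched hr₁.flow (by simp [hσ₁, Mem.setNat_nat])
    (by simp [hσ₁, Mem.setReal_real])).mono le_rfl ?_)
  rintro τ ⟨hF, h6⟩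
  rw [← hvol] at h6
  have hr₂ := hr₁.frame hF
  have hcert : I.certified (τ.nat 8 I.N.s I.h) = I.certified (st.top I) := by
    rw [hr₂.lab]; rfl
  have hcond : BExp.Holds I τ (.ltR (.mul (Prog.rvar 6) (Prog.rvar 5))
      (.mul (Prog.rvar 4) Prog.certE)) ↔ I.vol st.g * st.den < st.num * I.certified (st.top I) := by
    simp only [BExp.Holds, RExp.eval, Prog.rvar_eval, Prog.certE_eval, h6, hr₂.num, hr₂.den, hcert]
  refine Run.ite (B := 200) (by decide) (fun hb => ?_) (fun hb => ?_)
  swap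
  · rw [hcond] at hb
    rw [if_neg hb]
    exact Run.straight rfl (by simp [Cmd.time]; omega) hr₂
  rw [hcond] at hb
  rw [if_pos hb]
  refine Run.seq (Run.straight rfl (by decide) ?_)
  have hE1 : Cmd.effect I (Prog.set 10 (.const 0)) τ = τ.setNat 10 0 0 0 := rfl
  rw [hE1]
  set σ₂ := τ.setNat 10 0 0 0 with hσ₂
  have hr₃ : BaseRep I σ₂ st := hr₂.frame ((Frame.refl _ _ _).setNat (by simp) _ _ _)
  have h6' : σ₂.real 6 0 0 = I.vol st.g := h6
  have hcert₃ : I.certified (σ₂.nat 8 I.N.s I.h) = I.certified (st.top I) := by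
    rw [hr₃.lab]; rfl
  refine Run.seq ((copy_run hr₃.touched hr₃.flow (by simp [hσ₂, Mem.setNat_nat]) hcert₃).mono
    le_rfl ?_)
  rintro τ' ⟨hF', hcopy⟩
  refine Run.straight rfl (by decide) ?_
  have e2 : τ'.nat 2 = σ₂.nat 2 := hF'.1 2 (by simp)
  have e8 : τ'.nat 8 I.N.s I.h = st.top I := by
    rw [hF'.1 8 (by simp), hr₃.lab]; rfl
  have hE2 : Cmd.effect I (Cmd.block [Prog.set 3 (Prog.var 2), Prog.setr 3 (Prog.num 0),
      Prog.setr 4 (Prog.rvar 6), Prog.setr 5 Prog.certE]) τ' =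
      (((τ'.setNat 3 0 0 l).setReal 3 0 0 0).setReal 4 0 0 (I.vol st.g)).setReal 5 0 0
        (I.certified (st.top I)) := by
    simp [Cmd.block, Cmd.effect, Prog.setr, Prog.set, Prog.num_eval, NExp.eval, Prog.var_eval,
      Prog.rvar_eval, Prog.certE_eval, e2, hr₃.touched.1, Mem.setReal_real, Mem.setNat_nat,
      hF'.2, h6', e8, hl]
  rw [hE2]
  refine ⟨?_, ?_, ?_, ?_, ?_, ?_, ?_, ?_⟩
  · refine hr₃.out.congr ?_ (fun j _ => ?_) ?_
    · simp [Mem.setNat_nat_of_ne, hF'.1]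
    · simp [Mem.setNat_nat_of_ne, hF'.1]
    · simp [Mem.setReal_real_of_ne, hF'.2]
  · intro u v
    exact Eq.trans (by simp [Mem.setNat_nat_of_ne, hF'.1]) (hr₃.flow u v)
  · intro v d
    exact Eq.trans (by simp [Mem.setNat_nat_of_ne, hF'.1]) (hr₃.lab v d)
  · intro v d
    exact Eq.trans (by simp [Mem.setNat_nat_of_ne, hF'.1]) (hr₃.ptr v d)
  · refine hr₃.touched.congr ?_ ?_ <;> simp [Mem.setNat_nat_of_ne, hF'.1]
  · constructor
    · intro j hj
      have hj' : j < st.touched.length := by simpa [Mem.setNat_nat] using hj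
      obtain ⟨e, he⟩ : ∃ e, st.touched[j]? = some e := ⟨_, List.getElem?_eq_getElem hj'⟩
      obtain ⟨h1, h2, h3⟩ := hcopy j e he
      refine ⟨e, hE e (List.mem_of_getElem? he), ?_, ?_, ?_⟩
      · simp [Mem.setNat_nat, h1]
      · simp [Mem.setNat_nat, h2]
      · simp [Mem.setReal_real, h3, State.record]
    · intro e _ hall
      have hnot : e ∉ st.touched := by
        intro he
        obtain ⟨j, hj⟩ := List.mem_iff_getElem?.1 he
        obtain ⟨h1, h2, -⟩ := hcopy j e hj
        refine hall j ?_ ⟨?_, ?_⟩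
        · simpa [Mem.setNat_nat] using (List.getElem?_eq_some_iff.1 hj).1
        · simp [Mem.setNat_nat, h1]
        · simp [Mem.setNat_nat, h2]
      simp [Mem.setReal_real, State.record, Input.wt_of_eq_zero (hg e hnot)]
  · simp [Mem.setReal_real, State.record]
  · simp [Mem.setReal_real, State.record]

open Classical in
theorem relabel_run (H : I.Good) (hf : FlowInv I st) (hr : Rep I σ st) :
    (¬ (st.cur = I.N.s ∧ st.d = I.h) →
      Run I Prog.relabel σ 1000 (Rep I · (st.relabel I))) ∧
    (st.cur = I.N.s ∧ st.d = I.h →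
      Run I Prog.relabel σ (2000 * (st.touched.length + 1)) (Rep I ·
        (if I.vol st.g * st.den < st.num * I.certified ((st.relabel I).top I) then
          (st.relabel I).record I else st.relabel I))) := by
  set st₁ : State n := { st with
    lab := put st.lab st.cur st.d (st.lab st.cur st.d + 1)
    ptr := put st.ptr st.cur st.d 0 } with hst₁
  set σ₁ := (σ.setNat 9 st.cur st.d 0).setNat 8 st.cur st.d (st.lab st.cur st.d + 1) with hσ₁
  have hE : Cmd.effect I (Cmd.block [.setN 9 (Prog.var 11) (Prog.var 5) (.const 0),
      .setN 8 (Prog.var 11) (Prog.var 5) (.add Prog.labE (.const 1))]) σ = σ₁ := by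
    simp only [Cmd.block, Cmd.effect, Prog.var, Prog.labE, NExp.eval, hr.cur, hr.d, Mem.setNat_nat]
    simp [hr.lab, hσ₁]
  have hr₁ : BaseRep I σ₁ st₁ := by
    refine ⟨?_, ?_, ?_, ?_, ?_, ?_, hr.num, hr.den⟩
    · refine hr.out.congr ?_ (fun j _ => ?_) rfl <;> simp [hσ₁, Mem.setNat_nat_of_ne]
    · intro u v
      exact Eq.trans (by simp [hσ₁, Mem.setNat_nat_of_ne]) (hr.flow u v)
    · intro v d
      have h1 : σ₁.nat 8 v d = if (v : ℕ) = st.cur ∧ d = st.d then st.lab st.cur st.d + 1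
          else σ.nat 8 v d := by simp [hσ₁, Mem.setNat_nat]
      rw [h1, hr.lab]
      simp only [hst₁, put, Fin.ext_iff]
    · intro v d
      have h1 : σ₁.nat 9 v d = if (v : ℕ) = st.cur ∧ d = st.d then 0
          else σ.nat 9 v d := by simp [hσ₁, Mem.setNat_nat]
      rw [h1, hr.ptr]
      simp only [hst₁, put, Fin.ext_iff]
    · refine hr.touched.congr ?_ ?_ <;> simp [hσ₁, Mem.setNat_nat_of_ne]
    · refine HoldsCut.congr hr.snap ?_ ?_ <;> simp [hσ₁, Mem.setNat_nat_of_ne]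
  have e11 : σ₁.nat 11 0 0 = st.cur := hr.cur
  have e5 : σ₁.nat 5 0 0 = st.d := hr.d
  have hcond : BExp.Holds I σ₁ (.and (.not (Prog.ne (Prog.var 11) .inS))
      (.not (Prog.ne (Prog.var 5) .inH))) ↔ st.cur = I.N.s ∧ st.d = I.h := by
    simp only [BExp.Holds, Prog.ne_holds, Prog.var_eval, NExp.eval, e11, e5, not_not, Fin.ext_iff]
  constructor
  · intro hne
    refine (Run.seq (S := 200) (T := 800) (Run.straight rfl (by decide) ?_)).mono (by omega)
      fun _ h => h
    rw [hE]
    refine (Run.seq (S := 300) (T := 200) ((Run.ite (B := 200) (T := 100)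
      (Q := (BaseRep I · st₁)) (by decide) (fun hb => absurd (hcond.1 hb) hne)
      fun _ => Run.straight (p := .skip) rfl (by decide) hr₁).mono (by omega) fun τ hτ => ?_)).mono
      (by omega) fun _ h => h
    exact Run.straight rfl (by decide) hτ.restart
  · intro heq
    have hrec := record_run (st := st₁) hr₁ (show I.vol st.g = _ from hf.vol_eq H)
      (fun e he => hf.touched_edges H (show e ∈ st.touched from he)) fun e he => by
        have := (hf.mem_touched e).not.1 he
        change st.g e = 0
        omega
    set l := st.touched.length with hl
    refine (Run.seq (S := 200) (T := (200 + (800 * l + 1200)) + 200)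
      (Run.straight rfl (by decide) ?_)).mono (by omega) fun _ h => h
    rw [hE]
    refine Run.seq ((Run.ite (B := 200) (by decide) (fun _ => hrec)
      fun hb => absurd (hcond.2 heq) hb).mono le_rfl fun τ hτ => ?_)
    refine Run.straight rfl (by decide) ?_
    have h1 := hτ.restart
    change Rep I _ (if I.vol st.g * st.den < st.num * I.certified (st₁.top I) then
      (st.relabel I).record I else st.relabel I)
    split_ifs at h1 ⊢ with h2 h3 h3
    · exact h1
    · exact absurd h2 h3
    · exact absurd h3 h2
    · exact h1

end

section

variable {n : ℕ} {I : Input n} {st : State n} {σ τ : Mem}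

/-! #### One step of the algorithm -/

/-- The invariant of the algorithm. -/
structure Inv (I : Input n) (st : State n) : Prop where
  flow : FlowInv I st
  label : LabelInv I st
  path : PathInv I st

theorem Rep.frame (hr : Rep I σ st) (hF : Frame [12, 13] [] σ τ) : Rep I τ st := by
  refine ⟨⟨hr.out.congr (hF.1 _ (by simp)) (fun j _ => by rw [hF.1 _ (by simp)]) (hF.2 _ (by simp)),
    fun u v => ?_, fun v d => ?_, fun v d => ?_,
    hr.touched.congr (hF.1 _ (by simp)) (hF.1 _ (by simp)),
    hr.snap.congr (hF.1 _ (by simp)) (hF.2 _ (by simp)), ?_, ?_⟩, fun i v hi => ?_,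
    fun i e hi => ?_, ?_, ?_, ?_⟩
  · rw [hF.1 _ (by simp)]; exact hr.flow u v
  · rw [hF.1 _ (by simp)]; exact hr.lab v d
  · rw [hF.1 _ (by simp)]; exact hr.ptr v d
  · rw [hF.2 _ (by simp)]; exact hr.num
  · rw [hF.2 _ (by simp)]; exact hr.den
  · rw [hF.1 _ (by simp)]; exact hr.row i v hi
  · rw [hF.1 _ (by simp)]; exact hr.cap i e hi
  · rw [hF.1 _ (by simp)]; exact hr.k
  · rw [hF.1 _ (by simp)]; exact hr.d
  · rw [hF.1 _ (by simp)]; exact hr.cur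

theorem skip_rep (hr : Rep I σ st) : Rep I (Cmd.effect I Prog.skipArc σ) st.skip := by
  have hE : Cmd.effect I Prog.skipArc σ =
      σ.setNat 9 st.cur st.d (st.ptr st.cur st.d + 1) := by
    simp only [Prog.skipArc, Cmd.effect, Prog.var, Prog.ptrE, NExp.eval, hr.cur, hr.d, hr.ptr]
  have h (a : ℕ) (ha : a ≠ 9) :
      (σ.setNat 9 st.cur st.d (st.ptr st.cur st.d + 1)).nat a = σ.nat a :=
    Mem.setNat_nat_of_ne _ _ _ _ _ ha
  rw [hE]
  refine ⟨⟨hr.out.congr (h 0 (by simp)) (fun j _ => by rw [h 1 (by simp)]) rfl,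
    fun u v => ?_, fun v d => ?_, fun v d => ?_,
    hr.touched.congr (h 2 (by simp)) (h 14 (by simp)),
    HoldsCut.congr hr.snap (h 3 (by simp)) rfl, hr.num, hr.den⟩, fun i v hi => ?_,
    fun i e hi => ?_, ?_, ?_, ?_⟩
  · rw [h 7 (by simp)]; exact hr.flow u v
  · rw [h 8 (by simp)]; exact hr.lab v d
  · simp only [Mem.setNat_nat, true_and, State.skip, put, Fin.ext_iff, hr.ptr]
  · rw [h 1 (by simp)]; exact hr.row i v hi
  · rw [h 6 (by simp)]; exact hr.cap i e hi
  · rw [h 4 (by simp)]; exact hr.k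
  · rw [h 5 (by simp)]; exact hr.d
  · rw [h 11 (by simp)]; exact hr.cur

theorem canAugment_holds (hr : Rep I σ st) : Prog.canAugment.Holds I σ ↔
    0 < I.N.sinkCap st.cur ∧
      I.wt st.g (st.cur, I.N.t) ≤ I.level (st.lab st.cur st.d) + I.gap (st.top I) := by
  have h1 : (NExp.sinkCap (Prog.var 11)).eval I σ = I.N.sinkCap st.cur := by
    simp only [NExp.eval, Prog.var_eval, hr.cur, Network.sinkQuery_val]
  have h2 := Prog.wtE_eval (I := I) σ hr.flow (u := Prog.var 11) (v := .inT)
    (c := .sinkCap (Prog.var 11)) (e := (st.cur, I.N.t)) hr.cur rfl h1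
  have h3 : Prog.labE.eval I σ = st.lab st.cur st.d := by
    simp only [Prog.labE, NExp.eval, Prog.var_eval, hr.cur, hr.d, hr.lab]
  have h4 : Prog.topE.eval I σ = st.top I := by
    simp only [Prog.topE, NExp.eval, hr.lab, State.top]
  simp only [Prog.canAugment, BExp.Holds, Prog.leR_holds, h2, RExp.eval, Prog.levelE_eval,
    Prog.gapE_eval, h3, h4, NExp.eval, Prog.var_eval, hr.cur, Network.sinkQuery_val]

theorem canPush_holds (hr : Rep I σ st) {x : Fin n}
    (hx : (I.N.out st.cur)[st.ptr st.cur st.d]? = some x) (h12 : σ.nat 12 0 0 = x)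
    (h13 : σ.nat 13 0 0 = I.N.len st.cur x) : Prog.canPush.Holds I σ ↔
    x ≠ I.N.t ∧ I.N.len st.cur x < st.d ∧
      I.wt st.g (st.cur, x) + I.level (st.lab x (st.d - I.N.len st.cur x)) ≤
        I.level (st.lab st.cur st.d) := by
  have h0 : Prog.ptrE.eval I σ = st.ptr st.cur st.d := by
    simp only [Prog.ptrE, NExp.eval, Prog.var_eval, hr.cur, hr.d, hr.ptr]
  have h1 : (NExp.cap (Prog.var 11) Prog.ptrE).eval I σ = I.N.U st.cur x := by
    simp only [NExp.eval, Prog.var_eval, hr.cur, h0, I.N.entryQuery_val _ _ hx,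
      I.N.U_of_getElem? _ hx]
  have h2 := Prog.wtE_eval (I := I) σ hr.flow (u := Prog.var 11) (v := Prog.var 12)
    (c := .cap (Prog.var 11) Prog.ptrE) (e := (st.cur, x)) hr.cur h12 h1
  have h3 : Prog.labE.eval I σ = st.lab st.cur st.d := by
    simp only [Prog.labE, NExp.eval, Prog.var_eval, hr.cur, hr.d, hr.lab]
  simp only [Prog.canPush, BExp.Holds, Prog.leR_holds, Prog.ne_holds, h2, RExp.eval,
    Prog.levelE_eval, h3, Prog.var_eval, h12, h13, hr.d, NExp.eval, ne_eq, Fin.ext_iff, hr.lab]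

theorem guard_holds (hr : BaseRep I σ st) :
    Prog.guard.Holds I σ ↔ I.certified (st.top I) < I.thr := by
  simp only [Prog.guard, BExp.Holds, Prog.certE_eval, Prog.thrE_eval, hr.lab, State.top]

/-- The slack in the augmentation test is at least `1/(4h)` and levels are nonnegative, so a refused
sink edge has a substantial excess weight. This is why adjacency lists are read only at vertices in
`Sat`. -/
theorem sat_of_not_augment (H : I.Good) (hp : PathInv I st)
    (h : ¬ (0 < I.N.sinkCap st.cur ∧
      I.wt st.g (st.cur, I.N.t) ≤ I.level (st.lab st.cur st.d) + I.gap (st.top I))) :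
    I.Sat st.g st.cur := by
  refine ⟨hp.cur_ne, ?_⟩
  rcases Nat.eq_zero_or_pos (I.N.sinkCap st.cur) with h0 | h0
  · exact Or.inl h0
  · have h1 := not_le.1 fun h1 => h ⟨h0, h1⟩
    have h2 := H.le_gap (st.top I)
    have h3 := H.level_nonneg (st.lab st.cur st.d)
    exact Or.inr (by linarith)

/-- The time for a unit of work. -/
def unitTime : ℕ := 10000

theorem advance_run (H : I.Good) (hi : Inv I st) (hr : Rep I σ st) (hsat : I.Sat st.g st.cur)
    {x : Fin n} (hx : (I.N.out st.cur)[st.ptr st.cur st.d]? = some x) (h12 : σ.nat 12 0 0 = x)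
    (h13 : σ.nat 13 0 0 = I.N.len st.cur x) :
    ∃ st' T, Run I (.ite Prog.canPush Prog.push Prog.skipArc) σ T (Rep I · st') ∧ Inv I st' ∧
      -- The `2000` is set aside for the loop guard, the tests and the queries that precede this
      -- command in a step.
      2000 + T + unitTime * st.work I ≤ unitTime * st'.work I := by
  have hmem := List.mem_of_getElem? hx
  unfold unitTime
  by_cases hc : Prog.canPush.Holds I σ
  · obtain ⟨h1, h2, h3⟩ := (canPush_holds hr hx h12 h13).1 hc
    refine ⟨st.push I x, 200 + 1000 * (I.h + 1), Run.ite (by decide)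
      (fun _ => push_run hi.path hr hx h12 h13) (fun h => absurd hc h),
      ⟨hi.flow.push x, hi.label.push x, hi.path.push H hmem h1 h2 h3 hsat⟩, ?_⟩
    have := State.work_push hi.path hmem h2
    omega
  · refine ⟨st.skip, 200 + 200, Run.ite (by decide) (fun h => absurd h hc)
      (fun _ => Run.straight rfl (by decide) (skip_rep hr)),
      ⟨hi.flow.skip, hi.label.skip hi.path hsat
        (List.getElem?_eq_some_iff.1 hx).1 ?_, hi.path.skip⟩, ?_⟩
    · intro y hy h1 h2
      obtain rfl := Option.some.inj (hx.symm.trans hy)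
      by_contra! h3
      exact hc ((canPush_holds hr hx h12 h13).2 ⟨h1, h2, h3⟩)
    · have := State.work_skip hi.path
      omega

theorem relabel_step (H : I.Good) (hi : Inv I st) (hr : Rep I σ st) (hsat : I.Sat st.g st.cur)
    (hrun : I.certified (st.top I) < I.thr) (hptr : I.N.outDeg st.cur ≤ st.ptr st.cur st.d)
    (hsink : 0 < I.N.sinkCap st.cur →
      I.level (st.lab st.cur st.d) + I.gap (st.top I) < I.wt st.g (st.cur, I.N.t)) :
    ∃ st' T, Run I Prog.relabel σ T (Rep I · st') ∧ Inv I st' ∧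
      2000 + T + unitTime * st.work I ≤ unitTime * st'.work I := by
  unfold unitTime
  have hl := hi.label.relabel H hi.path hsat hrun hptr hsink
  have hp : PathInv I (st.relabel I) := PathInv.restart H _
  obtain ⟨h1, h2⟩ := relabel_run H hi.flow hr
  by_cases h : st.cur = I.N.s ∧ st.d = I.h
  · have hw := State.work_relabel_top hi.label hi.path h
    have h3 := h2 h
    split_ifs at h3 with h4
    · refine ⟨_, _, h3, ⟨hi.flow.record H hl h4, hl.record, hp.record⟩, ?_⟩
      change _ ≤ 10000 * (st.relabel I).work I
      omega
    · refine ⟨_, _, h3, ⟨hi.flow.relabel_of_le H (not_lt.1 h4), hl, hp⟩, ?_⟩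
      omega
  · have hw := State.work_relabel hi.label hi.path
    exact ⟨_, _, h1 h, ⟨hi.flow.relabel_of_ne h, hl, hp⟩, by omega⟩

theorem step_run (H : I.Good) (hi : Inv I st) (hr : Rep I σ st)
    (hrun : I.certified (st.top I) < I.thr) :
    ∃ st' T, Run I Prog.step σ T (Rep I · st') ∧ Inv I st' ∧
      Prog.guard.cost + T + unitTime * st.work I ≤ unitTime * st'.work I := by
  have hg : Prog.guard.cost ≤ 200 := by decide
  by_cases hc : Prog.canAugment.Holds I σ
  · obtain ⟨h1, h2⟩ := (canAugment_holds hr).1 hc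
    obtain ⟨b, hb, hb', hrun'⟩ := augment_run H hi.path hr h1
    refine ⟨st.augment I b, 200 + 3000 * (I.h + 1), Run.ite (by decide) (fun _ => hrun')
      (fun h => absurd hc h), ⟨hi.flow.augment H hi.path hrun h1 h2 hb hb',
      hi.label.augment H b, PathInv.restart H _⟩, ?_⟩
    have := State.work_augment st I b
    unfold unitTime
    omega
  have hc' := mt (canAugment_holds hr).2 hc
  have hsat := sat_of_not_augment H hi.path hc'
  have hptr : (Prog.ptrE.eval I σ) = st.ptr st.cur st.d := by
    simp only [Prog.ptrE, NExp.eval, Prog.var_eval, hr.cur, hr.d, hr.ptr]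
  have hdeg : BExp.Holds I σ (.ltN Prog.ptrE (.deg (Prog.var 11))) ↔
      st.ptr st.cur st.d < I.N.outDeg st.cur := by
    simp only [BExp.Holds, hptr, NExp.eval, Prog.var_eval, hr.cur, Network.degQuery_val]
  by_cases hd : st.ptr st.cur st.d < I.N.outDeg st.cur
  · obtain ⟨x, hx⟩ : ∃ x, (I.N.out st.cur)[st.ptr st.cur st.d]? = some x :=
      ⟨_, List.getElem?_eq_getElem hd⟩
    set σ₁ := (σ.setNat 12 0 0 x).setNat 13 0 0 (I.N.len st.cur x) with hσ₁
    have hE : Cmd.effect I (Cmd.block [Prog.set 12 (.head (Prog.var 11) Prog.ptrE),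
        Prog.set 13 (.len (Prog.var 11) Prog.ptrE)]) σ = σ₁ := by
      simp only [Cmd.block, Cmd.effect, Prog.set, Prog.var, Prog.ptrE, NExp.eval, Mem.setNat_nat]
      simp [hr.cur, hr.d, hr.ptr, I.N.entryQuery_val _ _ hx, hσ₁]
    have hr₁ : Rep I σ₁ st := hr.frame
      (((Frame.refl _ _ _).setNat (by simp) _ _ _).setNat (by simp) _ _ _)
    obtain ⟨st', T, h1, h2, h3⟩ := advance_run H hi hr₁ hsat hx
      (by simp [hσ₁, Mem.setNat_nat]) (by simp [hσ₁, Mem.setNat_nat])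
    refine ⟨st', 200 + (200 + (200 + T)), Run.ite (by decide) (fun h => absurd h hc)
      (fun _ => Run.ite (by decide) (fun _ => Run.seq (Run.straight rfl (by decide) ?_))
        (fun h => absurd (hdeg.2 hd) h)), h2, by omega⟩
    rw [hE]
    exact h1
  · obtain ⟨st', T, h1, h2, h3⟩ := relabel_step H hi hr hsat hrun (not_lt.1 hd)
      fun h0 => not_le.1 fun h => hc' ⟨h0, h⟩
    exact ⟨st', 200 + (200 + T), Run.ite (by decide) (fun h => absurd h hc)
      (fun _ => Run.ite (by decide) (fun h => absurd (hdeg.1 h) hd) (fun _ => h1)), h2, by omega⟩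

end

section

variable {n : ℕ} {I : Input n} {st : State n} {σ τ : Mem}

/-! #### The whole algorithm -/

theorem start_rep : Rep I (Cmd.effect I (Cmd.block [Prog.restart, Prog.setr 4 (Prog.num 1)])
    Mem.init) (State.start I) := by
  -- The zero memory represents the start apart from the numerator `1`, which is written after the
  -- restart.
  have h0 : BaseRep I Mem.init { State.start I with num := 0 } := by
    refine ⟨⟨rfl, fun j a h => ?_⟩, fun _ _ => rfl, fun _ _ => rfl, fun _ _ => rfl,
      ⟨rfl, fun i e h => ?_⟩, ⟨fun j hj => absurd hj (Nat.not_lt_zero _), fun _ _ _ => rfl⟩,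
      rfl, rfl⟩
    · simp [State.start] at h
    · simp [State.start] at h
  have h1 := h0.restart
  set σ := Cmd.effect I Prog.restart Mem.init with hσ
  have hE : Cmd.effect I (Cmd.block [Prog.restart, Prog.setr 4 (Prog.num 1)]) Mem.init =
      σ.setReal 4 0 0 1 := by
    simp only [Cmd.block, Cmd.effect, Prog.setr, Prog.num_eval, NExp.eval, ← hσ, Nat.cast_one]
  rw [hE]
  refine ⟨⟨h1.out.congr rfl (fun _ _ => rfl) ?_, h1.flow, h1.lab, h1.ptr, h1.touched.congr rfl rfl,
    HoldsCut.congr h1.snap rfl ?_, ?_, ?_⟩, h1.row, h1.cap, h1.k, h1.d, h1.cur⟩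
  · simp [Mem.setReal_real_of_ne]
  · simp [Mem.setReal_real_of_ne]
  · simp [Mem.setReal_real, State.start]
  · rw [Mem.setReal_real_of_ne _ _ _ _ _ (by norm_num)]; exact h1.den

theorem sum_range_eq_sum_map {α : Type*} (l : List α) (F : α → ℝ) (G : ℕ → ℝ)
    (h : ∀ j a, l[j]? = some a → G j = F a) :
    ∑ j ∈ Finset.range l.length, G j = (l.map F).sum := by
  induction l generalizing G with
  | nil => simp
  | cons a l ih =>
    rw [List.length_cons, Finset.sum_range_succ', ih (fun j => G (j + 1)) fun j b hb => h (j + 1) b hb,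
      h 0 a rfl, List.map_cons, List.sum_cons, add_comm]

theorem OutRep.holdsFlow (H : I.Good) (hf : FlowInv I st) (h : OutRep I st.augs τ) :
    HoldsFlow I τ (flowOf I.eta st.augs) := by
  refine ⟨fun j hj => ?_, fun P => ?_⟩
  · rw [h.1] at hj
    obtain ⟨h1, h2⟩ := h.2 j _ (List.getElem?_eq_getElem hj)
    refine ⟨?_, _, hf.augs_path _ (List.getElem_mem hj), h1⟩
    rw [h2]
    exact mul_nonneg H.eta_pos.le (Nat.cast_nonneg _)
  · rw [h.1, flowOf_apply, sum_range_eq_sum_map st.augs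
      (fun a => I.eta * ((if a.1 = P then a.2 else 0 : ℕ) : ℝ)), List.sum_map_mul_left]
    · rw [Nat.cast_list_sum, List.map_map]; rfl
    · intro j a ha
      obtain ⟨h1, h2⟩ := h.2 j a ha
      rw [h1, h2]
      have h3 : a.1.map Fin.val = P.map Fin.val ↔ a.1 = P :=
        (List.map_injective_iff.2 Fin.val_injective).eq_iff
      by_cases h4 : a.1 = P <;> simp [h3, h4]

theorem out_run {L : List (Fin n × Fin n)} {g : Fin n × Fin n → ℕ}
    (ht : TouchedRep I L σ) (hg : FlowRep g σ) (h10 : σ.nat 10 0 0 = 0) :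
    Run I Prog.outLoop σ (L.length * 400 + 200) fun τ => Frame [10] [2] σ τ ∧
      τ.real 2 0 0 = σ.real 2 0 0 ∧ ∀ (i : ℕ) e, L[i]? = some e → τ.real 2 1 i = I.weight g e := by
  refine Run.mono (Run.loop L.length (fun j τ => Frame [10] [2] σ τ ∧ τ.nat 10 0 0 = j ∧
    τ.real 2 0 0 = σ.real 2 0 0 ∧
    ∀ (i : ℕ) e, i < j → L[i]? = some e → τ.real 2 1 i = I.weight g e)
    (B := 200) (T := 200) (by decide)
    ⟨Frame.refl _ _ _, h10, rfl, fun i e hi => absurd hi (Nat.not_lt_zero _)⟩ ?_ ?_) le_rfl ?_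
  · rintro j hj τ ⟨hF, hj10, hd, hall⟩
    have ht' : TouchedRep I L τ := ht.congr (hF.1 2 (by simp)) (hF.1 14 (by simp))
    have hg' : FlowRep g τ := by unfold FlowRep; rw [hF.1 7 (by simp)]; exact hg
    obtain ⟨e, he⟩ : ∃ e, L[j]? = some e := ⟨_, List.getElem?_eq_getElem hj⟩
    constructor
    · simp only [BExp.Holds, Prog.var_eval, hj10, ht'.1]; exact hj
    · refine Run.straight rfl (by decide) ?_
      have hw := touchedWt_eval ht' hg' (x := Prog.var 10) (e := e)
        (by rw [Prog.var_eval, hj10]; exact he)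
      have hE : Cmd.effect I (.seq (.setR 2 (.const 1) (Prog.var 10)
          (.div (.add (Prog.touchedWt (Prog.var 10)) (Prog.num 1)) Prog.thrE)) (Prog.inc 10)) τ =
          (τ.setReal 2 1 j (I.weight g e)).setNat 10 0 0 (j + 1) := by
        simp [Cmd.effect, RExp.eval, hw, Prog.thrE_eval, Prog.num_eval, Prog.inc, Prog.set,
          NExp.eval, Prog.var_eval, hj10, Input.weight]
      rw [hE]
      refine ⟨(hF.setReal (by simp) _ _ _).setNat (by simp) _ _ _, by simp [Mem.setNat_nat],
        by simpa [Mem.setReal_real] using hd, ?_⟩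
      intro i e' hi he'
      rcases Nat.lt_succ_iff_lt_or_eq.1 hi with h | rfl
      · have := hall i e' h he'
        simpa [Mem.setReal_real, h.ne] using this
      · rw [he] at he'
        obtain rfl := Option.some.inj he'
        simp [Mem.setReal_real]
  · rintro τ ⟨hF, hj10, -⟩
    simp only [BExp.Holds, Prog.var_eval, hj10]
    rw [hF.1 2 (by simp), ht.1]
    exact lt_irrefl _
  · rintro τ ⟨hF, -, hd, h1⟩
    exact ⟨hF, hd, fun i e he => h1 i e (List.getElem?_eq_some_iff.1 he).1 he⟩

theorem TouchedRep.holdsCut {L : List (Fin n × Fin n)} {g : Fin n × Fin n → ℕ}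
    (h : TouchedRep I L τ) (hE : ∀ e ∈ L, e ∈ I.N.edges) (hg : ∀ e, e ∉ L → g e = 0)
    (hd : τ.real 2 0 0 = 1 / I.thr)
    (hw : ∀ (i : ℕ) e, L[i]? = some e → τ.real 2 1 i = I.weight g e) :
    HoldsCut I τ 2 (I.weight g) := by
  refine ⟨fun j hj => ?_, fun e _ hall => ?_⟩
  · rw [h.1] at hj
    have he := List.getElem?_eq_getElem hj
    obtain ⟨h1, h2, -⟩ := h.2 j _ he
    exact ⟨_, hE _ (List.getElem_mem hj), h1, h2, (hw j _ he).symm⟩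
  · have hnot : e ∉ L := by
      intro he
      obtain ⟨j, hj⟩ := List.mem_iff_getElem?.1 he
      obtain ⟨h1, h2, -⟩ := h.2 j e hj
      exact hall j (h.1.symm ▸ (List.getElem?_eq_some_iff.1 hj).1) ⟨h1, h2⟩
    rw [hd, Input.weight, Input.wt_of_eq_zero (hg e hnot), zero_add]

theorem finish_run (H : I.Good) (hf : FlowInv I st) (hr : BaseRep I σ st) :
    Run I (.seq (Cmd.block [Prog.setr 2 (.div (Prog.num 1) Prog.thrE), Prog.set 10 (.const 0)])
      Prog.outLoop) σ (400 * st.touched.length + 400) fun τ =>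
        HoldsFlow I τ (flowOf I.eta st.augs) ∧ HoldsCut I τ 2 (I.weight st.g) ∧
          HoldsCut I τ 3 st.cut := by
  set σ₁ := (σ.setReal 2 0 0 (1 / I.thr)).setNat 10 0 0 0 with hσ₁
  have hE : Cmd.effect I (Cmd.block [Prog.setr 2 (.div (Prog.num 1) Prog.thrE),
      Prog.set 10 (.const 0)]) σ = σ₁ := by
    simp [Cmd.block, Cmd.effect, Prog.setr, Prog.set, Prog.num_eval, NExp.eval, RExp.eval,
      Prog.thrE_eval, hσ₁]
  refine (Run.seq (S := 200) (T := st.touched.length * 400 + 200)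
    (Run.straight rfl (by decide) ?_)).mono (by omega) fun _ h => h
  rw [hE]
  have hF₁ : Frame [10] [2] σ σ₁ := ((Frame.refl _ _ _).setReal (by simp) _ _ _).setNat (by simp) _ _ _
  have ht : TouchedRep I st.touched σ₁ := hr.touched.congr (hF₁.1 2 (by simp)) (hF₁.1 14 (by simp))
  have hg : FlowRep st.g σ₁ := by unfold FlowRep; rw [hF₁.1 7 (by simp)]; exact hr.flow
  refine (out_run ht hg (by simp [hσ₁, Mem.setNat_nat])).mono le_rfl ?_
  rintro τ ⟨hF₂, hd, hw⟩
  have hF := hF₁.trans hF₂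
  refine ⟨OutRep.holdsFlow H hf (hr.out.congr (hF.1 0 (by simp))
    (fun j _ => by rw [hF.1 1 (by simp)]) (hF.2 0 (by simp))),
    TouchedRep.holdsCut (hr.touched.congr (hF.1 2 (by simp)) (hF.1 14 (by simp)))
      (fun e he => hf.touched_edges H he) (fun e he => ?_)
      (hd.trans (by simp [hσ₁, Mem.setReal_real])) hw,
    HoldsCut.congr hr.snap (hF.1 3 (by simp)) (hF.2 3 (by simp))⟩
  have := (hf.mem_touched e).not.1 he
  omega

theorem program_exec (H : I.Good) : ∃ (T : ℕ) (τ : Mem) (st : State n),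
    Exec I Prog.program Mem.init T τ ∧ FlowInv I st ∧ LabelInv I st ∧
      I.thr ≤ I.certified (st.top I) ∧ T ≤ unitTime * (st.work I + (st.touched.length + 2)) ∧
      HoldsFlow I τ (flowOf I.eta st.augs) ∧ HoldsCut I τ 2 (I.weight st.g) ∧
      HoldsCut I τ 3 st.cut := by
  obtain ⟨T₁, hT₁, hx₁⟩ := Run.exec_effect (I := I)
    (p := Cmd.block [Prog.restart, Prog.setr 4 (Prog.num 1)]) rfl Mem.init
  have hT₁' : T₁ ≤ 200 := hT₁.trans (by decide)
  -- The bound with `c = 1` serves termination only. The time is returned in terms of the work of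
  -- the final state, so that it can be estimated for every `c`.
  have hB : ∀ τ x, Rep I τ x ∧ Inv I x → unitTime * x.work I ≤
      unitTime * ⌈workConst * I.par ^ 18 * (1 + I.N.localSize 1)⌉₊ := by
    rintro τ x ⟨-, hi⟩
    refine Nat.mul_le_mul_left _ (Nat.cast_le (α := ℝ).1 (le_trans ?_ (Nat.le_ceil _)))
    have h1 := work_le H hi.flow hi.label le_rfl
    have h2 : (0 : ℝ) ≤ x.touched.length := Nat.cast_nonneg _
    linarith
  obtain ⟨T₂, τ₂, st, hx₂, ⟨hr, hi⟩, hb, hT₂⟩ := Run.loop_potential (I := I) (b := Prog.guard)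
    (p := Prog.step) (fun τ x => Rep I τ x ∧ Inv I x) (fun x => unitTime * x.work I) _ hB
    (by decide) (fun τ x ⟨hr, hi⟩ hb => by
      obtain ⟨y, T, h1, h2, h3⟩ := step_run H hi hr ((guard_holds hr.toBaseRep).1 hb)
      exact ⟨y, T, h1.mono le_rfl fun _ h => ⟨h, h2⟩, h3⟩)
    ⟨start_rep, .start H, .start H, PathInv.restart H (State.start I)⟩
  have hg : Prog.guard.cost ≤ 200 := by decide
  rw [guard_holds hr.toBaseRep, not_lt] at hb
  obtain ⟨T₃, hT₃, τ, hx₃, h1, h2, h3⟩ := finish_run H hi.flow hr.toBaseRep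
  refine ⟨_, τ, st, .seq hx₁ (.seq hx₂ hx₃), hi.flow, hi.label, hb, ?_, h1, h2, h3⟩
  unfold unitTime at *
  omega

end

end LocalFlow

/-! ### The theorem assembled -/

theorem mainTheorem2 :
    ∃ (prog : Cmd) (k : ℕ) (K C a b : ℝ), 0 < a ∧
      ∀ (n : ℕ) (N : Network n) (h : ℕ) (δ ζ : ℝ),
        1 ≤ h → 0 < δ → δ < 1 → ζ = 6 / δ + 3 → 2 ≤ N.m →
        (∀ v, N.t ∈ N.out v → N.len v N.t = 1) →
        (∑ e ∈ N.edges, (N.U e.1 e.2 : ℝ)) ≤ (N.m : ℝ) ^ ζ →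
        ∃ (T : ℕ) (τ : Mem), Exec ⟨N, h, δ⟩ prog Mem.init T τ ∧
          (∀ c : ℝ, 1 ≤ c →
            (T : ℝ) ≤ K * (h + 1 / δ + Real.log n) ^ k * (1 + N.localSize c)) ∧
          ∃ (f : List (Fin n) →₀ ℝ) (w wmin : Fin n × Fin n → ℝ) (η : ℝ),
            HoldsFlow ⟨N, h, δ⟩ τ f ∧ HoldsCut ⟨N, h, δ⟩ τ 2 w ∧ HoldsCut ⟨N, h, δ⟩ τ 3 wmin ∧
            -- the first pair
            N.IsFeasiblePair h f w ∧
            ((∃ P, N.IsHPath h P) → N.cutSize w ≤ C * (Real.log n / δ) * flowValue f) ∧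
            a * (δ ^ 2 / Real.log N.m) ≤ η ∧ η ≤ b * (δ ^ 2 / Real.log N.m) ∧
            (∀ P, ∃ z : ℕ, f P / η = z) ∧
            (∀ e ∈ N.edges,
              w e = (1 + δ / 6) ^ (edgeFlow f e / (η * N.U e.1 e.2)) / (N.m : ℝ) ^ ζ) ∧
            -- the second pair
            N.IsFeasiblePair h f wmin ∧
            N.cutSize wmin ≤ (2 + δ) * flowValue f := by

  -- The constants come from `work_le`, `cutSize_weight_le` and `eta_bounds`.
  refine ⟨Prog.program, 18, unitTime * workConst, 140, 1 / 70, 1 / 36, by norm_num, ?_⟩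
  intro n N h δ ζ hh hδ hδ' hζ hm hlen hcap
  subst hζ
  set I : Input n := ⟨N, h, δ⟩ with hI
  have H : I.Good := ⟨hh, hδ, hδ', hm, hlen, hcap⟩
  obtain ⟨T, τ, st, hx, hf, hl, hdone, hT, h1, h2, h3⟩ := program_exec H
  have hden := hf.den_pos H hdone
  obtain ⟨hη, hη'⟩ := eta_bounds H
  refine ⟨T, τ, hx, fun c hc => ?_, flowOf I.eta st.augs, I.weight st.g, st.cut, I.eta,
    h1, h2, h3, ⟨hf.isHLengthFlow H, hl.isMovingCut H hdone⟩, LocalFlow.cutSize_weight_le H hf hl hdone,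
    hη, hη', fun P => ⟨(st.augs.map fun a => if a.1 = P then a.2 else 0).sum, ?_⟩,
    fun e _ => weight_eq H st e,
    ⟨hf.isHLengthFlow H, (hf.cut hden).1⟩, ?_⟩
  · have hw := work_le H hf hl hc
    calc (T : ℝ) ≤ unitTime * (st.work I + (st.touched.length + 2)) := by exact_mod_cast hT
      _ ≤ unitTime * (workConst * I.par ^ 18 * (1 + I.N.localSize c)) :=
        mul_le_mul_of_nonneg_left hw (Nat.cast_nonneg _)
      _ = unitTime * workConst * I.par ^ 18 * (1 + I.N.localSize c) := by ring
  · rw [flowOf_apply, mul_div_cancel_left₀ _ H.eta_pos.ne']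
  · rw [(hf.cut hden).2, flowValue_flowOf]
    exact hf.num_div_den_le H hdone hden
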